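/- Let $V=\bigoplus_{n\in\mathbb Z}V_n$ be a vertex operator algebra $(V,Y,\mathbf 1,\omega)$ over $\mathbb C$ (so $\dim V_n<\infty$ for all $n$, $V_n=0$ for $n\ll 0$, the vacuum, creation and Jacobi axioms hold, $Y(\omega,z)=\sum_{n\in\mathbb Z}L(n)z^{-n-2}$ where the operators $L(n)$ satisfy $$[L(m),L(n)]=(m-n)L(m+n)+\delta_{m+n,0}\tfrac{m^3-m}{12}\,c\quad (m,n\in\mathbb Z),$$ $L(0)$ acts on $V_n$ as the scalar $n$, and $\frac{d}{dz}Y(v,z)=Y(L(-1)v,z)$). Suppose that $V$ is simple, that $V_0=\mathbb C\mathbf 1$, that $L(1)V_1=0$, and that the central charge $c$ is a real number with $c>1$. Then $V$ is a completely reducible module for the Virasoro algebra (where $L_n$ acts as $L(n)$ and the central element as the scalar $c$); that is, $V$ is a direct sum of irreducible Virasoro submodules. -/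

import Mathlib

open scoped VertexOperator

noncomputable section

/-! ### The Virasoro Lie algebra -/

/-- The Virasoro algebra `⨁ ℂ L_n ⊕ ℂ C`: the pair `(f, a)` stands for `∑ f n • L_n + a • C`. -/
def Virasoro : Type := (ℤ →₀ ℂ) × ℂ

namespace Virasoro

instance : AddCommGroup Virasoro := inferInstanceAs (AddCommGroup ((ℤ →₀ ℂ) × ℂ))
instance : Module ℂ Virasoro := inferInstanceAs (Module ℂ ((ℤ →₀ ℂ) × ℂ))

/-- The generator `L_n`. -/
def L (n : ℤ) : Virasoro := (Finsupp.single n 1, 0)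

/-- The central element `C`. -/
def C : Virasoro := (0, 1)

/-- Linear maps out of the Virasoro algebra, prescribed on the basis `L_n`, `C`. -/
def lift {M : Type*} [AddCommGroup M] [Module ℂ M] (f : ℤ → M) (z : M) : Virasoro →ₗ[ℂ] M :=
  LinearMap.coprod (Finsupp.linearCombination ℂ f) (LinearMap.toSpanSingleton ℂ M z)

@[simp] theorem lift_L {M : Type*} [AddCommGroup M] [Module ℂ M] (f : ℤ → M) (z : M) (n : ℤ) :
    lift f z (L n) = f n := by
  change LinearMap.coprod _ _ ((Finsupp.single n 1, 0) : (ℤ →₀ ℂ) × ℂ) = _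
  simp

@[simp] theorem lift_C {M : Type*} [AddCommGroup M] [Module ℂ M] (f : ℤ → M) (z : M) :
    lift f z C = z := by
  change LinearMap.coprod _ _ ((0, 1) : (ℤ →₀ ℂ) × ℂ) = _
  simp

/-- The elements `L_n` and `C` span the Virasoro algebra. -/
theorem induction {p : Virasoro → Prop} (hL : ∀ n, p (L n)) (hC : p C)
    (hadd : ∀ x y, p x → p y → p (x + y)) (hsmul : ∀ (a : ℂ) x, p x → p (a • x))
    (x : Virasoro) : p x := by
  have h0 : p 0 := by simpa using hsmul 0 _ hC
  obtain ⟨f, a⟩ := x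
  have h1 : ∀ f : ℤ →₀ ℂ, p ((f, 0) : (ℤ →₀ ℂ) × ℂ) := by
    intro f
    induction f using Finsupp.induction_linear with
    | zero => exact h0
    | add f g hf hg =>
      have : ((f + g, 0) : (ℤ →₀ ℂ) × ℂ) = (f, 0) + (g, 0) := by simp
      rw [this]; exact hadd _ _ hf hg
    | single n b =>
      have : ((Finsupp.single n b, 0) : (ℤ →₀ ℂ) × ℂ) = b • (Finsupp.single n 1, 0) := by simp
      rw [this]; exact hsmul b _ (hL n)
  have : ((f, a) : (ℤ →₀ ℂ) × ℂ) = (f, 0) + a • ((0, 1) : (ℤ →₀ ℂ) × ℂ) := by simp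
  rw [this]
  exact hadd _ _ (h1 f) (hsmul a _ hC)

/-- The bracket of two basis vectors,
`[L_m, L_n] = (m - n) L_{m+n} + δ_{m+n,0} (m³ - m)/12 C`. -/
def bracketL (m n : ℤ) : Virasoro :=
  ((m : ℂ) - n) • L (m + n) + (if m + n = 0 then ((m : ℂ) ^ 3 - m) / 12 else 0) • C

/-- The bilinear extension of `bracketL`, with `C` central. -/
def bracketLin : Virasoro →ₗ[ℂ] Virasoro →ₗ[ℂ] Virasoro :=
  lift (fun m => lift (fun n => bracketL m n) 0) 0

instance : Bracket Virasoro Virasoro := ⟨fun x y => bracketLin x y⟩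

theorem bracket_def (x y : Virasoro) : ⁅x, y⁆ = bracketLin x y := rfl

@[simp] theorem bracketLin_L_L (m n : ℤ) : bracketLin (L m) (L n) = bracketL m n := by
  simp [bracketLin]

@[simp] theorem bracketLin_C_left (x : Virasoro) : bracketLin C x = 0 := by
  simp [bracketLin]

@[simp] theorem bracketLin_C_right (x : Virasoro) : bracketLin x C = 0 := by
  induction x using Virasoro.induction with
  | hL n => simp [bracketLin]
  | hC => simp
  | hadd x y hx hy => simp [hx, hy]
  | hsmul a x hx => simp [hx]

theorem bracketL_swap (m n : ℤ) : bracketL m n = - bracketL n m := by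
  unfold bracketL
  rw [add_comm n m]
  split_ifs with h
  · obtain rfl : n = -m := by omega
    push_cast
    module
  · module

theorem bracketLin_swap (x y : Virasoro) : bracketLin x y = - bracketLin y x := by
  induction x using Virasoro.induction with
  | hL m =>
    induction y using Virasoro.induction with
    | hL n => simpa using bracketL_swap m n
    | hC => simp
    | hadd x y hx hy => simp [hx, hy, add_comm]
    | hsmul a x hx => simp [hx]
  | hC => simp
  | hadd x y hx hy => simp [hx, hy, add_comm]
  | hsmul a x hx => simp [hx]

theorem leibniz_L (k m n : ℤ) :
    bracketLin (L k) (bracketL m n)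
      = bracketLin (bracketL k m) (L n) + bracketLin (L m) (bracketL k n) := by
  simp only [bracketL, map_add, map_smul, LinearMap.add_apply, LinearMap.smul_apply,
    bracketLin_L_L, bracketLin_C_left, bracketLin_C_right, smul_zero, add_zero]
  rw [show m + (k + n) = k + (m + n) by ring, show k + m + n = k + (m + n) by ring]
  split_ifs with h
  · obtain rfl : k = -(m + n) := by omega
    push_cast
    module
  · push_cast
    module

theorem leibniz_lin (x y z : Virasoro) :
    bracketLin x (bracketLin y z)
      = bracketLin (bracketLin x y) z + bracketLin y (bracketLin x z) := by
  induction x using Virasoro.induction with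
  | hL k =>
    induction y using Virasoro.induction with
    | hL m =>
      induction z using Virasoro.induction with
      | hL n => simpa using leibniz_L k m n
      | hC => simp
      | hadd x y hx hy => simp only [map_add, hx, hy]; abel
      | hsmul a x hx => simp only [map_smul, hx, smul_add]
    | hC => simp
    | hadd x y hx hy => simp only [map_add, LinearMap.add_apply, hx, hy]; abel
    | hsmul a x hx => simp only [map_smul, LinearMap.smul_apply, hx, smul_add]
  | hC => simp
  | hadd x y hx hy => simp only [map_add, LinearMap.add_apply, hx, hy]; abel
  | hsmul a x hx => simp only [map_smul, LinearMap.smul_apply, hx, smul_add]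

instance : LieRing Virasoro where
  add_lie x y z := by simp [bracket_def]
  lie_add x y z := by simp [bracket_def]
  lie_self x := by
    have h : (2 : ℂ) • bracketLin x x = 0 := by
      rw [two_smul]; exact eq_neg_iff_add_eq_zero.mp (bracketLin_swap x x)
    exact (smul_eq_zero.mp h).resolve_left two_ne_zero
  leibniz_lie x y z := leibniz_lin x y z

instance : LieAlgebra ℂ Virasoro where
  lie_smul a x y := by simp [bracket_def]

/-- Operators `T n` satisfying the Virasoro relations with central charge `c` turn the bracket of
the Virasoro algebra into the commutator of operators. -/
theorem lift_bracket {V : Type*} [AddCommGroup V] [Module ℂ V] (T : ℤ → Module.End ℂ V) (c : ℂ)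
    (hT : ∀ m n : ℤ, T m * T n - T n * T m = ((m : ℂ) - n) • T (m + n)
      + (if m + n = 0 then ((m : ℂ) ^ 3 - m) / 12 * c else 0) • (1 : Module.End ℂ V))
    (x y : Virasoro) :
    lift T (c • (1 : Module.End ℂ V)) ⁅x, y⁆
      = lift T (c • 1) x * lift T (c • 1) y - lift T (c • 1) y * lift T (c • 1) x := by
  rw [bracket_def]
  induction x using Virasoro.induction with
  | hL m =>
    induction y using Virasoro.induction with
    | hL n =>
      simp only [bracketLin_L_L, lift_L, hT, bracketL, map_add, map_smul, lift_C, smul_smul,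
        ite_mul, zero_mul]
    | hC => simp
    | hadd x y hx hy => simp only [map_add, hx, hy, mul_add, add_mul]; abel
    | hsmul a x hx => simp only [map_smul, hx, mul_smul_comm, smul_mul_assoc, smul_sub]
  | hC => simp
  | hadd x y hx hy => simp only [map_add, LinearMap.add_apply, hx, hy, mul_add, add_mul]; abel
  | hsmul a x hx =>
    simp only [map_smul, LinearMap.smul_apply, hx, mul_smul_comm, smul_mul_assoc, smul_sub]

end Virasoro

/-! ### Vertex operator algebras -/

/-- A vertex operator algebra `(V, Y, 𝟏, ω)` over `ℂ`.  The vertex operator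
`Y(u, z) = ∑ u_n z^{-n-1}` sends each vector to a Laurent series (so `u_n v = 0` for `n ≫ 0`),
and its mode `u_n` is written `(Y u)[[n]]`.  The operators `L(n) = ω_{n+1}` are the modes
of `ω`. -/
class VertexOperatorAlgebra (V : Type*) [AddCommGroup V] [Module ℂ V] where
  /-- The state-field correspondence. -/
  Y : V →ₗ[ℂ] VertexOperator ℂ V
  /-- The vacuum vector `𝟏`. -/
  vacuum : V
  /-- The conformal (Virasoro) vector `ω`. -/
  conformal : V
  /-- The central charge `c`. -/
  centralCharge : ℂ
  /-- The homogeneous subspace `V_n`. -/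
  weightSpace : ℤ → Submodule ℂ V
  isInternal : DirectSum.IsInternal weightSpace
  finite_weightSpace : ∀ n, Module.Finite ℂ (weightSpace n)
  weightSpace_eq_bot : ∃ N : ℤ, ∀ n < N, weightSpace n = ⊥
  /-- `Y(𝟏, z) = id`. -/
  vacuum_mode : ∀ n : ℤ, (Y vacuum)[[n]] = if n = -1 then 1 else 0
  /-- `Y(v, z)𝟏` has only nonnegative powers of `z` ... -/
  mode_vacuum : ∀ (v : V) (n : ℕ), ((Y v)[[(n : ℤ)]]) vacuum = 0
  /-- ... and constant term `v`. -/
  creation : ∀ v : V, ((Y v)[[-1]]) vacuum = v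
  /-- The Jacobi identity: the coefficient of `z₀^{-l-1} z₁^{-m-1} z₂^{-n-1}`, applied to `w`.
  All three sums have finite support. -/
  jacobi : ∀ (u v w : V) (l m n : ℤ),
    ∑ᶠ i : ℕ, ((-1) ^ i * Ring.choose l i : ℤ) •
        ((Y u)[[m + l - i]]) (((Y v)[[n + i]]) w)
      - (l.negOnePow : ℤ) • ∑ᶠ i : ℕ, ((-1) ^ i * Ring.choose l i : ℤ) •
        ((Y v)[[n + l - i]]) (((Y u)[[m + i]]) w)
      = ∑ᶠ i : ℕ, (Ring.choose m i : ℤ) • ((Y (((Y u)[[l + i]]) v))[[m + n - i]]) w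
  /-- The Virasoro relations for `L(n) = ω_{n+1}`. -/
  virasoro : ∀ m n : ℤ,
    ((Y conformal)[[m + 1]]) * ((Y conformal)[[n + 1]])
        - ((Y conformal)[[n + 1]]) * ((Y conformal)[[m + 1]])
      = ((m : ℂ) - n) • ((Y conformal)[[m + n + 1]])
        + (if m + n = 0 then ((m : ℂ) ^ 3 - m) / 12 * centralCharge else 0) •
          (1 : Module.End ℂ V)
  /-- `L(0)` acts on `V_n` as the scalar `n`. -/
  conformal_mode_one : ∀ (n : ℤ), ∀ v ∈ weightSpace n, ((Y conformal)[[1]]) v = (n : ℂ) • v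
  /-- `d/dz Y(v, z) = Y(L(-1)v, z)`. -/
  derivative : ∀ (v : V) (n : ℤ),
    ((Y (((Y conformal)[[0]]) v))[[n]]) = (-(n : ℂ)) • ((Y v)[[n - 1]])

namespace VertexOperatorAlgebra

variable (V : Type*) [AddCommGroup V] [Module ℂ V] [VertexOperatorAlgebra V]

/-- The Virasoro operator `L(n) = ω_{n+1}` on `V`. -/
def L (n : ℤ) : Module.End ℂ V := ((Y (conformal : V))[[n + 1]])

/-- `V` is simple: it is nonzero and has no ideals (equivalently, no subspaces stable under all
modes `u_n`) other than `0` and `V`. -/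
def IsSimple : Prop :=
  Nontrivial V ∧ ∀ W : Submodule ℂ V,
    (∀ (u : V) (n : ℤ), ∀ w ∈ W, ((Y u)[[n]]) w ∈ W) → W = ⊥ ∨ W = ⊤

/-- The action of the Virasoro algebra on `V`: the linear extension of `L_n ↦ L(n)`, `C ↦ c`. -/
def virasoroAction : Virasoro →ₗ[ℂ] Module.End ℂ V :=
  Virasoro.lift (L V) ((centralCharge V : ℂ) • 1)

theorem virasoroAction_lie (x y : Virasoro) :
    virasoroAction V ⁅x, y⁆
      = virasoroAction V x * virasoroAction V y - virasoroAction V y * virasoroAction V x :=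
  Virasoro.lift_bracket (L V) (centralCharge V) virasoro x y

instance instLieRingModule : LieRingModule Virasoro V where
  bracket x v := virasoroAction V x v
  add_lie x y v := by simp
  lie_add x v w := by simp
  leibniz_lie x y v := by simp [virasoroAction_lie]

instance instLieModule : LieModule ℂ Virasoro V where
  smul_lie a x v := by
    change virasoroAction V (a • x) v = a • virasoroAction V x v
    simp
  lie_smul a x v := by
    change virasoroAction V x (a • v) = a • virasoroAction V x v
    simp

theorem virasoro_L_lie (n : ℤ) (v : V) : ⁅Virasoro.L n, v⁆ = L V n v := by
  change virasoroAction V (Virasoro.L n) v = _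
  simp [virasoroAction]

theorem virasoro_C_lie (v : V) : ⁅Virasoro.C, v⁆ = (centralCharge V : ℂ) • v := by
  change virasoroAction V Virasoro.C v = _
  simp [virasoroAction]

end VertexOperatorAlgebra

/-- A Lie module is completely reducible if it is the (internal) direct sum of a family of
irreducible submodules. -/
def IsCompletelyReducible (R 𝔤 M : Type*) [CommRing R] [LieRing 𝔤] [LieAlgebra R 𝔤]
    [AddCommGroup M] [Module R M] [LieRingModule 𝔤 M] [LieModule R 𝔤 M] : Prop :=
  ∃ S : Set (LieSubmodule R 𝔤 M),
    (∀ N ∈ S, LieModule.IsIrreducible R 𝔤 N) ∧ sSupIndep S ∧ sSup S = ⊤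

end

/-! Since `V_0 = ℂ𝟏` and `L(-1)𝟏 = 0`, an `sl₂` argument excludes negative weights, and `V` is a
graded Virasoro module with finite-dimensional weight spaces. In weight `k` let `S_k` be the space
of singular vectors (killed by all `L_n`, `n > 0`) and `D_k` the space of descendants (the sum of
the images of the `L_{-n}`, `n > 0`). It suffices that `V_k = S_k ⊕ D_k` for all `k`. Indeed a
nonzero submodule contains a singular vector in its lowest weight; in the module generated by `x ∈
S_k` a singular vector of higher weight would also be a descendant, so that module is irreducible;
and bases of the `S_k` generate `V` as a direct sum.

The splitting is proved by induction on `k`, simultaneously for `V` and its graded dual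
(`IsDualPair.splitting`). For `S_k ∩ D_k = 0` (`disjoint_singular_descend`), a singular descendant
is written as a sum of `L_{-ν} w` with `w` singular of weight `j < k` and `ν` a partition of `k -
j`. Raising words of degree `k - j` kill it, and modulo descendants of weight `j` they return a Gram
matrix applied to the vectors `w`. For `j > 0` that matrix is invertible; for `j = 0` its kernel
only involves words ending in `L_{-1}`, which vanish on weight 0. For `V_k = S_k + D_k`
(`IsDualPair.le_sup`), a functional of weight `k` killing `S_k + D_k` is a singular descendant of
the dual, hence zero. The condition `L(1)V_1 = 0` says that `L_{-1}` kills weight 0 of the dual, so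
the two modules satisfy the same hypotheses.

What the Gram matrices require is the Kac determinant, obtained from the Feigin–Fuchs realisation on
polynomials with `c = 13 - 6t - 6/t` and lowest weight `(α² + 2(1-t)α)/(4t)`. The Gram matrix
factors as `F(2(t-1)-α)ᵀ D F(α)` (`gram_eq`), where `F` expands the vectors `L_{-λ}|α⟩` in monomials
and `D` is diagonal and invertible. By `det_fockMatrix_eq`, `det F(α)` at level `N` is the product
of `(α - (s - r t))^{p(N-(r+1)(s+1))}`. It is monic in `α` of degree the total number of parts of
the partitions of `N`. At level `(r+1)(s+1)` it vanishes at `α = s - r t`: for natural `t` a nonzero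
constant-term functional built from Dyson's product kills the image of every lowering operator, and
polynomiality gives all `t`. Lowering words applied to a null vector supply the multiplicities,
because the lowering algebra has no zero divisors, and the degree leaves room for nothing else.
Finally, for real `c > 1` and real weight `h ≥ 0`, a zero occurs only for `h = 0` and `r = s = 0`
(`eq_zero_of_degenerate`). -/

noncomputable section

/-! ### Words in the lowering operators and straightening

The index `i : ℕ` stands for the operator `L_{-(i+1)}`, of degree `i + 1`. -/

namespace Virasoro

/-- The degree of a word in the operators `L_{-(i+1)}`. -/
def wordDegree (l : List ℕ) : ℕ := (l.map (· + 1)).sum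

@[simp] theorem wordDegree_nil : wordDegree [] = 0 := rfl

@[simp] theorem wordDegree_cons (i : ℕ) (l : List ℕ) :
    wordDegree (i :: l) = i + 1 + wordDegree l := by simp [wordDegree]

@[simp] theorem wordDegree_append (l l' : List ℕ) :
    wordDegree (l ++ l') = wordDegree l + wordDegree l' := by simp [wordDegree]

theorem wordDegree_eq_zero {l : List ℕ} : wordDegree l = 0 ↔ l = [] := by
  cases l <;> simp

theorem wordDegree_perm {l l' : List ℕ} (h : l.Perm l') : wordDegree l = wordDegree l' :=
  (h.map _).sum_eq

/-- The degree of a multi-index, in which the `i`-th entry counts with weight `i + 1`. -/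
def multiDegree : (ℕ →₀ ℕ) →+ ℕ := Finsupp.weight (fun i : ℕ => i + 1)

@[simp] theorem multiDegree_single (i k : ℕ) :
    multiDegree (Finsupp.single i k) = k * (i + 1) := by
  simp [multiDegree, Finsupp.weight_single]

theorem le_multiDegree (μ : ℕ →₀ ℕ) (i : ℕ) : μ i * (i + 1) ≤ multiDegree μ := by
  have h := (Finsupp.single_add_erase i μ)
  rw [← congrArg multiDegree h, map_add, multiDegree_single]
  omega

/-- The multi-indices of degree `N` (in other words, the partitions of `N`). -/
abbrev Idx (N : ℕ) : Type := {μ : ℕ →₀ ℕ // multiDegree μ = N}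

theorem finite_multiDegree_eq (N : ℕ) : {μ : ℕ →₀ ℕ | multiDegree μ = N}.Finite := by
  have hf : (Set.range fun f : Fin N → Fin (N + 1) =>
      Finsupp.onFinset (Finset.range N) (fun i => if h : i < N then (f ⟨i, h⟩ : ℕ) else 0)
        (by intro a ha; by_contra hc; simp_all)).Finite := Set.finite_range _
  refine hf.subset fun μ (hμ : multiDegree μ = N) => ?_
  have h1 : ∀ i, μ i ≤ N := fun i => by
    have := le_multiDegree μ i
    nlinarith
  have h2 : ∀ i, N ≤ i → μ i = 0 := fun i hi => by
    have := le_multiDegree μ i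
    by_contra h
    have : 1 ≤ μ i := Nat.one_le_iff_ne_zero.mpr h
    nlinarith
  refine ⟨fun i => ⟨μ i, Nat.lt_succ_of_le (h1 i)⟩, ?_⟩
  ext i
  by_cases h : i < N
  · simp [h]
  · simp [h, h2 i (by omega)]

instance (N : ℕ) : Fintype (Idx N) := (finite_multiDegree_eq N).fintype

/-- The decreasingly sorted word attached to a multi-index. -/
def sortedWord (μ : ℕ →₀ ℕ) : List ℕ := (Finsupp.toMultiset μ).sort (· ≥ ·)

@[simp] theorem coe_sortedWord (μ : ℕ →₀ ℕ) :
    (sortedWord μ : Multiset ℕ) = Finsupp.toMultiset μ := Multiset.sort_eq _ _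

theorem wordDegree_eq_multiDegree (l : List ℕ) :
    wordDegree l = multiDegree (Multiset.toFinsupp (l : Multiset ℕ)) := by
  induction l with
  | nil => simp
  | cons i l ih =>
    rw [wordDegree_cons, ih, ← Multiset.cons_coe, ← Multiset.singleton_add, map_add, map_add]
    simp

@[simp] theorem wordDegree_sortedWord (μ : ℕ →₀ ℕ) : wordDegree (sortedWord μ) = multiDegree μ := by
  rw [wordDegree_eq_multiDegree, coe_sortedWord, Finsupp.toMultiset_toFinsupp]

theorem perm_sortedWord (l : List ℕ) :
    l.Perm (sortedWord (Multiset.toFinsupp (l : Multiset ℕ))) := by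
  rw [← Multiset.coe_eq_coe, coe_sortedWord, Multiset.toFinsupp_toMultiset]

theorem length_sortedWord (μ : ℕ →₀ ℕ) : (sortedWord μ).length = μ.degree := by
  rw [← Multiset.coe_card, coe_sortedWord, Finsupp.card_toMultiset]
  rfl

section Word

variable {M : Type*} [AddCommGroup M] [Module ℂ M] (A : ℕ → Module.End ℂ M)

/-- The product of operators spelled by a word. -/
def word (l : List ℕ) : Module.End ℂ M := (l.map A).prod

@[simp] theorem word_nil : word A [] = 1 := rfl

@[simp] theorem word_cons (i : ℕ) (l : List ℕ) : word A (i :: l) = A i * word A l := by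
  simp [word]

theorem word_append (l l' : List ℕ) : word A (l ++ l') = word A l * word A l' := by
  simp [word]

/-- The span of the words of degree `d` and length less than `k`. -/
def shortWords (d k : ℕ) : Submodule ℂ (Module.End ℂ M) :=
  Submodule.span ℂ {T | ∃ l, wordDegree l = d ∧ l.length < k ∧ T = word A l}

theorem word_mem_shortWords {d k : ℕ} {l : List ℕ} (hd : wordDegree l = d) (hk : l.length < k) :
    word A l ∈ shortWords A d k := Submodule.subset_span ⟨l, hd, hk, rfl⟩

theorem mul_mem_shortWords {d k : ℕ} (i : ℕ) {T : Module.End ℂ M} (hT : T ∈ shortWords A d k) :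
    A i * T ∈ shortWords A (i + 1 + d) (k + 1) := by
  induction hT using Submodule.span_induction with
  | mem T hT =>
    obtain ⟨l, rfl, hk, rfl⟩ := hT
    rw [← word_cons]
    exact word_mem_shortWords A (by simp) (by simpa using hk)
  | zero => simp
  | add x y _ _ hx hy => rw [mul_add]; exact add_mem hx hy
  | smul a x _ hx => rw [mul_smul_comm]; exact Submodule.smul_mem _ _ hx

variable {A}
variable (hA : ∀ i j : ℕ, A i * A j - A j * A i = ((j : ℂ) - i) • A (i + j + 1))
include hA

/-- Exchanging two neighbouring letters costs a commutator, a single letter of the same total degree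
since `(i + 1) + (j + 1) = (i + j + 1) + 1`; so the error is a shorter word. -/
theorem word_sub_word_mem_of_perm {l l' : List ℕ} (h : l.Perm l') :
    word A l - word A l' ∈ shortWords A (wordDegree l) l.length := by
  induction h with
  | nil => simp
  | cons i _ ih =>
    rw [word_cons, word_cons, ← mul_sub, wordDegree_cons]
    exact mul_mem_shortWords A i ih
  | swap i j l =>
    simp only [word_cons, ← mul_assoc, ← sub_mul]
    rw [hA, smul_mul_assoc, ← word_cons]
    refine Submodule.smul_mem _ _ (word_mem_shortWords A ?_ ?_)
    · simp; omega
    · simp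
  | @trans l₁ l₂ l₃ h₁ h₂ ih₁ ih₂ =>
    rw [← wordDegree_perm h₁, ← h₁.length_eq] at ih₂
    simpa using add_mem ih₁ ih₂

theorem shortWords_le_span_sortedWord (d k : ℕ) :
    shortWords A d k ≤ Submodule.span ℂ (Set.range fun μ : Idx d => word A (sortedWord μ)) := by
  induction k with
  | zero => exact Submodule.span_le.mpr (by rintro _ ⟨l, _, hk, _⟩; simp at hk)
  | succ k ih =>
    refine Submodule.span_le.mpr ?_
    rintro _ ⟨l, rfl, hk, rfl⟩
    have h := word_sub_word_mem_of_perm hA (perm_sortedWord l)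
    have h1 : shortWords A (wordDegree l) l.length ≤ shortWords A (wordDegree l) k :=
      Submodule.span_mono (by rintro _ ⟨l', h, h', rfl⟩; exact ⟨l', h, by omega, rfl⟩)
    have h2 := ih (h1 h)
    have h3 : word A (sortedWord (Multiset.toFinsupp (l : Multiset ℕ))) ∈
        Submodule.span ℂ (Set.range fun μ : Idx (wordDegree l) => word A (sortedWord μ)) :=
      Submodule.subset_span ⟨⟨_, (wordDegree_eq_multiDegree l).symm⟩, rfl⟩
    simpa using add_mem h2 h3

/-- Straightening: every word is a combination of sorted words. -/
theorem word_mem_span_sortedWord (l : List ℕ) : word A l ∈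
    Submodule.span ℂ (Set.range fun μ : Idx (wordDegree l) => word A (sortedWord μ)) :=
  shortWords_le_span_sortedWord hA _ (l.length + 1) (word_mem_shortWords A rfl (by simp))

end Word

end Virasoro

end



noncomputable section

/-! ### The lowering operators on Fock space

The Fock space over `R` is `MvPolynomial ℕ R`, with creation operators `x_{i+1} = X i`.  The
Feigin–Fuchs operators of negative degree have coefficients polynomial in the momentum `α` and the
parameter `t` of the central charge `13 - 6 t - 6 / t`. -/

namespace Fock

open MvPolynomial Finset Virasoro

section Ring

variable (R : Type*) [CommRing R]

/-- The creation operator `x_k` for `k > 0`, and `x_0 = 0`. -/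
def x : ℕ → MvPolynomial ℕ R
  | 0 => 0
  | k + 1 => X k

@[simp] theorem x_zero : x R 0 = 0 := rfl

@[simp] theorem x_succ (k : ℕ) : x R (k + 1) = X k := rfl

/-- The derivation `x_k ↦ k x_{k+n+1}`. -/
def shiftDer (n : ℕ) : Derivation R (MvPolynomial ℕ R) (MvPolynomial ℕ R) :=
  mkDerivation R fun i => ((i + 1 : ℕ) : MvPolynomial ℕ R) * x R (i + 1 + (n + 1))

@[simp] theorem shiftDer_x (n k : ℕ) :
    shiftDer R n (x R k) = (k : MvPolynomial ℕ R) * x R (k + (n + 1)) := by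
  cases k with
  | zero => simp
  | succ k => rw [x_succ, shiftDer, mkDerivation_X]

/-- The sum of all `x_i x_j` with `i + j = n`. -/
def quad (n : ℕ) : MvPolynomial ℕ R := ∑ k ∈ range (n + 1), x R k * x R (n - k)

variable {R}

/-- Shifting by `m` places the first sum on the indices `m, …, m + n`; reflecting places the second
on `0, …, m - 1`. Together they fill one convolution. -/
theorem shifted_convolution {S : Type*} [CommRing S] (y : ℕ → S) (m n : ℕ) :
    ∑ k ∈ range (n + 1), (k : S) * y (k + m) * y (n - k)
      - ∑ k ∈ range (m + 1), (k : S) * y (k + n) * y (m - k)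
      = ∑ k ∈ range (m + n + 1), ((k : S) - m) * (y k * y (m + n - k)) := by
  have h1 : ∑ k ∈ range (n + 1), (k : S) * y (k + m) * y (n - k)
      = ∑ k ∈ range (n + 1), (((m + k : ℕ) : S) - m) * (y (m + k) * y (m + n - (m + k))) := by
    refine sum_congr rfl fun k _ => ?_
    rw [show m + n - (m + k) = n - k by omega, add_comm k m]
    push_cast; ring
  have h2 : ∑ k ∈ range (m + 1), (k : S) * y (k + n) * y (m - k)
      = - ∑ k ∈ range m, ((k : S) - m) * (y k * y (m + n - k)) := by
    rw [← sum_flip, sum_range_succ, ← sum_neg_distrib]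
    simp only [Nat.sub_self, Nat.cast_zero, zero_mul, add_zero]
    refine sum_congr rfl fun k hk => ?_
    have hk := mem_range.mp hk
    rw [show m - (m - k) = k by omega, show m - k + n = m + n - k by omega, Nat.cast_sub hk.le]
    ring
  rw [h1, h2, add_assoc m n 1, sum_range_add _ m (n + 1)]; ring

/-- Averaging with the reflection `k ↦ m + n - k` replaces the weight `k - m` by a constant. -/
theorem two_mul_shifted_convolution {S : Type*} [CommRing S] (y : ℕ → S) (m n : ℕ) :
    2 * ∑ k ∈ range (m + n + 1), ((k : S) - m) * (y k * y (m + n - k))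
      = ((n : S) - m) * ∑ k ∈ range (m + n + 1), y k * y (m + n - k) := by
  rw [two_mul]
  conv_lhs => arg 2; rw [← sum_flip]
  rw [← sum_add_distrib, mul_sum]
  refine sum_congr rfl fun k hk => ?_
  have hk : k ≤ m + n := by have := mem_range.mp hk; omega
  rw [show m + n - (m + n - k) = k by omega, Nat.cast_sub hk]
  push_cast; ring

theorem shiftDer_quad (m n : ℕ) : shiftDer R m (quad R n)
    = 2 * ∑ k ∈ range (n + 1), (k : MvPolynomial ℕ R) * x R (k + (m + 1)) * x R (n - k) := by
  simp only [quad, map_sum, Derivation.leibniz, shiftDer_x, smul_eq_mul, sum_add_distrib]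
  rw [two_mul, add_comm]
  congr 1
  · exact sum_congr rfl fun k _ => by ring
  · rw [← sum_flip]
    refine sum_congr rfl fun k hk => ?_
    have hk := mem_range.mp hk
    rw [show n - (n - k) = k by omega]; ring

theorem shiftDer_quad_sub (m n : ℕ) :
    shiftDer R m (quad R (n + 1)) - shiftDer R n (quad R (m + 1))
      = ((n : MvPolynomial ℕ R) - m) * quad R (m + n + 2) := by
  rw [shiftDer_quad, shiftDer_quad, ← mul_sub, shifted_convolution (x R) (m + 1) (n + 1),
    two_mul_shifted_convolution, quad]
  rw [show m + 1 + (n + 1) = m + n + 2 by omega]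
  push_cast; ring

/-- The multiplication part of the operator `L_{-(n+1)}`. -/
def mulPart (t α : R) (n : ℕ) : MvPolynomial ℕ R :=
  C t * quad R (n + 1) + C (α + (t - 1) * n) * x R (n + 1)

/-- The operator `L_{-(n+1)}` on the Fock space of momentum `α`. -/
def lower (t α : R) (n : ℕ) : Module.End R (MvPolynomial ℕ R) :=
  (shiftDer R n).toLinearMap + LinearMap.mulLeft R (mulPart t α n)

theorem lower_apply (t α : R) (n : ℕ) (f : MvPolynomial ℕ R) :
    lower t α n f = shiftDer R n f + mulPart t α n * f := rfl

/-- The cocycle condition under which adding a multiplication operator to `shiftDer` preserves its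
commutation relations. -/
theorem shiftDer_mulPart_sub (t α : R) (m n : ℕ) :
    shiftDer R m (mulPart t α n) - shiftDer R n (mulPart t α m)
      = ((n : MvPolynomial ℕ R) - m) * mulPart t α (m + n + 1) := by
  have h := shiftDer_quad_sub (R := R) m n
  simp only [mulPart, map_add, Derivation.leibniz, shiftDer_x, smul_eq_mul, derivation_C,
    mul_zero, add_zero, map_mul, map_sub, map_natCast, map_one, Derivation.map_natCast,
    Derivation.map_one_eq_zero, sub_zero]
  rw [show n + 1 + (m + 1) = m + n + 2 by omega, show m + 1 + (n + 1) = m + n + 2 by omega,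
    show m + n + 1 + 1 = m + n + 2 by omega]
  push_cast
  linear_combination (C t) * h

theorem shiftDer_comm (m n : ℕ) (f : MvPolynomial ℕ R) :
    shiftDer R m (shiftDer R n f) - shiftDer R n (shiftDer R m f)
      = ((n : MvPolynomial ℕ R) - m) * shiftDer R (m + n + 1) f := by
  have h : ⁅shiftDer R m, shiftDer R n⁆
      = ((n : MvPolynomial ℕ R) - m) • shiftDer R (m + n + 1) := by
    refine derivation_ext fun i => ?_
    rw [Derivation.commutator_apply, ← x_succ]
    simp only [shiftDer_x, Derivation.leibniz, smul_eq_mul, Derivation.map_natCast, mul_zero,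
      add_zero, Derivation.smul_apply]
    rw [show i + 1 + (n + 1) + (m + 1) = i + 1 + (m + n + 1 + 1) by omega,
      show i + 1 + (m + 1) + (n + 1) = i + 1 + (m + n + 1 + 1) by omega]
    push_cast; ring
  have := congrArg (fun D => D f) h
  rwa [Derivation.commutator_apply] at this

theorem lower_comm (t α : R) (m n : ℕ) (f : MvPolynomial ℕ R) :
    lower t α m (lower t α n f) - lower t α n (lower t α m f)
      = ((n : MvPolynomial ℕ R) - m) * lower t α (m + n + 1) f := by
  simp only [lower_apply, map_add, Derivation.leibniz, smul_eq_mul]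
  linear_combination shiftDer_comm m n f + f * shiftDer_mulPart_sub t α m n

/-- The vector obtained by applying a word in the operators `L_{-(n+1)}` to the vacuum. -/
def wordVec (t α : R) (l : List ℕ) : MvPolynomial ℕ R := l.foldr (fun n f => lower t α n f) 1

@[simp] theorem wordVec_nil (t α : R) : wordVec t α [] = 1 := rfl

@[simp] theorem wordVec_cons (t α : R) (n : ℕ) (l : List ℕ) :
    wordVec t α (n :: l) = lower t α n (wordVec t α l) := rfl

/-! #### Change of rings -/

section Map

variable {S : Type*} [CommRing S] (φ : R →+* S)

@[simp] theorem map_x (k : ℕ) : map φ (x R k) = x S k := by cases k <;> simp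

theorem map_shiftDer (n : ℕ) (f : MvPolynomial ℕ R) :
    map φ (shiftDer R n f) = shiftDer S n (map φ f) := by
  induction f using MvPolynomial.induction_on with
  | C a => simp [derivation_C]
  | add f g hf hg => simp [hf, hg]
  | mul_X f i hf =>
    simp only [← x_succ, Derivation.leibniz, map_add, map_mul, shiftDer_x, smul_eq_mul, hf, map_x,
      map_natCast]

theorem map_mulPart (t α : R) (n : ℕ) :
    map φ (mulPart t α n) = mulPart (φ t) (φ α) n := by
  simp [mulPart, quad]

theorem map_lower (t α : R) (n : ℕ) (f : MvPolynomial ℕ R) :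
    map φ (lower t α n f) = lower (φ t) (φ α) n (map φ f) := by
  simp [lower_apply, map_shiftDer, map_mulPart]

theorem map_wordVec (t α : R) (l : List ℕ) :
    map φ (wordVec t α l) = wordVec (φ t) (φ α) l := by
  induction l with
  | nil => simp
  | cons n l ih => rw [wordVec_cons, map_lower, ih, wordVec_cons]

end Map

/-! #### The grading -/

variable (R) in
/-- The derivation `x_k ↦ k x_k`. -/
def euler : Derivation R (MvPolynomial ℕ R) (MvPolynomial ℕ R) :=
  mkDerivation R fun i => ((i + 1 : ℕ) : MvPolynomial ℕ R) * x R (i + 1)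

@[simp] theorem euler_x (k : ℕ) : euler R (x R k) = (k : MvPolynomial ℕ R) * x R k := by
  cases k with
  | zero => simp
  | succ k => rw [x_succ, euler, mkDerivation_X]; simp

theorem euler_monomial (μ : ℕ →₀ ℕ) (a : R) :
    euler R (monomial μ a) = (multiDegree μ : MvPolynomial ℕ R) * monomial μ a := by
  induction μ using Finsupp.induction_linear generalizing a with
  | zero => simp [derivation_C]
  | add μ ν hμ hν =>
    have : monomial (μ + ν) a = monomial μ a * monomial ν (1 : R) := by simp [monomial_mul]
    rw [this, Derivation.leibniz, hμ, hν, map_add]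
    simp only [smul_eq_mul]; push_cast; ring
  | single i k =>
    rw [← C_mul_X_pow_eq_monomial, Derivation.leibniz, derivation_C, Derivation.leibniz_pow, ← x_succ,
      euler_x, multiDegree_single]
    cases k with
    | zero => simp
    | succ k => simp; ring

theorem coeff_euler (μ : ℕ →₀ ℕ) (f : MvPolynomial ℕ R) :
    coeff μ (euler R f) = (multiDegree μ : R) * coeff μ f := by
  induction f using MvPolynomial.induction_on' with
  | monomial ν a =>
    rw [euler_monomial, ← map_natCast (C (R := R) (σ := ℕ)), coeff_C_mul, coeff_monomial]
    split_ifs with h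
    · rw [h]
    · simp
  | add f g hf hg => rw [map_add, coeff_add, hf, hg, coeff_add]; ring

theorem euler_quad (n : ℕ) : euler R (quad R n) = (n : MvPolynomial ℕ R) * quad R n := by
  simp only [quad, map_sum, Derivation.leibniz, euler_x, smul_eq_mul, mul_sum]
  refine sum_congr rfl fun k hk => ?_
  have hk : k ≤ n := by have := mem_range.mp hk; omega
  rw [Nat.cast_sub hk]; ring

theorem euler_mulPart (t α : R) (n : ℕ) :
    euler R (mulPart t α n) = ((n + 1 : ℕ) : MvPolynomial ℕ R) * mulPart t α n := by
  simp only [mulPart, map_add, Derivation.leibniz, euler_x, euler_quad, smul_eq_mul, derivation_C]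
  ring

theorem euler_shiftDer (n : ℕ) (f : MvPolynomial ℕ R) :
    euler R (shiftDer R n f) - shiftDer R n (euler R f)
      = ((n + 1 : ℕ) : MvPolynomial ℕ R) * shiftDer R n f := by
  have h : ⁅euler R, shiftDer R n⁆ = ((n + 1 : ℕ) : MvPolynomial ℕ R) • shiftDer R n := by
    refine derivation_ext fun i => ?_
    rw [Derivation.commutator_apply, ← x_succ]
    simp only [shiftDer_x, euler_x, Derivation.leibniz, smul_eq_mul, Derivation.map_natCast,
      mul_zero, add_zero, Derivation.smul_apply]
    push_cast; ring
  have := congrArg (fun D => D f) h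
  rwa [Derivation.commutator_apply] at this

theorem euler_lower (t α : R) (n : ℕ) (f : MvPolynomial ℕ R) :
    euler R (lower t α n f) = lower t α n (euler R f)
      + ((n + 1 : ℕ) : MvPolynomial ℕ R) * lower t α n f := by
  simp only [lower_apply, map_add, Derivation.leibniz, smul_eq_mul, euler_mulPart]
  linear_combination euler_shiftDer n f

theorem euler_wordVec (t α : R) (l : List ℕ) :
    euler R (wordVec t α l) = (wordDegree l : MvPolynomial ℕ R) * wordVec t α l := by
  induction l with
  | nil => simp
  | cons n l ih =>
    rw [wordVec_cons, euler_lower, ih, ← nsmul_eq_mul, map_nsmul, nsmul_eq_mul, wordDegree_cons]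
    push_cast; ring

/-- A word vector and a monomial are both eigenvectors of `euler`; distinct degrees remain distinct
eigenvalues in characteristic zero. -/
theorem coeff_wordVec_eq_zero [IsDomain R] [CharZero R] (t α : R) {l : List ℕ} {μ : ℕ →₀ ℕ}
    (h : multiDegree μ ≠ wordDegree l) : coeff μ (wordVec t α l) = 0 := by
  have h1 := coeff_euler μ (wordVec t α l)
  rw [euler_wordVec, ← map_natCast (C (R := R) (σ := ℕ)), coeff_C_mul, eq_comm, ← sub_eq_zero,
    ← sub_mul, mul_eq_zero, sub_eq_zero, Nat.cast_inj] at h1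
  exact h1.resolve_left h

/-- The matrix expressing the vectors `L_{-λ}|α⟩` of degree `N` in terms of monomials. -/
def fockMatrix (t α : R) (N : ℕ) : Matrix (Idx N) (Idx N) R :=
  fun μ ν => coeff μ.1 (wordVec t α (sortedWord ν.1))

theorem map_fockMatrix {S : Type*} [CommRing S] (φ : R →+* S) (t α : R) (N : ℕ) :
    (fockMatrix t α N).map φ = fockMatrix (φ t) (φ α) N := by
  ext μ ν
  simp only [fockMatrix, Matrix.map_apply, ← coeff_map, map_wordVec]

theorem map_det_fockMatrix {S : Type*} [CommRing S] (φ : R →+* S)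
    (t α : R) (N : ℕ) : φ (fockMatrix t α N).det = (fockMatrix (φ t) (φ α) N).det := by
  rw [RingHom.map_det, ← map_fockMatrix]; rfl

end Ring

end Fock

end



noncomputable section

/-! ### Leading coefficients of determinants of polynomial matrices -/

namespace Polynomial

theorem natDegree_prod_le_sum_and_coeff {ι R : Type*} [CommRing R] (s : Finset ι) (f : ι → R[X])
    (d : ι → ℕ) (h : ∀ i ∈ s, (f i).natDegree ≤ d i) :
    (∏ i ∈ s, f i).natDegree ≤ ∑ i ∈ s, d i ∧
      (∏ i ∈ s, f i).coeff (∑ i ∈ s, d i) = ∏ i ∈ s, (f i).coeff (d i) := by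
  classical
  induction s using Finset.induction_on with
  | empty => simp
  | insert a s ha ih =>
    obtain ⟨h1, h2⟩ := ih fun i hi => h i (Finset.mem_insert_of_mem hi)
    have h3 := h a (Finset.mem_insert_self a s)
    rw [Finset.prod_insert ha, Finset.sum_insert ha, Finset.prod_insert ha, ← h2]
    exact ⟨natDegree_mul_le.trans (add_le_add h3 h1), coeff_mul_add_eq_of_natDegree_le h3 h1⟩

end Polynomial

namespace Matrix

open Polynomial

/-- A matrix of polynomials whose matrix of leading coefficients (by columns) is the identity has
monic determinant. -/
theorem monic_det_of_column_degrees {ι R : Type*} [Fintype ι] [DecidableEq ι] [CommRing R]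
    (M : Matrix ι ι R[X]) (d : ι → ℕ) (hd : ∀ i j, (M i j).natDegree ≤ d j)
    (hc : ∀ i j, (M i j).coeff (d j) = if i = j then 1 else 0) :
    M.det.natDegree ≤ ∑ j, d j ∧ M.det.coeff (∑ j, d j) = 1 := by
  have h := fun σ : Equiv.Perm ι => natDegree_prod_le_sum_and_coeff Finset.univ
    (fun i => M (σ i) i) d fun i _ => hd _ _
  constructor
  · rw [det_apply]
    refine natDegree_sum_le_of_forall_le _ _ fun σ _ => ?_
    rcases Int.units_eq_one_or (Equiv.Perm.sign σ) with h' | h' <;> rw [h'] <;> simp [(h σ).1]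
  · have : (1 : Matrix ι ι R).det = 1 := det_one
    rw [← this, det_apply, det_apply, finsetSum_coeff]
    refine Finset.sum_congr rfl fun σ _ => ?_
    have h2 : ∏ i, (1 : Matrix ι ι R) (σ i) i = (∏ i, M (σ i) i).coeff (∑ j, d j) := by
      rw [(h σ).2]
      exact Finset.prod_congr rfl fun i _ => by rw [hc, one_apply]
    rw [h2]
    rcases Int.units_eq_one_or (Equiv.Perm.sign σ) with h' | h' <;> rw [h'] <;> simp

end Matrix

namespace Fock

open MvPolynomial Finset Virasoro

/-! ### Leading terms in the momentum -/

section Lead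

open Polynomial (natDegree)

variable {K : Type*} [CommRing K]

/-- For constant momentum the operator is defined over `K`, so it cannot raise the degree in the
polynomial variable. -/
theorem natDegree_coeff_lower_le (t a : K) (n k : ℕ) {f : MvPolynomial ℕ (Polynomial K)}
    (hf : ∀ μ, (coeff μ f).natDegree ≤ k) (μ : ℕ →₀ ℕ) :
    (coeff μ (lower (Polynomial.C t) (Polynomial.C a) n f)).natDegree ≤ k := by
  rw [f.as_sum, map_sum, coeff_sum]
  refine Polynomial.natDegree_sum_le_of_forall_le _ _ fun ν _ => ?_
  have : monomial ν (coeff ν f) = coeff ν f • map Polynomial.C (monomial ν (1 : K)) := by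
    simp [smul_monomial]
  rw [this, map_smul, ← map_lower, coeff_smul, coeff_map, smul_eq_mul]
  refine Polynomial.natDegree_mul_le.trans ?_
  simpa using hf ν

theorem lower_X_apply (t : K) (n : ℕ) (f : MvPolynomial ℕ (Polynomial K)) :
    lower (Polynomial.C t) Polynomial.X n f
      = (Polynomial.X : Polynomial K) • (X n * f) + lower (Polynomial.C t) (Polynomial.C 0) n f := by
  simp only [lower_apply, mulPart, smul_eq_C_mul, map_add, map_mul, map_zero, x_succ]
  ring

/-- The momentum enters `L_{-(n+1)}` only through multiplication by `α x_{n+1}`. Each letter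
therefore contributes at most one power of `α`, and the top coefficient is the commutative monomial
of the word. -/
theorem wordVec_lead (t : K) (l : List ℕ) (μ : ℕ →₀ ℕ) :
    (coeff μ (wordVec (Polynomial.C t) Polynomial.X l)).natDegree ≤ l.length ∧
    (coeff μ (wordVec (Polynomial.C t) Polynomial.X l)).coeff l.length
      = coeff μ (monomial (Multiset.toFinsupp (l : Multiset ℕ)) (1 : K)) := by
  induction l generalizing μ with
  | nil =>
    simp only [wordVec_nil, List.length_nil, coeff_one, coeff_monomial]
    split_ifs <;> simp_all
  | cons n l ih =>
    have hE := natDegree_coeff_lower_le t 0 n l.length (fun ν => (ih ν).1) μ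
    rw [wordVec_cons, lower_X_apply, coeff_add, coeff_smul, smul_eq_mul, List.length_cons]
    have hX : ∀ ν, (coeff ν (X n * wordVec (Polynomial.C t) Polynomial.X l)).natDegree ≤ l.length ∧
        (coeff ν (X n * wordVec (Polynomial.C t) Polynomial.X l)).coeff l.length
          = coeff ν (X n * monomial (Multiset.toFinsupp (l : Multiset ℕ)) (1 : K)) := by
      intro ν
      rw [coeff_X_mul', coeff_X_mul']
      split_ifs
      · exact ih _
      · simp
    constructor
    · refine (Polynomial.natDegree_add_le _ _).trans (max_le ?_ (hE.trans (Nat.le_succ _)))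
      refine Polynomial.natDegree_mul_le.trans ?_
      have := Polynomial.natDegree_X_le (R := K)
      have := (hX μ).1
      omega
    · rw [Polynomial.coeff_add, Polynomial.coeff_X_mul, (hX μ).2,
        Polynomial.coeff_eq_zero_of_natDegree_lt (Nat.lt_succ_of_le hE), add_zero]
      rw [← Multiset.cons_coe, ← Multiset.singleton_add, map_add, Multiset.toFinsupp_singleton,
        X, monomial_mul, one_mul]

theorem coeff_wordVec_sortedWord (t : K) (μ ν : ℕ →₀ ℕ) :
    (coeff μ (wordVec (Polynomial.C t) Polynomial.X (sortedWord ν))).natDegree ≤ ν.degree ∧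
    (coeff μ (wordVec (Polynomial.C t) Polynomial.X (sortedWord ν))).coeff ν.degree
      = if μ = ν then 1 else 0 := by
  have := wordVec_lead t (sortedWord ν) μ
  rw [length_sortedWord, coe_sortedWord, Finsupp.toMultiset_toFinsupp, coeff_monomial] at this
  simpa only [eq_comm] using this

/-- The number of parts of all partitions of `N`. -/
def totalDegree (N : ℕ) : ℕ := ∑ μ : Idx N, μ.1.degree

theorem natDegree_det_fockMatrix (t : K) (N : ℕ) :
    (fockMatrix (Polynomial.C t) Polynomial.X N).det.natDegree ≤ totalDegree N ∧
    (fockMatrix (Polynomial.C t) Polynomial.X N).det.coeff (totalDegree N) = 1 := by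
  refine Matrix.monic_det_of_column_degrees _ (fun ν : Idx N => ν.1.degree)
    (fun μ ν => (coeff_wordVec_sortedWord t _ _).1) fun μ ν => ?_
  rw [fockMatrix, (coeff_wordVec_sortedWord t _ _).2]
  simp only [Subtype.ext_iff]

theorem monic_det_fockMatrix [Nontrivial K] (t : K) (N : ℕ) :
    (fockMatrix (Polynomial.C t) Polynomial.X N).det.Monic ∧
    (fockMatrix (Polynomial.C t) Polynomial.X N).det.natDegree = totalDegree N := by
  obtain ⟨h1, h2⟩ := natDegree_det_fockMatrix t N
  refine ⟨Polynomial.monic_of_natDegree_le_of_coeff_eq_one _ h1 h2, le_antisymm h1 ?_⟩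
  exact Polynomial.le_natDegree_of_ne_zero (by rw [h2]; exact one_ne_zero)

/-- The algebra generated by the operators `L_{-n}` has no zero divisors. -/
theorem eq_zero_of_sum_wordVec_append_eq_zero [IsDomain K] (t : K) {M N : ℕ} (k : Idx M → K)
    (c : Idx N → K) (hk : k ≠ 0)
    (h : ∑ μ, ∑ ν, Polynomial.C (c μ * k ν) •
      wordVec (Polynomial.C t) Polynomial.X (sortedWord μ.1 ++ sortedWord ν.1) = 0) : c = 0 := by
  classical
  -- The symbol of a nonzero combination: its part of maximal word length, read as a polynomial in
  -- the `x_i`.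
  have key : ∀ {L : ℕ} (b : Idx L → K), b ≠ 0 → ∃ m, (∀ μ, b μ ≠ 0 → μ.1.degree ≤ m) ∧
      ∑ μ with μ.1.degree = m, monomial μ.1 (b μ) ≠ 0 := by
    intro L b hb
    obtain ⟨μ₀, hμ₀⟩ := Function.ne_iff.mp hb
    obtain ⟨μ₁, h1, h2⟩ := exists_max_image (univ.filter fun μ => b μ ≠ 0)
      (fun μ => μ.1.degree) ⟨μ₀, by simpa using hμ₀⟩
    refine ⟨μ₁.1.degree, fun μ hμ => h2 μ (by simpa using hμ), fun h0 => ?_⟩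
    have := congrArg (coeff μ₁.1) h0
    rw [coeff_sum, sum_eq_single μ₁] at this
    · simp at this h1; exact h1 this
    · intro μ _ hne
      rw [coeff_monomial, if_neg fun he => hne (Subtype.ext he)]
    · simp
  by_contra hc
  obtain ⟨m, hm, hm'⟩ := key k hk
  obtain ⟨m', hn, hn'⟩ := key c hc
  -- The product of the two symbols is nonzero in a polynomial domain, yet it is the coefficient of
  -- momentum degree `m' + m` in a sum assumed to vanish.
  refine mul_ne_zero hn' hm' ?_
  ext σ
  have h1 := congrArg (fun f => (coeff σ f).coeff (m' + m)) h
  simp only [coeff_sum, coeff_smul, smul_eq_mul, Polynomial.finsetSum_coeff, coeff_zero,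
    Polynomial.coeff_zero, Polynomial.coeff_C_mul] at h1
  rw [coeff_zero, ← h1, sum_mul_sum, sum_filter, coeff_sum]
  refine sum_congr rfl fun μ _ => ?_
  rw [apply_ite (coeff σ), coeff_sum, sum_filter, coeff_zero, ite_sum_zero]
  refine sum_congr rfl fun ν _ => ?_
  by_cases hcμ : c μ = 0
  · simp [hcμ]
  by_cases hkν : k ν = 0
  · simp [hkν]
  obtain ⟨hd, hl⟩ := wordVec_lead t (sortedWord μ.1 ++ sortedWord ν.1) σ
  have h2 := hn μ hcμ
  have h3 := hm ν hkν
  rw [List.length_append, length_sortedWord, length_sortedWord] at hd hl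
  by_cases he : μ.1.degree = m' ∧ ν.1.degree = m
  · rw [if_pos he.1, if_pos he.2, ← he.1, ← he.2, hl, monomial_mul, ← Multiset.coe_add,
      coe_sortedWord, coe_sortedWord, map_add, Finsupp.toMultiset_toFinsupp,
      Finsupp.toMultiset_toFinsupp, coeff_monomial, coeff_monomial]
    simp
  · rw [Polynomial.coeff_eq_zero_of_natDegree_lt (lt_of_le_of_lt hd (by omega)), mul_zero]
    split_ifs <;> tauto

end Lead

end Fock

end



noncomputable section

namespace Fock

open MvPolynomial Finset Virasoro

/-! ### The constant term functional -/

section ConstantTerm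

variable (r : ℕ)

/-- The weight `∏_{i ≠ j} (w_i - w_j)^t`. -/
def dysonProduct (R : Type*) [CommRing R] (t : ℕ) : MvPolynomial (Fin r) R :=
  ∏ p ∈ (univ : Finset (Fin r)).offDiag, (X p.1 - X p.2) ^ t

/-- The substitution `x_k ↦ - ∑ w_i^k`. -/
def powerSumEval : MvPolynomial ℕ ℂ →ₐ[ℂ] MvPolynomial (Fin r) ℂ :=
  aeval fun i => - psum (Fin r) ℂ (i + 1)

/-- The derivation `∑ w_i^{n+2} ∂/∂w_i`. -/
def wittDer (n : ℕ) : Derivation ℂ (MvPolynomial (Fin r) ℂ) (MvPolynomial (Fin r) ℂ) :=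
  mkDerivation ℂ fun i => X i ^ (n + 2)

variable {r}

theorem powerSumEval_x {k : ℕ} (hk : k ≠ 0) :
    powerSumEval r (x ℂ k) = - psum (Fin r) ℂ k := by
  obtain ⟨k, rfl⟩ := Nat.exists_eq_succ_of_ne_zero hk
  simp [powerSumEval]

@[simp] theorem wittDer_X (n : ℕ) (i : Fin r) : wittDer r n (X i) = X i ^ (n + 2) :=
  mkDerivation_X _ _ _

theorem wittDer_psum (n k : ℕ) :
    wittDer r n (psum (Fin r) ℂ k) = (k : MvPolynomial (Fin r) ℂ) * psum (Fin r) ℂ (k + (n + 1)) := by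
  simp only [psum, map_sum, Derivation.leibniz_pow, wittDer_X, mul_sum, smul_eq_mul, nsmul_eq_mul]
  refine sum_congr rfl fun i _ => ?_
  cases k with
  | zero => simp
  | succ k => rw [Nat.add_sub_cancel]; ring

/-- The vector field `∑ w_i^{n+2} ∂_i` sends the power sum `p_k` to `k p_{k+n+1}`, which is the rule
defining `shiftDer` on generators. -/
theorem wittDer_powerSumEval (n : ℕ) (f : MvPolynomial ℕ ℂ) :
    wittDer r n (powerSumEval r f) = powerSumEval r (shiftDer ℂ n f) := by
  induction f using MvPolynomial.induction_on with
  | C a => simp [derivation_C, powerSumEval]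
  | add f g hf hg => simp only [map_add, hf, hg]
  | mul_X f i hf =>
    rw [← x_succ, map_mul, Derivation.leibniz, Derivation.leibniz, hf, shiftDer_x,
      powerSumEval_x (Nat.succ_ne_zero i), map_neg, wittDer_psum]
    simp only [smul_eq_mul, map_add, map_mul, map_natCast]
    rw [powerSumEval_x (by omega), powerSumEval_x (by omega)]
    ring

/-- The complete homogeneous polynomials in two variables, summed over all ordered pairs. -/
theorem sum_offDiag_geom (n : ℕ) :
    ∑ p ∈ (univ : Finset (Fin r)).offDiag,
      ∑ k ∈ range (n + 1), (X p.1 : MvPolynomial (Fin r) ℂ) ^ k * X p.2 ^ (n - k)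
      = ∑ k ∈ range (n + 1), psum (Fin r) ℂ k * psum (Fin r) ℂ (n - k)
        - ((n + 1 : ℕ) : MvPolynomial (Fin r) ℂ) * psum (Fin r) ℂ n := by
  have h := sum_union (disjoint_diag_offDiag (univ : Finset (Fin r)))
    (f := fun p => ∑ k ∈ range (n + 1), (X p.1 : MvPolynomial (Fin r) ℂ) ^ k * X p.2 ^ (n - k))
  rw [diag_union_offDiag, sum_product, sum_diag] at h
  have h1 : ∑ i : Fin r, ∑ k ∈ range (n + 1), (X i : MvPolynomial (Fin r) ℂ) ^ k * X i ^ (n - k)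
      = ((n + 1 : ℕ) : MvPolynomial (Fin r) ℂ) * psum (Fin r) ℂ n := by
    rw [psum, mul_sum]
    refine sum_congr rfl fun i _ => ?_
    have : ∀ k ∈ range (n + 1), (X i : MvPolynomial (Fin r) ℂ) ^ k * X i ^ (n - k) = X i ^ n :=
      fun k hk => by rw [← pow_add, Nat.add_sub_of_le (Nat.lt_succ_iff.mp (mem_range.mp hk))]
    rw [sum_congr rfl this]
    simp
  have h2 : ∑ i : Fin r, ∑ j : Fin r,
      ∑ k ∈ range (n + 1), (X i : MvPolynomial (Fin r) ℂ) ^ k * X j ^ (n - k)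
      = ∑ k ∈ range (n + 1), psum (Fin r) ℂ k * psum (Fin r) ℂ (n - k) := by
    simp only [psum, sum_mul_sum]
    rw [sum_congr rfl fun i _ => sum_comm, sum_comm]
  rw [← h2, ← h1, h]; ring

/-- The logarithmic derivative of `(w_i - w_j)^t` along the field is `t (w_i^{n+2} - w_j^{n+2}) /
(w_i - w_j)`, a complete homogeneous polynomial; summed over pairs these are convolutions of power
sums. -/
theorem wittDer_dysonProduct (n t : ℕ) :
    wittDer r n (dysonProduct r ℂ t) = (t : MvPolynomial (Fin r) ℂ) *
      (∑ k ∈ range (n + 2), psum (Fin r) ℂ k * psum (Fin r) ℂ (n + 1 - k)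
        - ((n + 2 : ℕ) : MvPolynomial (Fin r) ℂ) * psum (Fin r) ℂ (n + 1)) * dysonProduct r ℂ t := by
  rw [← sum_offDiag_geom, dysonProduct]
  induction (univ : Finset (Fin r)).offDiag using Finset.induction_on with
  | empty => simp
  | insert p s hp ih =>
    rw [prod_insert hp, Derivation.leibniz, ih, sum_insert hp, Derivation.leibniz_pow, map_sub,
      wittDer_X, wittDer_X, ← geom_sum₂_mul]
    simp only [smul_eq_mul, nsmul_eq_mul]
    cases t with
    | zero => simp
    | succ t =>
      rw [Nat.add_sub_cancel]
      simp only [show ∀ k, n + 2 - 1 - k = n + 1 - k by intro k; omega]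
      ring

/-- The correction removes the two end terms of the convolution: `p_0 = r` whereas `x_0 = 0`. -/
theorem powerSumEval_quad (n : ℕ) :
    powerSumEval r (quad ℂ (n + 1)) = ∑ k ∈ range (n + 2), psum (Fin r) ℂ k * psum (Fin r) ℂ (n + 1 - k)
      - 2 * (r : MvPolynomial (Fin r) ℂ) * psum (Fin r) ℂ (n + 1) := by
  rw [quad, map_sum, sum_range_succ, sum_range_succ', sum_range_succ, sum_range_succ']
  simp only [Nat.sub_self, x_zero, mul_zero, zero_mul, map_zero, add_zero, psum_zero, Nat.sub_zero,
    Fintype.card_fin]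
  have : ∀ k ∈ range n, powerSumEval r (x ℂ (k + 1) * x ℂ (n + 1 - (k + 1)))
      = psum (Fin r) ℂ (k + 1) * psum (Fin r) ℂ (n + 1 - (k + 1)) := fun k hk => by
    have := mem_range.mp hk
    rw [map_mul, powerSumEval_x (by omega), powerSumEval_x (by omega), neg_mul_neg]
  rw [sum_congr rfl this]
  ring

/-- The constant multi-exponent. -/
def constExp (r m : ℕ) : Fin r →₀ ℕ := Finsupp.equivFunOnFinite.symm fun _ => m

@[simp] theorem constExp_apply (m : ℕ) (i : Fin r) : constExp r m i = m := rfl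

theorem sum_derivation_apply {ι A : Type*} [CommRing A] [Algebra ℂ A] (s : Finset ι)
    (D : ι → Derivation ℂ A A) (a : A) : (∑ i ∈ s, D i) a = ∑ i ∈ s, D i a := by
  have := congrFun (map_sum (Derivation.coeFnAddMonoidHom (R := ℂ) (A := A) (M := A)) D s) a
  rwa [Finset.sum_apply] at this

/-- Integration by parts: a monomial whose product with `w_i^{n+1}` is `∏ w_j^m` has exponent `m -
(n + 1)` in `w_i`, and this is its eigenvalue under `w_i ∂_i`. -/
theorem coeff_wittDer (n m : ℕ) (f : MvPolynomial (Fin r) ℂ) :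
    coeff (constExp r m) (wittDer r n f)
      = ((m : ℂ) - (n + 1)) * coeff (constExp r m) (psum (Fin r) ℂ (n + 1) * f) := by
  have h : ∀ f, wittDer r n f = ∑ i, X i ^ (n + 1) * (X i * pderiv i f) := by
    intro f
    have : wittDer r n = ∑ i, (X i ^ (n + 2) : MvPolynomial (Fin r) ℂ) • pderiv i := by
      refine derivation_ext fun j => ?_
      rw [wittDer_X, sum_derivation_apply, sum_eq_single j]
      · simp
      · intro i _ hi; simp [pderiv_X_of_ne hi.symm]
      · simp
    rw [this, sum_derivation_apply]
    refine sum_congr rfl fun i _ => ?_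
    rw [Derivation.smul_apply, smul_eq_mul]; ring
  induction f using MvPolynomial.induction_on' with
  | monomial μ a =>
    rw [h, psum, sum_mul, coeff_sum, coeff_sum, mul_sum]
    refine sum_congr rfl fun i _ => ?_
    rw [X_mul_pderiv_monomial, X_pow_eq_monomial, smul_monomial, monomial_mul, monomial_mul,
      coeff_monomial, coeff_monomial]
    split_ifs with he
    · have := DFunLike.congr_fun he i
      simp only [Finsupp.add_apply, Finsupp.single_eq_same, constExp_apply] at this
      rw [← this]; push_cast; simp
    · simp
  | add f g hf hg => rw [map_add, coeff_add, hf, hg, mul_add, coeff_add]; ring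

/-- The functional `f ↦ CT[∏_{i ≠ j} (1 - w_i / w_j)^t ∏ w_i^{-s} f(-p(w))]`. -/
def ctFunctional (r t m : ℕ) : MvPolynomial ℕ ℂ →ₗ[ℂ] ℂ :=
  lcoeff ℂ (constExp r m) ∘ₗ LinearMap.mulLeft ℂ (dysonProduct r ℂ t) ∘ₗ
    (powerSumEval r).toLinearMap

theorem ctFunctional_apply (t m : ℕ) (f : MvPolynomial ℕ ℂ) : ctFunctional r t m f
    = coeff (constExp r m) (dysonProduct r ℂ t * powerSumEval r f) := rfl

/-- After substitution and multiplication by Dyson's product, `L_{-(n+1)}` becomes `wittDer` minus a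
multiple of `p_{n+1}`. The momentum `s - r t` makes that multiple equal to the one in
`coeff_wittDer`, so the whole expression is a total derivative. -/
theorem ctFunctional_lower (r t s n : ℕ) (f : MvPolynomial ℕ ℂ) :
    ctFunctional (r + 1) t (s + 1 + t * r) (lower (t : ℂ) (s - r * t) n f) = 0 := by
  set F := powerSumEval (r + 1) f with hF
  set m := s + 1 + t * r with hm
  have h1 : dysonProduct (r + 1) ℂ t * powerSumEval (r + 1) (lower (t : ℂ) (s - r * t) n f)
      = wittDer (r + 1) n (dysonProduct (r + 1) ℂ t * F)
        - C ((m : ℂ) - (n + 1)) * (psum (Fin (r + 1)) ℂ (n + 1) * (dysonProduct (r + 1) ℂ t * F)) := by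
    rw [lower_apply, map_add, map_mul, ← wittDer_powerSumEval, Derivation.leibniz,
      wittDer_dysonProduct, mulPart]
    simp only [map_add, map_mul, powerSumEval_quad, powerSumEval_x (Nat.succ_ne_zero n),
      smul_eq_mul, ← hF, hm, map_sub, map_natCast, map_one]
    push_cast
    ring
  rw [ctFunctional_apply, h1, coeff_sub, coeff_C_mul, coeff_wittDer, sub_self]

end ConstantTerm

end Fock

end



noncomputable section

namespace Fock

open MvPolynomial Finset Virasoro

/-! ### Non-vanishing of the constant term of Dyson's product -/

section Laurent

variable (r : ℕ)

/-- Real Laurent polynomials in `r` variables. -/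
abbrev Laurent : Type := AddMonoidAlgebra ℝ (Fin r → ℤ)

/-- The inclusion of polynomials into Laurent polynomials. -/
def toLaurent : MvPolynomial (Fin r) ℝ →ₐ[ℝ] Laurent r :=
  aeval fun i => AddMonoidAlgebra.single (Pi.single i 1) 1

/-- The substitution `w_i ↦ w_i⁻¹`. -/
def laurentInv : Laurent r →+* Laurent r :=
  AddMonoidAlgebra.mapDomainRingHom ℝ (-AddMonoidHom.id (Fin r → ℤ))

variable {r}

theorem laurentInv_single (g : Fin r → ℤ) (a : ℝ) :
    laurentInv r (AddMonoidAlgebra.single g a) = AddMonoidAlgebra.single (-g) a := by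
  simp [laurentInv, AddMonoidAlgebra.mapDomain_single]

theorem coeff_laurentInv_neg (b : Laurent r) (g : Fin r → ℤ) :
    (laurentInv r b).coeff (-g) = b.coeff g := by
  induction b using AddMonoidAlgebra.induction_linear with
  | zero => simp
  | add a b ha hb => rw [map_add]; simp [ha, hb]
  | single h a =>
    rw [laurentInv_single]
    simp [Finsupp.single_apply]

/-- The constant term of `a(w) b(w⁻¹)` is the Euclidean inner product of the coefficient vectors,
hence positive for `a = b ≠ 0` with real coefficients. -/
theorem coeff_zero_mul_laurentInv (a b : Laurent r) :
    (a * laurentInv r b).coeff 0 = a.coeff.sum fun g c => c * b.coeff g := by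
  induction a using AddMonoidAlgebra.induction_linear with
  | zero => simp
  | add a a' ha ha' =>
    rw [add_mul, AddMonoidAlgebra.coeff_add, Finsupp.add_apply, ha, ha',
      AddMonoidAlgebra.coeff_add, Finsupp.sum_add_index']
    · simp
    · intros; ring
  | single g c =>
    rw [AddMonoidAlgebra.coeff_single_mul_apply, add_zero, coeff_laurentInv_neg]
    simp

theorem coeff_zero_mul_laurentInv_self_ne_zero {a : Laurent r} (ha : a ≠ 0) :
    (a * laurentInv r a).coeff 0 ≠ 0 := by
  rw [coeff_zero_mul_laurentInv]
  have hne : a.coeff.support.Nonempty := by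
    rw [Finsupp.support_nonempty_iff]
    intro h
    exact ha (by ext; simp [h])
  refine ne_of_gt (sum_pos (fun g hg => ?_) hne)
  have := Finsupp.mem_support_iff.mp hg
  exact mul_self_pos.mpr this

theorem toLaurent_monomial (μ : Fin r →₀ ℕ) (a : ℝ) :
    toLaurent r (monomial μ a) = AddMonoidAlgebra.single (fun i => (μ i : ℤ)) a := by
  have h : ∀ μ : Fin r →₀ ℕ,
      toLaurent r (monomial μ 1) = AddMonoidAlgebra.single (fun i => (μ i : ℤ)) 1 := by
    intro μ
    induction μ using Finsupp.induction_linear with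
    | zero =>
      rw [monomial_zero', map_one, map_one, AddMonoidAlgebra.one_def]
      rfl
    | add μ ν hμ hν =>
      rw [← one_mul (1 : ℝ), ← monomial_mul, map_mul, hμ, hν, AddMonoidAlgebra.single_mul_single]
      congr 1
    | single i k =>
      rw [← X_pow_eq_monomial, map_pow, toLaurent, aeval_X, AddMonoidAlgebra.single_pow, one_pow]
      congr 1
      ext j
      by_cases h : j = i
      · subst h; simp
      · simp [h]
  rw [← mul_one a, ← smul_eq_mul, ← smul_monomial, map_smul, h, AddMonoidAlgebra.smul_single]

theorem coeff_toLaurent (μ : Fin r →₀ ℕ) (f : MvPolynomial (Fin r) ℝ) :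
    (toLaurent r f).coeff (fun i => (μ i : ℤ)) = coeff μ f := by
  induction f using MvPolynomial.induction_on' with
  | monomial ν a =>
    rw [toLaurent_monomial, coeff_monomial, AddMonoidAlgebra.coeff_single, Finsupp.single_apply]
    congr 1
    rw [eq_iff_iff, funext_iff, DFunLike.ext_iff]
    simp
  | add f g hf hg => rw [map_add, coeff_add, ← hf, ← hg]; simp

/-- The constant term in Dyson's product does not vanish. -/
theorem coeff_dysonProduct_real_ne_zero (r t : ℕ) :
    coeff (constExp (r + 1) (t * r)) (dysonProduct (r + 1) ℝ t) ≠ 0 := by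
  set W : Fin (r + 1) → Laurent (r + 1) := fun i => AddMonoidAlgebra.single (Pi.single i 1) 1
  set W' : Fin (r + 1) → Laurent (r + 1) := fun i => AddMonoidAlgebra.single (-Pi.single i 1) 1
  have hW : ∀ i, W i * W' i = 1 := fun i => by
    simp only [W, W', AddMonoidAlgebra.single_mul_single, AddMonoidAlgebra.one_def]
    simp
  have hWinv : ∀ i, laurentInv (r + 1) (W i) = W' i := fun i => laurentInv_single _ _
  have hX : ∀ i, toLaurent (r + 1) (X i) = W i := fun i => aeval_X _ _
  set P := (univ : Finset (Fin (r + 1))).offDiag with hP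
  set Q := P.filter fun p => p.1 < p.2 with hQ
  set V : MvPolynomial (Fin (r + 1)) ℝ := ∏ p ∈ Q, (X p.1 - X p.2) ^ t
  have hsplit : ∀ f : Fin (r + 1) × Fin (r + 1) → Laurent (r + 1),
      ∏ p ∈ P, f p = (∏ p ∈ Q, f p) * ∏ p ∈ Q, f p.swap := by
    intro f
    rw [← prod_filter_mul_prod_filter_not P fun p => p.1 < p.2]
    congr 1
    refine prod_bij' (fun p _ => p.swap) (fun p _ => p.swap) ?_ ?_ ?_ ?_ ?_
    · rintro ⟨i, j⟩ h
      simp [hP, hQ] at h ⊢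
      exact ⟨Ne.symm h.1, lt_of_le_of_ne h.2 (Ne.symm h.1)⟩
    · rintro ⟨i, j⟩ h
      simp [hP, hQ] at h ⊢
      exact ⟨Ne.symm h.1, h.2.le⟩
    · simp
    · simp
    · simp
  have hV : V ≠ 0 := by
    refine prod_ne_zero_iff.mpr fun p hp => pow_ne_zero _ (sub_ne_zero.mpr fun h => ?_)
    rw [hQ, mem_filter] at hp
    exact hp.2.ne (X_injective h)
  have hVL : toLaurent (r + 1) V ≠ 0 := by
    obtain ⟨μ, hμ⟩ := ne_zero_iff.mp hV
    intro h
    rw [← coeff_toLaurent, h] at hμ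
    simp at hμ
  -- Pair by pair, `(w_i - w_j)(w_i⁻¹ - w_j⁻¹) = (w_i - w_j)(w_j - w_i) w_i⁻¹ w_j⁻¹`. So Dyson's
  -- product, normalised by a monomial, is `V(w) V(w⁻¹)`, whose constant term is a sum of squares.
  have hmain : toLaurent (r + 1) V * laurentInv (r + 1) (toLaurent (r + 1) V)
      = toLaurent (r + 1) (dysonProduct (r + 1) ℝ t) * (∏ i, W' i) ^ (t * r) := by
    have h1 : (∏ i, W' i) ^ (t * r) = ∏ p ∈ Q, (W' p.1 * W' p.2) ^ t := by
      -- Each index is the first entry of `r + 1` ordered pairs, one of which is diagonal and is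
      -- cancelled as a unit.
      have h2 : ∏ p ∈ P, W' p.1 = (∏ i, W' i) ^ r := by
        have h3 := prod_union (disjoint_diag_offDiag (univ : Finset (Fin (r + 1))))
          (f := fun p => W' p.1)
        rw [diag_union_offDiag, prod_product, prod_diag] at h3
        simp only [prod_const, card_univ, Fintype.card_fin] at h3
        rw [prod_pow, pow_succ, mul_comm] at h3
        have hu : IsUnit (∏ i, W' i) := by
          refine IsUnit.of_mul_eq_one (∏ i, W i) ?_
          rw [← prod_mul_distrib]
          exact prod_eq_one fun i _ => by rw [mul_comm, hW]
        exact (hu.mul_left_cancel h3).symm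
      rw [mul_comm, pow_mul, ← h2, hsplit, ← prod_mul_distrib, prod_pow]
      rfl
    rw [h1]
    simp only [V, dysonProduct, map_prod, map_pow, map_sub, hX, hWinv]
    rw [← hP, hsplit, ← prod_mul_distrib, ← prod_mul_distrib, ← prod_mul_distrib]
    refine prod_congr rfl fun p _ => ?_
    rw [← mul_pow, ← mul_pow, ← mul_pow]
    congr 1
    simp only [Prod.fst_swap, Prod.snd_swap]
    linear_combination (W p.1 - W p.2) * (W' p.2 * hW p.1 - W' p.1 * hW p.2)
  have hne := coeff_zero_mul_laurentInv_self_ne_zero hVL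
  rw [hmain] at hne
  have hpow : (∏ i, W' i) ^ (t * r)
      = AddMonoidAlgebra.single (-fun i => ((constExp (r + 1) (t * r) i : ℕ) : ℤ)) 1 := by
    have : ∏ i, W i = toLaurent (r + 1) (monomial (constExp (r + 1) 1) 1) := by
      rw [monomial_eq]
      simp [Finsupp.prod_fintype, hX]
    have h2 : ∏ i, W' i = laurentInv (r + 1) (∏ i, W i) := by simp [hWinv]
    rw [h2, this, toLaurent_monomial, laurentInv_single, AddMonoidAlgebra.single_pow, one_pow]
    congr 1
    ext i
    simp
  rw [hpow, AddMonoidAlgebra.coeff_mul_single_apply, zero_add, neg_neg, coeff_toLaurent,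
    mul_one] at hne
  exact hne

theorem coeff_dysonProduct_ne_zero (r t : ℕ) :
    coeff (constExp (r + 1) (t * r)) (dysonProduct (r + 1) ℂ t) ≠ 0 := by
  have h : dysonProduct (r + 1) ℂ t = map (algebraMap ℝ ℂ) (dysonProduct (r + 1) ℝ t) := by
    simp [dysonProduct]
  rw [h, coeff_map]
  simpa using coeff_dysonProduct_real_ne_zero r t

end Laurent

/-! ### Vanishing of the determinant on the curves `α = s - r t` -/

section Vanishing

/-- Newton's identities, with division by `k` allowed over `ℂ`. -/
theorem esymm_mem_range_powerSumEval (r k : ℕ) :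
    esymm (Fin r) ℂ k ∈ (powerSumEval r).range := by
  induction k using Nat.strong_induction_on with
  | _ k ih =>
    rcases Nat.eq_zero_or_pos k with rfl | hk
    · rw [esymm_zero]; exact one_mem _
    have hps : ∀ n, psum (Fin r) ℂ n ∈ (powerSumEval r).range := by
      intro n
      rcases Nat.eq_zero_or_pos n with rfl | hn
      · rw [psum_zero]; exact natCast_mem _ _
      · exact ⟨-x ℂ n, by
          change powerSumEval r (-x ℂ n) = _
          rw [map_neg, powerSumEval_x hn.ne', neg_neg]⟩
    have h := mul_esymm_eq_sum (Fin r) ℂ k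
    have hmem : (k : MvPolynomial (Fin r) ℂ) * esymm (Fin r) ℂ k ∈ (powerSumEval r).range := by
      rw [h]
      refine mul_mem (pow_mem (neg_mem (one_mem _)) _) (sum_mem fun a ha => ?_)
      exact mul_mem (mul_mem (pow_mem (neg_mem (one_mem _)) _)
        (ih _ (mem_filter.mp ha).2)) (hps _)
    have := Subalgebra.smul_mem _ hmem ((k : ℂ)⁻¹)
    rwa [← nsmul_eq_mul, ← Nat.cast_smul_eq_nsmul ℂ, smul_smul,
      inv_mul_cancel₀ (by exact_mod_cast hk.ne'), one_smul] at this

/-- The product of all variables is the top elementary symmetric polynomial, so it has a preimage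
`f`; evaluating at `f ^ s` shifts every exponent by `s` and leaves Dyson's constant term. -/
theorem ctFunctional_ne_zero (r t s : ℕ) : ctFunctional (r + 1) t (s + t * r) ≠ 0 := by
  obtain ⟨f, hf⟩ := esymm_mem_range_powerSumEval (r + 1) (r + 1)
  intro h
  have h1 := LinearMap.congr_fun h (f ^ s)
  have he : esymm (Fin (r + 1)) ℂ (r + 1) = monomial (constExp (r + 1) 1) 1 := by
    have : powersetCard (r + 1) (univ : Finset (Fin (r + 1))) = {univ} := by
      simpa using powersetCard_self (univ : Finset (Fin (r + 1)))
    rw [esymm, this, sum_singleton, monomial_eq]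
    simp [Finsupp.prod_fintype]
  have hf : powerSumEval (r + 1) f = esymm (Fin (r + 1)) ℂ (r + 1) := hf
  have hc : constExp (r + 1) (s + t * r)
      = constExp (r + 1) (t * r) + s • constExp (r + 1) 1 := by
    ext i; simp; ring
  rw [ctFunctional_apply, map_pow, hf, he, monomial_pow, one_pow, hc, coeff_mul_monomial,
    mul_one] at h1
  exact coeff_dysonProduct_ne_zero r t h1

theorem isHomogeneous_powerSumEval_monomial (r : ℕ) (μ : ℕ →₀ ℕ) :
    (powerSumEval r (monomial μ 1)).IsHomogeneous (multiDegree μ) := by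
  induction μ using Finsupp.induction_linear with
  | zero =>
    rw [monomial_zero', map_one, map_one, map_zero]
    exact isHomogeneous_one _ _
  | add μ ν hμ hν =>
    rw [← one_mul (1 : ℂ), ← monomial_mul, map_mul, map_add]
    exact hμ.mul hν
  | single i k =>
    rw [← X_pow_eq_monomial, map_pow, powerSumEval, aeval_X, multiDegree_single, mul_comm]
    refine IsHomogeneous.pow (IsHomogeneous.neg ?_) _
    exact IsHomogeneous.sum _ _ _ fun j _ => isHomogeneous_X_pow _ _

theorem isHomogeneous_dysonProduct (r t : ℕ) :
    (dysonProduct (r + 1) ℂ t).IsHomogeneous ((r + 1) * r * t) := by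
  have : (r + 1) * r * t = ∑ p ∈ (univ : Finset (Fin (r + 1))).offDiag, 1 * t := by
    rw [sum_const, offDiag_card]
    simp only [card_univ, Fintype.card_fin, smul_eq_mul, one_mul]
    rw [← Nat.mul_sub_one, Nat.add_sub_cancel]
  rw [this]
  exact IsHomogeneous.prod _ _ _ fun p _ =>
    ((isHomogeneous_X _ _).sub (isHomogeneous_X _ _)).pow t

/-- Homogeneity: the extracted monomial has degree `(r + 1)(s + t r)`, of which Dyson's product
takes `(r + 1) r t`. -/
theorem ctFunctional_monomial_eq_zero (r t s : ℕ) {μ : ℕ →₀ ℕ}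
    (hμ : multiDegree μ ≠ (r + 1) * s) (a : ℂ) :
    ctFunctional (r + 1) t (s + t * r) (monomial μ a) = 0 := by
  rw [show monomial μ a = a • monomial μ (1 : ℂ) by simp [smul_monomial], map_smul,
    ctFunctional_apply]
  have h := (isHomogeneous_dysonProduct r t).mul (isHomogeneous_powerSumEval_monomial (r + 1) μ)
  rw [h.coeff_eq_zero, smul_zero]
  intro h
  refine hμ ?_
  have : (constExp (r + 1) (s + t * r)).degree = (r + 1) * (s + t * r) := by
    simp [Finsupp.degree_eq_sum]
  rw [this] at h
  nlinarith

/-- The monomials of degree `N` are combinations of the vectors `L_{-λ}|α⟩` as soon as the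
determinant does not vanish. -/
theorem exists_sum_wordVec_eq {t α : ℂ} {N : ℕ} (h : (fockMatrix t α N).det ≠ 0)
    (f : MvPolynomial ℕ ℂ) (hf : ∀ μ, multiDegree μ ≠ N → coeff μ f = 0) :
    ∃ u : Idx N → ℂ, f = ∑ ν, u ν • wordVec t α (sortedWord ν.1) := by
  refine ⟨(fockMatrix t α N)⁻¹.mulVec fun μ => coeff μ.1 f, ?_⟩
  ext μ
  rw [coeff_sum]
  by_cases hμ : multiDegree μ = N
  · have h1 := congrFun (Matrix.mulVec_mulVec (fun μ : Idx N => coeff μ.1 f)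
      (fockMatrix t α N) (fockMatrix t α N)⁻¹) ⟨μ, hμ⟩
    rw [Matrix.mul_nonsing_inv _ (isUnit_iff_ne_zero.mpr h), Matrix.one_mulVec] at h1
    rw [← h1, Matrix.mulVec, dotProduct]
    exact sum_congr rfl fun ν _ => by rw [coeff_smul, smul_eq_mul, mul_comm]; rfl
  · rw [hf μ hμ, sum_eq_zero]
    intro ν _
    rw [coeff_smul, coeff_wordVec_eq_zero _ _ (by rwa [wordDegree_sortedWord, ν.2]), smul_zero]

/-- Were the determinant nonzero, every monomial of this degree would be a combination of nonempty
lowering words and so killed by `ctFunctional`. Other degrees die by homogeneity, and the functional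
would be zero. -/
theorem det_fockMatrix_natCast (r t s : ℕ) :
    (fockMatrix (t : ℂ) (s - r * t) ((r + 1) * (s + 1))).det = 0 := by
  by_contra hdet
  refine ctFunctional_ne_zero r t (s + 1) ?_
  refine (basisMonomials ℕ ℂ).ext fun μ => ?_
  simp only [coe_basisMonomials, LinearMap.zero_apply]
  by_cases hμ : multiDegree μ = (r + 1) * (s + 1)
  · obtain ⟨u, hu⟩ := exists_sum_wordVec_eq hdet (monomial μ 1) fun ν hν => by
      rw [coeff_monomial, if_neg]; rintro rfl; exact hν hμ
    rw [hu, map_sum]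
    refine sum_eq_zero fun ν _ => ?_
    rw [map_smul]
    obtain ⟨n, l, hl⟩ : ∃ n l, sortedWord ν.1 = n :: l := by
      refine List.exists_cons_of_ne_nil fun h => ?_
      have := wordDegree_sortedWord ν.1
      rw [h, wordDegree_nil, ν.2] at this
      simp at this
    rw [hl, wordVec_cons, ctFunctional_lower, smul_zero]
  · exact ctFunctional_monomial_eq_zero r t (s + 1) hμ 1

theorem polynomial_eq_zero_of_natCast {p : Polynomial ℂ} (h : ∀ n : ℕ, p.eval (n : ℂ) = 0) :
    p = 0 := by
  refine p.eq_zero_of_infinite_isRoot ((Set.infinite_range_of_injective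
    (Nat.cast_injective (R := ℂ))).mono ?_)
  rintro _ ⟨n, rfl⟩
  exact h n

/-- The Kac determinant vanishes on the curve attached to `(r + 1, s + 1)`. -/
theorem det_fockMatrix_eq_zero (r s : ℕ) (t : ℂ) :
    (fockMatrix t (s - r * t) ((r + 1) * (s + 1))).det = 0 := by
  set p : Polynomial ℂ := (fockMatrix (Polynomial.X : Polynomial ℂ)
    ((s : Polynomial ℂ) - (r : Polynomial ℂ) * Polynomial.X) ((r + 1) * (s + 1))).det with hp
  have h : ∀ z : ℂ, p.eval z = (fockMatrix z (s - r * z) ((r + 1) * (s + 1))).det := by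
    intro z
    have := map_det_fockMatrix (Polynomial.evalRingHom z) (Polynomial.X : Polynomial ℂ)
      ((s : Polynomial ℂ) - (r : Polynomial ℂ) * Polynomial.X) ((r + 1) * (s + 1))
    simpa using this
  rw [← h, polynomial_eq_zero_of_natCast (p := p) fun n => by rw [h, det_fockMatrix_natCast],
    Polynomial.eval_zero]

end Vanishing

end Fock

end



noncomputable section

/-! ### Multiplicity of a root of a determinant -/

namespace Matrix

open Polynomial

/-- A polynomial matrix whose specialization at `a` has a kernel of dimension at least `k` has
determinant divisible by `(X - a)^k`. -/
theorem pow_dvd_det_of_le_finrank_ker {ι K : Type*} [Fintype ι] [DecidableEq ι] [Field K]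
    (A : Matrix ι ι K[X]) (a : K) {k : ℕ}
    (hk : k ≤ Module.finrank K (LinearMap.ker (A.map (eval a)).mulVecLin)) :
    (X - C a) ^ k ∣ A.det := by
  classical
  set W := LinearMap.ker (A.map (eval a)).mulVecLin with hW
  let bW := Module.finBasis K W
  let v : Fin (Module.finrank K W) → (ι → K) := fun i => bW i
  have hv : LinearIndependent K v := bW.linearIndependent.map' W.subtype (Submodule.ker_subtype W)
  have hs : LinearIndepOn K id (Set.range v) := hv.linearIndepOn_id
  -- A basis of the kernel at `a`, completed to a basis of the whole space, serves as a change of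
  -- columns with constant invertible determinant.
  let b := Module.Basis.extend hs
  let ε : ι ≃ _ := (Pi.basisFun K ι).indexEquiv b
  let P : Matrix ι ι K := fun i j => b (ε j) i
  have hP : IsUnit P.det := by
    have h := (b.reindex ε.symm).isUnit_det (Pi.basisFun K ι)
    have h2 := (Pi.basisFun K ι).isUnit_det (b.reindex ε.symm)
    rw [Module.Basis.det_apply] at h2
    convert h2 using 2
    ext i j
    simp [P, Module.Basis.toMatrix_apply]
  let T : Finset ι := Finset.univ.filter fun j => b (ε j) ∈ W
  have hT : k ≤ T.card := by
    refine hk.trans ?_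
    have : ∀ i, ∃ j, b (ε j) = v i := fun i => by
      refine ⟨ε.symm ⟨v i, hs.subset_extend (Set.subset_univ _) ⟨i, rfl⟩⟩, ?_⟩
      rw [Equiv.apply_symm_apply]
      exact Module.Basis.extend_apply_self hs _
    choose g hg using this
    have := Finset.card_le_card_of_injOn g (s := Finset.univ) (t := T)
      (fun i _ => by simp [T, hg]; exact (bW i).2)
      (fun i _ j _ h => hv.injective (by rw [← hg, ← hg, h]))
    simpa using this
  -- Columns attached to kernel vectors vanish at `a`, so each of them contributes one factor `X - C
  -- a`.
  have hdvd : ∀ i j, j ∈ T → (X - C a) ∣ (A * P.map C) i j := by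
    intro i j hj
    rw [dvd_iff_isRoot, IsRoot, mul_apply, eval_finsetSum]
    have h := (Finset.mem_filter.mp hj).2
    replace h : (A.map (eval a)).mulVec (b (ε j)) = 0 := h
    have := congrFun h i
    rw [Pi.zero_apply] at this
    rw [← this]
    exact Finset.sum_congr rfl fun x _ => by rw [map_apply, eval_mul, eval_C]; rfl
  choose q hq using hdvd
  have hfac : A * P.map C = of fun i j => (if j ∈ T then X - C a else 1) *
      (if h : j ∈ T then q i j h else (A * P.map C) i j) := by
    ext1 i j
    rw [of_apply]
    split_ifs with h
    · exact hq i j h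
    · rw [one_mul]
  have hdet : (A * P.map C).det = (∏ j, if j ∈ T then X - C a else 1) *
      (of fun i j => if h : j ∈ T then q i j h else (A * P.map C) i j).det := by
    conv_lhs => rw [hfac]
    exact det_mul_row (fun j => if j ∈ T then X - C a else 1)
      (of fun i j => if h : j ∈ T then q i j h else (A * P.map C) i j)
  rw [det_mul, Finset.prod_ite_mem, Finset.univ_inter, Finset.prod_const] at hdet
  have hPC : IsUnit (P.map (C : K →+* K[X])).det := by
    have := RingHom.map_det (C : K →+* K[X]) P
    rw [RingHom.mapMatrix_apply] at this
    rw [← this]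
    exact hP.map C
  have : (X - C a) ^ T.card ∣ A.det * (P.map C).det := ⟨_, hdet⟩
  exact (pow_dvd_pow _ hT).trans ((hPC.dvd_mul_right).mp this)

end Matrix

/-! ### Multiplicities of the zeros of the Fock determinant -/

namespace Fock

open MvPolynomial Finset Virasoro

theorem word_lower_one {R : Type*} [CommRing R] [Algebra ℂ R] (t α : R) (l : List ℕ)
    (f : MvPolynomial ℕ R) :
    word (fun n => (lower t α n).restrictScalars ℂ) l f = l.foldr (fun n f => lower t α n f) f := by
  induction l with
  | nil => simp
  | cons n l ih => rw [word_cons, Module.End.mul_apply, ih]; rfl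

theorem wordVec_append {R : Type*} [CommRing R] [Algebra ℂ R] (t α : R) (l l' : List ℕ) :
    wordVec t α (l ++ l')
      = word (fun n => (lower t α n).restrictScalars ℂ) l (wordVec t α l') := by
  rw [word_lower_one, wordVec, List.foldr_append, wordVec]

theorem lower_restrictScalars_comm {R : Type*} [CommRing R] [Algebra ℂ R] (t α : R) (m n : ℕ) :
    (lower t α m).restrictScalars ℂ * (lower t α n).restrictScalars ℂ
      - (lower t α n).restrictScalars ℂ * (lower t α m).restrictScalars ℂ
      = ((n : ℂ) - m) • (lower t α (m + n + 1)).restrictScalars ℂ := by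
  refine LinearMap.ext fun f => ?_
  have h := lower_comm t α m n f
  simp only [LinearMap.sub_apply, Module.End.mul_apply, LinearMap.restrictScalars_apply,
    LinearMap.smul_apply]
  rw [h, sub_smul, ← map_natCast (algebraMap ℂ (MvPolynomial ℕ R)) n,
    ← map_natCast (algebraMap ℂ (MvPolynomial ℕ R)) m, sub_mul, Algebra.smul_def, Algebra.smul_def]

/-- Straightening only uses structure constants of the Virasoro algebra, so the coefficients lie in
`ℂ` even when `R` contains the momentum as a variable. -/
theorem exists_wordVec_eq_sum_sortedWord {R : Type*} [CommRing R] [Algebra ℂ R] (t α : R)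
    (l : List ℕ) {N : ℕ} (hl : wordDegree l = N) :
    ∃ u : Idx N → ℂ, wordVec t α l = ∑ ν, u ν • wordVec t α (sortedWord ν.1) := by
  subst hl
  have h := word_mem_span_sortedWord (lower_restrictScalars_comm t α) l
  obtain ⟨u, hu⟩ := (Submodule.mem_span_range_iff_exists_fun ℂ).mp h
  refine ⟨u, ?_⟩
  have h1 := fun l => wordVec_append t α l []
  simp only [List.append_nil, wordVec_nil] at h1
  rw [h1, ← hu, LinearMap.sum_apply]
  exact sum_congr rfl fun ν _ => by rw [h1, LinearMap.smul_apply]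

theorem sum_smul_wordVec_eq_zero_iff {t α : ℂ} {N : ℕ} (u : Idx N → ℂ) :
    ∑ ν, u ν • wordVec t α (sortedWord ν.1) = 0 ↔ (fockMatrix t α N).mulVec u = 0 := by
  constructor
  · intro h
    ext μ
    have := congrArg (coeff μ.1) h
    simpa [coeff_sum, fockMatrix, Matrix.mulVec, dotProduct, mul_comm] using this
  · intro h
    ext μ
    by_cases hμ : multiDegree μ = N
    · have := congrFun h ⟨μ, hμ⟩
      simpa [coeff_sum, fockMatrix, Matrix.mulVec, dotProduct, mul_comm] using this
    · rw [coeff_sum]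
      refine sum_eq_zero fun ν _ => ?_
      rw [coeff_smul, coeff_wordVec_eq_zero _ _ (by rwa [wordDegree_sortedWord, ν.2]), smul_zero]

/-- Lowering words of degree `N` applied to a null vector of level `(r+1)(s+1)` give further null
vectors. They are independent in the lowering algebra because it has no zero divisors. -/
theorem card_idx_le_finrank_ker (r s : ℕ) (t : ℂ) (N : ℕ) :
    Fintype.card (Idx N) ≤ Module.finrank ℂ
      (LinearMap.ker (fockMatrix t (s - r * t) ((r + 1) * (s + 1) + N)).mulVecLin) := by
  set α : ℂ := s - r * t
  set M := (r + 1) * (s + 1)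
  obtain ⟨k, hk0, hk⟩ := Matrix.exists_mulVec_eq_zero_iff.mpr (det_fockMatrix_eq_zero r s t)
  rw [← sum_smul_wordVec_eq_zero_iff] at hk
  -- Straightened with the momentum as a variable: there independence can be tested, and afterwards
  -- the same relations are specialised to `α`.
  have hex := fun (μ : Idx N) (ν : Idx M) => exists_wordVec_eq_sum_sortedWord
    (Polynomial.C t) Polynomial.X (sortedWord μ.1 ++ sortedWord ν.1) (N := M + N)
    (by simp [μ.2, ν.2, add_comm])
  choose u hu using hex
  let Ψ : (Idx N → ℂ) →ₗ[ℂ] (Idx (M + N) → ℂ) :=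
    ∑ μ, ∑ ν, k ν • (LinearMap.proj μ).smulRight (u μ ν)
  have hΨ : ∀ c, Ψ c = ∑ μ, ∑ ν, (c μ * k ν) • u μ ν := by
    intro c
    simp only [Ψ, LinearMap.sum_apply, LinearMap.smul_apply, LinearMap.smulRight_apply,
      LinearMap.proj_apply, smul_smul, mul_comm]
  have hsum : ∀ c, ∑ μ, ∑ ν, Polynomial.C (c μ * k ν) •
      wordVec (Polynomial.C t) Polynomial.X (sortedWord μ.1 ++ sortedWord ν.1)
      = ∑ σ, Polynomial.C (Ψ c σ) •
        wordVec (Polynomial.C t) Polynomial.X (sortedWord σ.1) := by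
    intro c
    have h1 : ∀ (z : ℂ) (f : MvPolynomial ℕ (Polynomial ℂ)), Polynomial.C z • f = z • f := by
      intro z f
      ext; simp [coeff_smul]
    simp only [hΨ, Finset.sum_apply, Pi.smul_apply, h1, smul_eq_mul, hu, sum_smul, smul_sum,
      smul_smul]
    rw [sum_comm]
    refine Eq.trans ?_ sum_comm
    rw [sum_comm]
    exact sum_congr rfl fun μ _ => sum_comm
  have hinj : Function.Injective Ψ := by
    rw [← LinearMap.ker_eq_bot, LinearMap.ker_eq_bot']
    intro c hc
    refine eq_zero_of_sum_wordVec_append_eq_zero t k c hk0 ?_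
    rw [hsum, hc]; simp
  have hker : ∀ c, Ψ c ∈ LinearMap.ker (fockMatrix t α (M + N)).mulVecLin := by
    intro c
    rw [LinearMap.mem_ker, Matrix.mulVecLin_apply, ← sum_smul_wordVec_eq_zero_iff]
    have h := congrArg (map (Polynomial.evalRingHom α)) (hsum c)
    simp only [map_sum, smul_eq_C_mul, map_mul, map_C, map_wordVec, Polynomial.coe_evalRingHom,
      Polynomial.eval_C, Polynomial.eval_X] at h
    simp only [smul_eq_C_mul]
    rw [← h]
    refine sum_eq_zero fun μ _ => ?_
    simp only [mul_assoc]
    simp only [← smul_eq_C_mul, wordVec_append]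
    rw [← smul_sum]
    simp only [← map_smul]
    rw [← map_sum, hk, map_zero, smul_zero]
  have := LinearMap.finrank_le_finrank_of_injective (f := Ψ.codRestrict _ hker)
    (fun a b h => hinj (congrArg Subtype.val h))
  simpa using this

/-! ### The determinant formula -/

/-- The pairs `(r, s)` for which `(r + 1) (s + 1) ≤ N`. -/
def kacPairs (N : ℕ) : Finset (ℕ × ℕ) :=
  (range N ×ˢ range N).filter fun p => (p.1 + 1) * (p.2 + 1) ≤ N

theorem mem_kacPairs {N : ℕ} {p : ℕ × ℕ} : p ∈ kacPairs N ↔ (p.1 + 1) * (p.2 + 1) ≤ N := by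
  simp only [kacPairs, mem_filter, mem_product, mem_range, and_iff_right_iff_imp]
  intro h
  constructor <;> nlinarith

/-- Deleting `s + 1` parts equal to `r + 1` is a bijection onto the partitions of the remainder. -/
theorem card_filter_lt (N r s : ℕ) (h : (r + 1) * (s + 1) ≤ N) :
    (univ.filter fun μ : Idx N => s < μ.1 r).card = Fintype.card (Idx (N - (r + 1) * (s + 1))) := by
  rw [← card_univ]
  refine card_bij' (fun μ _ => ⟨μ.1 - Finsupp.single r (s + 1), ?_⟩)
    (fun μ _ => ⟨μ.1 + Finsupp.single r (s + 1), ?_⟩) ?_ ?_ ?_ ?_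
  · have hμ := (mem_filter.mp ‹_›).2
    have hle : Finsupp.single r (s + 1) ≤ μ.1 := Finsupp.single_le_iff.mpr hμ
    have := congrArg multiDegree (tsub_add_cancel_of_le hle)
    rw [map_add, multiDegree_single, μ.2] at this
    rw [mul_comm (r + 1)]; omega
  · rw [map_add, multiDegree_single, μ.2, mul_comm (s + 1)]; omega
  · intro μ _; exact mem_univ _
  · intro μ _
    simp only [mem_filter, mem_univ, true_and, Finsupp.add_apply, Finsupp.single_eq_same]
    omega
  · intro μ hμ
    exact Subtype.ext (tsub_add_cancel_of_le
      (Finsupp.single_le_iff.mpr (mem_filter.mp hμ).2))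
  · intro μ _
    exact Subtype.ext (add_tsub_cancel_right _ _)

/-- Double counting: `μ` has `μ r` parts equal to `r + 1`, one for each `s < μ r`. This matches the
degree of the determinant with the multiplicities of its known roots. -/
theorem totalDegree_eq (N : ℕ) : totalDegree N
    = ∑ p ∈ kacPairs N, Fintype.card (Idx (N - (p.1 + 1) * (p.2 + 1))) := by
  have h1 : ∀ μ : Idx N, μ.1.degree
      = ∑ p ∈ range N ×ˢ range N, if p.2 < μ.1 p.1 then 1 else 0 := by
    intro μ
    have hb : ∀ i, μ.1 i * (i + 1) ≤ N := fun i => by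
      have := le_multiDegree μ.1 i
      rwa [μ.2] at this
    have hsub : μ.1.support ⊆ range N := fun i hi => by
      have h1 := hb i
      have h2 := Nat.pos_of_ne_zero (Finsupp.mem_support_iff.mp hi)
      rw [mem_range]; nlinarith
    rw [sum_product, Finsupp.degree_apply, sum_subset hsub fun i _ hi => by simpa using hi]
    refine sum_congr rfl fun i _ => ?_
    have h1 : μ.1 i ≤ N := by have := hb i; nlinarith
    rw [← card_filter]
    have : (range N).filter (fun j => j < μ.1 i) = range (μ.1 i) := by
      ext j; simp; omega
    rw [this, card_range]
  rw [totalDegree, sum_congr rfl fun μ _ => h1 μ, sum_comm, kacPairs, sum_filter]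
  refine sum_congr rfl fun p _ => ?_
  rw [← sum_filter, ← card_eq_sum_ones]
  split_ifs with h
  · exact card_filter_lt N p.1 p.2 h
  · rw [card_eq_zero, filter_eq_empty_iff]
    intro μ _ hlt
    have := le_multiDegree μ.1 p.1
    rw [μ.2] at this
    exact h (by nlinarith)

/-- The hypothesis makes the roots distinct, so the prime powers are coprime and their product
divides the determinant; both are monic of the same degree. -/
theorem det_fockMatrix_X_eq {t : ℂ}
    (ht : ∀ r s r' s' : ℕ, (s : ℂ) - r * t = s' - r' * t → r = r' ∧ s = s') (N : ℕ) :
    (fockMatrix (Polynomial.C t) Polynomial.X N).det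
      = ∏ p ∈ kacPairs N, (Polynomial.X - Polynomial.C ((p.2 : ℂ) - p.1 * t))
          ^ Fintype.card (Idx (N - (p.1 + 1) * (p.2 + 1))) := by
  obtain ⟨hmonic, hdeg⟩ := monic_det_fockMatrix t N
  refine Polynomial.eq_of_monic_of_dvd_of_natDegree_le
    (Polynomial.monic_prod_of_monic _ _ fun p _ => (Polynomial.monic_X_sub_C _).pow _) hmonic
    (prod_dvd_of_coprime ?_ ?_) ?_
  · intro p _ q _ hpq
    refine IsCoprime.pow (Polynomial.isCoprime_X_sub_C_of_isUnit_sub ?_)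
    rw [isUnit_iff_ne_zero, sub_ne_zero]
    intro h
    obtain ⟨h1, h2⟩ := ht _ _ _ _ h
    exact hpq (Prod.ext h1 h2)
  · intro p hp
    refine Matrix.pow_dvd_det_of_le_finrank_ker _ _ ?_
    have hmap := map_fockMatrix (Polynomial.evalRingHom ((p.2 : ℂ) - p.1 * t))
      (Polynomial.C t) Polynomial.X N
    rw [Polynomial.coe_evalRingHom] at hmap
    rw [hmap, Polynomial.eval_C, Polynomial.eval_X]
    have := card_idx_le_finrank_ker p.1 p.2 t (N - (p.1 + 1) * (p.2 + 1))
    rwa [Nat.add_sub_of_le (mem_kacPairs.mp hp)] at this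
  · rw [hdeg, totalDegree_eq, Polynomial.natDegree_prod_of_monic _ _
      fun p _ => (Polynomial.monic_X_sub_C _).pow _]
    refine (sum_congr rfl fun p _ => ?_).le
    rw [(Polynomial.monic_X_sub_C _).natDegree_pow, Polynomial.natDegree_X_sub_C, mul_one]

/-- The determinant formula for Fock spaces, of which the Kac determinant formula is a
consequence. -/
theorem det_fockMatrix_eq (t α : ℂ) (N : ℕ) : (fockMatrix t α N).det
    = ∏ p ∈ kacPairs N, (α - (p.2 - p.1 * t)) ^ Fintype.card (Idx (N - (p.1 + 1) * (p.2 + 1))) := by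
  -- Infinitely many irrational parameters `√2 + n`, for which the roots are distinct; the identity
  -- is polynomial in `t`, so these suffice.
  have hirr : ∀ n : ℕ, ∀ r s r' s' : ℕ, (s : ℂ) - r * ((Real.sqrt 2 + n : ℝ) : ℂ)
      = s' - r' * ((Real.sqrt 2 + n : ℝ) : ℂ) → r = r' ∧ s = s' := by
    intro n r s r' s' h
    have hI : Irrational (Real.sqrt 2 + n) := irrational_sqrt_two.add_natCast n
    have h' : ((r' : ℝ) - r) * (Real.sqrt 2 + n) = (s' : ℝ) - s := by
      have : ((r' : ℂ) - r) * ((Real.sqrt 2 + n : ℝ) : ℂ) = (s' : ℂ) - s := by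
        linear_combination h
      exact_mod_cast this
    have hr : r = r' := by
      by_contra hne
      have hne' : ((r' : ℤ) - r : ℤ) ≠ 0 := by omega
      refine (hI.intCast_mul hne') ⟨((s' : ℤ) - s : ℤ), ?_⟩
      push_cast
      exact h'.symm
    subst hr
    refine ⟨rfl, ?_⟩
    rw [sub_self, zero_mul] at h'
    exact_mod_cast (sub_eq_zero.mp h'.symm).symm
  set p : Polynomial ℂ := (fockMatrix (Polynomial.X : Polynomial ℂ) (Polynomial.C α) N).det
    - ∏ p ∈ kacPairs N, (Polynomial.C α - ((p.2 : Polynomial ℂ) - (p.1 : Polynomial ℂ) * Polynomial.X))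
      ^ Fintype.card (Idx (N - (p.1 + 1) * (p.2 + 1))) with hp
  have heval : ∀ z : ℂ, p.eval z = (fockMatrix z α N).det
      - ∏ p ∈ kacPairs N, (α - (p.2 - p.1 * z)) ^ Fintype.card (Idx (N - (p.1 + 1) * (p.2 + 1))) := by
    intro z
    have := map_det_fockMatrix (Polynomial.evalRingHom z) (Polynomial.X : Polynomial ℂ)
      (Polynomial.C α) N
    simp only [Polynomial.coe_evalRingHom, Polynomial.eval_X, Polynomial.eval_C] at this
    rw [hp, Polynomial.eval_sub, this, Polynomial.eval_prod]
    simp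
  have h0 : p = 0 := by
    refine p.eq_zero_of_infinite_isRoot ((Set.infinite_range_of_injective
      (f := fun n : ℕ => ((Real.sqrt 2 + n : ℝ) : ℂ)) ?_).mono ?_)
    · intro m n h
      simpa using h
    · rintro _ ⟨n, rfl⟩
      change p.eval _ = 0
      rw [heval, sub_eq_zero]
      have h1 := congrArg (Polynomial.eval α) (det_fockMatrix_X_eq (hirr n) N)
      have := map_det_fockMatrix (Polynomial.evalRingHom α)
        (Polynomial.C ((Real.sqrt 2 + n : ℝ) : ℂ)) Polynomial.X N
      simp only [Polynomial.coe_evalRingHom, Polynomial.eval_X, Polynomial.eval_C] at this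
      rw [← this, h1, Polynomial.eval_prod]
      simp
  have := heval t
  rw [h0, Polynomial.eval_zero, eq_comm, sub_eq_zero] at this
  exact this

end Fock

end



noncomputable section

namespace Fock

open MvPolynomial Finset Virasoro

/-! ### The Virasoro action on Fock space -/

section Raise

/-- The annihilation operator `k ∂/∂x_k`. -/
def ann : ℕ → Derivation ℂ (MvPolynomial ℕ ℂ) (MvPolynomial ℕ ℂ)
  | 0 => 0
  | k + 1 => ((k + 1 : ℕ) : ℂ) • pderiv k

@[simp] theorem ann_zero : ann 0 = 0 := rfl

theorem ann_x (k j : ℕ) : ann k (x ℂ j) = if j = k then (k : MvPolynomial ℕ ℂ) else 0 := by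
  cases k with
  | zero => simp
  | succ k =>
    cases j with
    | zero => simp
    | succ j =>
      rw [ann, x_succ, Derivation.smul_apply, pderiv_X, Pi.single_apply, smul_eq_C_mul, map_natCast]
      by_cases h : j = k <;> simp [h]

theorem derivation_ext_x {D₁ D₂ : Derivation ℂ (MvPolynomial ℕ ℂ) (MvPolynomial ℕ ℂ)}
    (h : ∀ k, D₁ (x ℂ k) = D₂ (x ℂ k)) : D₁ = D₂ :=
  derivation_ext fun i => h (i + 1)

theorem ann_comm (k l : ℕ) (f : MvPolynomial ℕ ℂ) : ann k (ann l f) = ann l (ann k f) := by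
  have h : ⁅ann k, ann l⁆ = 0 := derivation_ext_x fun j => by
    rw [Derivation.commutator_apply, ann_x, ann_x]
    split_ifs <;> simp
  have := congrArg (fun D => D f) h
  rw [Derivation.commutator_apply] at this
  simpa [sub_eq_zero] using this

/-- The derivation `x_j ↦ j x_{j-(m+1)}`. -/
def dropDer (m : ℕ) : Derivation ℂ (MvPolynomial ℕ ℂ) (MvPolynomial ℕ ℂ) :=
  mkDerivation ℂ fun i => ((i + 1 : ℕ) : MvPolynomial ℕ ℂ) * x ℂ (i + 1 - (m + 1))

@[simp] theorem dropDer_x (m k : ℕ) :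
    dropDer m (x ℂ k) = (k : MvPolynomial ℕ ℂ) * x ℂ (k - (m + 1)) := by
  cases k with
  | zero => simp
  | succ k => rw [x_succ, dropDer, mkDerivation_X]

variable (t α : ℂ)

/-- The operator `L_{m+1}` on the Fock space of momentum `α`. -/
def raise (m : ℕ) : Module.End ℂ (MvPolynomial ℕ ℂ) :=
  (4 * t)⁻¹ • ∑ k ∈ range (m + 2), (ann k).toLinearMap * (ann (m + 1 - k)).toLinearMap
    + (dropDer m).toLinearMap
    + ((α + (1 - t) * (m + 2)) / (2 * t)) • (ann (m + 1)).toLinearMap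

theorem raise_apply (m : ℕ) (f : MvPolynomial ℕ ℂ) : raise t α m f
    = (4 * t)⁻¹ • ∑ k ∈ range (m + 2), ann k (ann (m + 1 - k) f) + dropDer m f
      + ((α + (1 - t) * (m + 2)) / (2 * t)) • ann (m + 1) f := by
  simp [raise, LinearMap.sum_apply]

@[simp] theorem raise_one (m : ℕ) : raise t α m 1 = 0 := by
  simp [raise_apply]

theorem ann_ann_x_mul (k l j : ℕ) (f : MvPolynomial ℕ ℂ) : ann k (ann l (x ℂ j * f))
    = x ℂ j * ann k (ann l f) + (if j = k then (k : MvPolynomial ℕ ℂ) else 0) * ann l f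
      + (if j = l then (l : MvPolynomial ℕ ℂ) else 0) * ann k f := by
  simp only [Derivation.leibniz, map_add, ann_x, smul_eq_mul]
  have : ann k (if j = l then (l : MvPolynomial ℕ ℂ) else 0) = 0 := by split_ifs <;> simp
  rw [this]; ring

variable {t}

/-- The second-order part contributes twice, once for each of its two annihilation factors, which
turns `(4 t)⁻¹` into `(2 t)⁻¹`. -/
theorem raise_x_mul (ht : t ≠ 0) (m j : ℕ) (f : MvPolynomial ℕ ℂ) : raise t α m (x ℂ j * f)
    = x ℂ j * raise t α m f + (j : ℂ) • (x ℂ (j - (m + 1)) * f + (2 * t)⁻¹ • ann (m + 1 - j) f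
      + if j = m + 1 then ((α + (1 - t) * (m + 2)) / (2 * t)) • f else 0) := by
  have hsum : ∑ k ∈ range (m + 2), ann k (ann (m + 1 - k) (x ℂ j * f))
      = x ℂ j * ∑ k ∈ range (m + 2), ann k (ann (m + 1 - k) f)
        + (2 * j : ℂ) • ann (m + 1 - j) f := by
    simp only [ann_ann_x_mul, sum_add_distrib, ← mul_sum]
    have h1 : ∑ k ∈ range (m + 2), (if j = k then (k : MvPolynomial ℕ ℂ) else 0)
        * ann (m + 1 - k) f = (j : MvPolynomial ℕ ℂ) * ann (m + 1 - j) f := by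
      rw [sum_eq_single j]
      · simp
      · intro b _ hb; rw [if_neg hb.symm, zero_mul]
      · intro h
        rw [show m + 1 - j = 0 by rw [mem_range] at h; omega]; simp
    have h2 : ∑ k ∈ range (m + 2), (if j = m + 1 - k then ((m + 1 - k : ℕ) : MvPolynomial ℕ ℂ)
        else 0) * ann k f = (j : MvPolynomial ℕ ℂ) * ann (m + 1 - j) f := by
      rw [← h1, ← sum_flip]
      refine sum_congr rfl fun k hk => ?_
      have := mem_range.mp hk
      rw [show m + 1 - (m + 1 - k) = k by omega]
    rw [h1, h2, smul_eq_C_mul, map_mul, map_natCast, map_ofNat]; ring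
  rw [raise_apply, hsum, raise_apply, Derivation.leibniz, Derivation.leibniz, dropDer_x, ann_x]
  have h4 : (4 * t)⁻¹ * (2 * (j : ℂ)) = j * (2 * t)⁻¹ := by field_simp; norm_num
  rw [smul_add (4 * t)⁻¹, smul_smul (4 * t)⁻¹, h4]
  by_cases hj : j = m + 1
  · subst hj
    simp only [if_true, smul_eq_mul, smul_eq_C_mul, map_mul, map_natCast]
    ring
  · simp only [if_neg hj, smul_eq_mul, smul_eq_C_mul, map_mul, map_natCast]
    ring

theorem dropDer_ann (m j : ℕ) (f : MvPolynomial ℕ ℂ) : dropDer m (ann j f)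
    = ann j (dropDer m f) - (j : ℂ) • ann (j + (m + 1)) f := by
  have h : ⁅dropDer m, ann j⁆ = -(j : ℂ) • ann (j + (m + 1)) := derivation_ext_x fun k => by
    rw [Derivation.commutator_apply, Derivation.smul_apply, ann_x, ann_x, dropDer_x,
      Derivation.leibniz, ann_x]
    have : dropDer m (if k = j then (j : MvPolynomial ℕ ℂ) else 0) = 0 := by split_ifs <;> simp
    rw [this, Derivation.map_natCast]
    rcases Nat.eq_zero_or_pos j with rfl | hj
    · simp
    by_cases hk : k = j + (m + 1)
    · rw [if_pos hk, if_pos (by omega), hk]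
      simp only [smul_eq_C_mul, smul_eq_mul, map_neg, map_natCast]; push_cast; ring
    · rw [if_neg hk, if_neg (by omega)]; simp
  have := congrArg (fun D => D f) h
  simp only [Derivation.commutator_apply, Derivation.smul_apply] at this
  rw [neg_smul, sub_eq_iff_eq_add] at this
  rw [this]; abel

theorem raise_ann (m j : ℕ) (f : MvPolynomial ℕ ℂ) : raise t α m (ann j f)
    = ann j (raise t α m f) - (j : ℂ) • ann (j + (m + 1)) f := by
  simp only [raise_apply, map_add, Derivation.map_smul, map_sum, dropDer_ann]
  rw [sum_congr rfl fun k _ => by rw [ann_comm _ j f, ann_comm k j], ann_comm _ j f]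
  abel

theorem shiftDer_ann (n j : ℕ) (f : MvPolynomial ℕ ℂ) : shiftDer ℂ n (ann j f)
    = ann j (shiftDer ℂ n f) - (j : ℂ) • ann (j - (n + 1)) f := by
  have h : ⁅shiftDer ℂ n, ann j⁆ = -(j : ℂ) • ann (j - (n + 1)) := derivation_ext_x fun k => by
    rw [Derivation.commutator_apply, Derivation.smul_apply, ann_x, ann_x, shiftDer_x,
      Derivation.leibniz, ann_x]
    have : shiftDer ℂ n (if k = j then (j : MvPolynomial ℕ ℂ) else 0) = 0 := by split_ifs <;> simp
    rw [this, Derivation.map_natCast]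
    by_cases hk : k + (n + 1) = j
    · rw [if_pos hk, if_pos (by omega), show j - (n + 1) = k by omega]
      simp only [smul_eq_C_mul, smul_eq_mul, map_neg, map_natCast]; ring
    · rw [if_neg hk]
      by_cases hk' : k = j - (n + 1)
      · rw [if_pos hk', show j - (n + 1) = 0 by omega]; simp
      · rw [if_neg hk']; simp
  have := congrArg (fun D => D f) h
  simp only [Derivation.commutator_apply, Derivation.smul_apply] at this
  rw [neg_smul, sub_eq_iff_eq_add] at this
  rw [this]; abel

theorem ann_quad (j N : ℕ) : ann j (quad ℂ N) = (2 * j : ℂ) • x ℂ (N - j) := by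
  simp only [quad, map_sum, Derivation.leibniz, ann_x, smul_eq_mul, sum_add_distrib]
  have h1 : ∑ k ∈ range (N + 1), x ℂ (N - k) * (if k = j then (j : MvPolynomial ℕ ℂ) else 0)
      = x ℂ (N - j) * j := by
    rw [sum_eq_single j]
    · simp
    · intro b _ hb; rw [if_neg hb, mul_zero]
    · intro h
      rw [show N - j = 0 by rw [mem_range] at h; omega]; simp
  have h2 : ∑ k ∈ range (N + 1), x ℂ k * (if N - k = j then (j : MvPolynomial ℕ ℂ) else 0)
      = x ℂ (N - j) * j := by
    rw [← h1, ← sum_flip]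
    refine sum_congr rfl fun k hk => ?_
    have := mem_range.mp hk
    rw [show N - (N - k) = k by omega]
  rw [h1, h2, smul_eq_C_mul, map_mul, map_natCast, map_ofNat]; ring

theorem ann_mulPart (n j : ℕ) : ann j (mulPart t α n) = (j : ℂ) • ((2 * t) • x ℂ (n + 1 - j)
    + if j = n + 1 then C (α + (t - 1) * n) else 0) := by
  rw [mulPart, map_add, Derivation.leibniz, Derivation.leibniz, derivation_C, derivation_C, ann_x,
    ann_quad]
  by_cases h : j = n + 1
  · rw [if_pos h, if_pos h.symm, h]
    simp only [smul_eq_C_mul, smul_eq_mul, map_natCast, map_mul, map_ofNat]; ring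
  · rw [if_neg h, if_neg (Ne.symm h)]
    simp only [smul_eq_C_mul, smul_eq_mul, map_natCast, map_mul, map_ofNat]; ring

theorem lower_ann (n j : ℕ) (f : MvPolynomial ℕ ℂ) : lower t α n (ann j f)
    = ann j (lower t α n f) - (j : ℂ) • (ann (j - (n + 1)) f + (2 * t) • (x ℂ (n + 1 - j) * f)
      + if j = n + 1 then (α + (t - 1) * n) • f else 0) := by
  rw [lower_apply, lower_apply, map_add, Derivation.leibniz, shiftDer_ann, ann_mulPart]
  by_cases h : j = n + 1
  · simp only [if_pos h, smul_eq_C_mul, smul_eq_mul]; ring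
  · simp only [if_neg h, smul_eq_C_mul, smul_eq_mul]; ring

theorem lower_x_mul (n j : ℕ) (f : MvPolynomial ℕ ℂ) : lower t α n (x ℂ j * f)
    = x ℂ j * lower t α n f + (j : ℂ) • (x ℂ (j + (n + 1)) * f) := by
  rw [lower_apply, lower_apply, Derivation.leibniz, shiftDer_x]
  simp only [smul_eq_C_mul, smul_eq_mul, map_natCast]; ring

end Raise

end Fock

end



noncomputable section

namespace Fock

open MvPolynomial Finset Virasoro

/-! ### Heisenberg operators and the Virasoro relations on Fock space -/

section Modes

/-- The lowest weight of the Fock space of momentum `α`. -/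
def lowestWeight (t α : ℂ) : ℂ := (α ^ 2 + 2 * (1 - t) * α) / (4 * t)

/-- The Virasoro operators on the Fock space of momentum `α`. -/
def modes (t α : ℂ) : ℤ → Module.End ℂ (MvPolynomial ℕ ℂ)
  | Int.ofNat 0 => (euler ℂ).toLinearMap + lowestWeight t α • 1
  | Int.ofNat (n + 1) => raise t α n
  | Int.negSucc n => lower t α n

theorem modes_zero (t α : ℂ) (f : MvPolynomial ℕ ℂ) :
    modes t α 0 f = euler ℂ f + lowestWeight t α • f := rfl

theorem modes_succ (t α : ℂ) (n : ℕ) : modes t α ((n : ℤ) + 1) = raise t α n := rfl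

theorem modes_neg (t α : ℂ) (n : ℕ) : modes t α (-((n : ℤ) + 1)) = lower t α n := by
  rw [← Int.negSucc_eq]; rfl

/-- The Heisenberg operators. -/
def heis (t α : ℂ) (n : ℤ) : Module.End ℂ (MvPolynomial ℕ ℂ) :=
  (ann n.toNat).toLinearMap + (2 * t) • LinearMap.mulLeft ℂ (x ℂ (-n).toNat)
    + if n = 0 then α • 1 else 0

variable {t : ℂ} (α : ℂ)

theorem heis_apply (n : ℤ) (f : MvPolynomial ℕ ℂ) : heis t α n f = ann n.toNat f
    + (2 * t) • (x ℂ (-n).toNat * f) + if n = 0 then α • f else 0 := by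
  rw [heis]
  split_ifs <;> simp

theorem heis_zero (f : MvPolynomial ℕ ℂ) : heis t α 0 f = α • f := by simp [heis_apply]

theorem heis_pos {k : ℕ} (hk : k ≠ 0) (f : MvPolynomial ℕ ℂ) : heis t α k f = ann k f := by
  rw [heis_apply]
  simp [hk]

theorem heis_neg {k : ℕ} (hk : k ≠ 0) (f : MvPolynomial ℕ ℂ) :
    heis t α (-k) f = (2 * t) • (x ℂ k * f) := by
  rw [heis_apply]
  simp [hk]

theorem euler_ann (j : ℕ) (f : MvPolynomial ℕ ℂ) :
    euler ℂ (ann j f) = ann j (euler ℂ f) - (j : ℂ) • ann j f := by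
  have h : ⁅euler ℂ, ann j⁆ = -(j : ℂ) • ann j := derivation_ext_x fun k => by
    rw [Derivation.commutator_apply, Derivation.smul_apply, ann_x, euler_x, Derivation.leibniz,
      ann_x, Derivation.map_natCast]
    by_cases hk : k = j
    · rw [if_pos hk, hk]
      simp only [smul_eq_C_mul, smul_eq_mul, map_neg, map_natCast, Derivation.map_natCast]; ring
    · simp [hk]
  have := congrArg (fun D => D f) h
  simp only [Derivation.commutator_apply, Derivation.smul_apply] at this
  rw [neg_smul, sub_eq_iff_eq_add] at this
  rw [this]; abel

/-- The scalar anomaly reflects the background charge `1 - t`. These commutators reduce the Virasoro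
relations to a computation on the vacuum. -/
theorem modes_heis (ht : t ≠ 0) (m n : ℤ) (f : MvPolynomial ℕ ℂ) :
    modes t α m (heis t α n f) = heis t α n (modes t α m f) - (n : ℂ) • heis t α (m + n) f
      + (if m + n = 0 then (1 - t) * m * (m + 1) else 0) • f := by
  rcases eq_or_ne n 0 with rfl | hn
  · rw [heis_zero, heis_zero, map_smul, Int.cast_zero, zero_smul, sub_zero]
    split_ifs with h
    · rw [show m = 0 by omega]; simp
    · simp
  obtain ⟨k, hk, rfl | rfl⟩ : ∃ k : ℕ, k ≠ 0 ∧ (n = k ∨ n = -k) :=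
    ⟨n.natAbs, by omega, by omega⟩
  · rw [heis_pos _ hk, heis_pos _ hk]
    rcases m with (_ | p) | p
    · rw [Int.ofNat_eq_natCast, Nat.cast_zero, modes_zero, modes_zero, euler_ann, zero_add,
        heis_pos _ hk, if_neg (by omega), zero_smul, map_add, Derivation.map_smul, Int.cast_natCast]
      abel
    · have : Int.ofNat (p + 1) + (k : ℤ) = ((k + (p + 1) : ℕ) : ℤ) := by
        simp; ring
      rw [this, heis_pos _ (by omega), if_neg (by omega), zero_smul, add_zero, Int.cast_natCast]
      exact raise_ann α p k f
    · have h1 : (Int.negSucc p + (k : ℤ)).toNat = k - (p + 1) := by omega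
      have h2 : (-(Int.negSucc p + (k : ℤ))).toNat = p + 1 - k := by omega
      rw [heis_apply, h1, h2]
      refine (lower_ann α p k f).trans ?_
      change ann k (lower t α p f) - _ = ann k (lower t α p f) - _ + _
      by_cases h : k = p + 1
      · rw [if_pos h, if_pos (by omega), if_pos (by omega), h, Int.cast_natCast, Int.cast_negSucc]
        push_cast; module
      · rw [if_neg h, if_neg (by omega), if_neg (by omega), zero_smul, Int.cast_natCast]; module
  · rw [heis_neg _ hk, heis_neg _ hk, map_smul]
    rcases m with (_ | p) | p
    · rw [Int.ofNat_eq_natCast, Nat.cast_zero, modes_zero, modes_zero, Derivation.leibniz, euler_x,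
        zero_add, heis_neg _ hk, if_neg (by omega)]
      simp only [smul_eq_C_mul, smul_eq_mul, map_natCast, Int.cast_neg, Int.cast_natCast, map_neg,
        map_zero, map_mul]
      ring
    · have h1 : (Int.ofNat (p + 1) + -(k : ℤ)).toNat = p + 1 - k := by simp; omega
      have h2 : (-(Int.ofNat (p + 1) + -(k : ℤ))).toNat = k - (p + 1) := by simp; omega
      rw [heis_apply, h1, h2]
      change (2 * t) • raise t α p _ = (2 * t) • (_ * raise t α p f) - _ + _
      rw [raise_x_mul α ht]
      by_cases h : k = p + 1
      · rw [if_pos h, if_pos (by simp; omega), if_pos (by simp; omega), h, smul_add, smul_smul,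
          smul_add, smul_add, smul_add, smul_smul (2 * t * _), smul_smul (2 * t * _)]
        have e1 : 2 * t * ((p + 1 : ℕ) : ℂ) * (2 * t)⁻¹ = (p + 1 : ℕ) := by field_simp
        have e2 : 2 * t * ((p + 1 : ℕ) : ℂ) * ((α + (1 - t) * (p + 2)) / (2 * t))
            = (p + 1 : ℕ) * (α + (1 - t) * (p + 2)) := by field_simp
        rw [e1, e2]
        push_cast; simp only [Int.ofNat_eq_natCast]; push_cast; module
      · rw [if_neg h, if_neg (by simp; omega), if_neg (by simp; omega), smul_add, smul_smul,
          smul_add, smul_add, smul_smul (2 * t * _), add_zero]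
        have e1 : 2 * t * (k : ℂ) * (2 * t)⁻¹ = k := by field_simp
        rw [e1]
        push_cast; module
    · have : Int.negSucc p + -(k : ℤ) = -((k + (p + 1) : ℕ) : ℤ) := by omega
      rw [this, heis_neg _ (by omega), if_neg (by omega)]
      change (2 * t) • lower t α p _ = (2 * t) • (_ * lower t α p f) - _ + _
      rw [lower_x_mul]
      push_cast; module

/-- The central charge `13 - 6 t - 6 / t`. -/
def charge (t : ℂ) : ℂ := 13 - 6 * t - 6 / t

/-- A form of Schur's lemma: commuting with creation operators determines `T` by `T 1`, and
commuting with annihilation operators makes `T 1` a constant. -/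
theorem eq_smul_of_commute_heis (ht : t ≠ 0) (T : Module.End ℂ (MvPolynomial ℕ ℂ))
    (hT : ∀ n f, T (heis t α n f) = heis t α n (T f)) (f : MvPolynomial ℕ ℂ) :
    T f = coeff 0 (T 1) • f := by
  have hX : ∀ i f, T (X i * f) = X i * T f := by
    intro i f
    have h := hT (-((i + 1 : ℕ) : ℤ)) f
    rw [heis_neg _ (Nat.succ_ne_zero i), heis_neg _ (Nat.succ_ne_zero i), map_smul] at h
    exact smul_right_injective _ (mul_ne_zero two_ne_zero ht) h
  have hd : ∀ i, pderiv i (T 1) = 0 := by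
    intro i
    have h := hT ((i + 1 : ℕ) : ℤ) 1
    rw [heis_pos _ (Nat.succ_ne_zero i), heis_pos _ (Nat.succ_ne_zero i),
      Derivation.map_one_eq_zero, map_zero, ann, Derivation.smul_apply] at h
    exact (smul_eq_zero.mp h.symm).resolve_left (Nat.cast_ne_zero.mpr (Nat.succ_ne_zero i))
  have h1 : T 1 = C (coeff 0 (T 1)) := by
    ext μ
    rw [coeff_C]
    split_ifs with h
    · rw [← h]
    · obtain ⟨i, hi⟩ := Finsupp.ne_iff.mp (Ne.symm h)
      have h2 := congrArg (coeff (μ - Finsupp.single i 1)) (hd i)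
      rw [coeff_pderiv, tsub_add_cancel_of_le (Finsupp.single_le_iff.mpr
        (Nat.one_le_iff_ne_zero.mpr hi)), coeff_zero] at h2
      refine (mul_eq_zero.mp h2).resolve_right ?_
      exact Nat.cast_add_one_ne_zero _
  rw [smul_eq_C_mul, ← h1]
  induction f using MvPolynomial.induction_on with
  | C a => rw [← mul_one (C a), ← smul_eq_C_mul, map_smul, smul_eq_C_mul, smul_eq_C_mul]; ring
  | add f g hf hg => rw [map_add, hf, hg, mul_add]
  | mul_X f i hf => rw [mul_comm f, hX, hf]; ring

theorem coeff_zero_x (k : ℕ) : coeff 0 (x ℂ k) = 0 := by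
  cases k <;> simp [coeff_X]

theorem coeff_zero_mul (f g : MvPolynomial ℕ ℂ) : coeff 0 (f * g) = coeff 0 f * coeff 0 g := by
  simp only [← constantCoeff_eq, map_mul]

theorem coeff_zero_quad (n : ℕ) : coeff 0 (quad ℂ n) = 0 := by
  rw [quad, coeff_sum]
  exact sum_eq_zero fun k _ => by rw [coeff_zero_mul, coeff_zero_x, zero_mul]

theorem coeff_zero_mulPart (n : ℕ) : coeff 0 (mulPart t α n) = 0 := by
  rw [mulPart, coeff_add, coeff_zero_mul, coeff_zero_mul, coeff_zero_x, coeff_zero_quad]; simp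

theorem coeff_zero_dropDer_quad (m n : ℕ) : coeff 0 (dropDer m (quad ℂ n)) = 0 := by
  rw [quad, map_sum, coeff_sum]
  refine sum_eq_zero fun k _ => ?_
  rw [Derivation.leibniz, coeff_add, smul_eq_mul, smul_eq_mul, coeff_zero_mul, coeff_zero_mul,
    coeff_zero_x, coeff_zero_x]; simp

theorem sum_range_mul_sub (n : ℕ) :
    ∑ k ∈ range (n + 2), (k : ℂ) * ((n + 1 - k : ℕ) : ℂ) = ((n + 1 : ℂ) ^ 3 - (n + 1)) / 6 := by
  have h : ∀ n : ℕ, ∑ k ∈ range n, (k : ℂ) = n * (n - 1) / 2 := by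
    intro n
    induction n with
    | zero => simp
    | succ n ih => rw [sum_range_succ, ih]; push_cast; ring
  have h2 : ∀ n : ℕ, ∑ k ∈ range n, (k : ℂ) ^ 2 = n * (n - 1) * (2 * n - 1) / 6 := by
    intro n
    induction n with
    | zero => simp
    | succ n ih => rw [sum_range_succ, ih]; push_cast; ring
  have : ∀ k ∈ range (n + 2), (k : ℂ) * ((n + 1 - k : ℕ) : ℂ) = (n + 1) * k - k ^ 2 := by
    intro k hk
    have := mem_range.mp hk
    rw [Nat.cast_sub (by omega)]; push_cast; ring
  rw [sum_congr rfl this, sum_sub_distrib, ← mul_sum, h, h2]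
  push_cast; ring

/-- The vacuum expectation that fixes the central charge: the quadratic parts contribute `∑ k (m + 1
- k)`, the linear parts supply the `t`-dependence and the lowest weight. -/
theorem coeff_zero_raise_mulPart (ht : t ≠ 0) (m n : ℕ) :
    coeff 0 (raise t α m (mulPart t α n)) = if m = n then
      ((m + 1 : ℂ) ^ 3 - (m + 1)) / 12 * charge t + 2 * (m + 1) * lowestWeight t α else 0 := by
  have h1 : ∀ k, ann k (ann (m + 1 - k) (mulPart t α n))
      = (((2 * t) * ((m + 1 - k : ℕ) : ℂ)) • if n + 1 - (m + 1 - k) = k then (k : MvPolynomial ℕ ℂ)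
        else 0) := by
    intro k
    rw [ann_mulPart, Derivation.map_smul, map_add, Derivation.map_smul, ann_x]
    have : ann k (if m + 1 - k = n + 1 then C (α + (t - 1) * n) else 0) = 0 := by
      split_ifs
      · exact derivation_C _ _
      · simp
    rw [this, add_zero, smul_smul, mul_comm]
  have h2 : coeff 0 (dropDer m (mulPart t α n)) = 0 := by
    rw [mulPart, map_add, Derivation.leibniz, Derivation.leibniz, derivation_C, derivation_C,
      dropDer_x]
    simp only [add_zero, smul_eq_mul, coeff_add, coeff_C_mul, coeff_zero_dropDer_quad,
      coeff_zero_mul, coeff_zero_x, mul_zero]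
  rw [raise_apply, coeff_add, coeff_add, h2, ann_mulPart, sum_congr rfl fun k _ => h1 k]
  simp only [coeff_smul, coeff_add, coeff_sum, coeff_zero_x, smul_eq_mul, mul_zero, zero_add,
    add_zero]
  by_cases h : m = n
  · subst h
    have h3 : ∀ k ∈ range (m + 2), 2 * t * ((m + 1 - k : ℕ) : ℂ) *
        coeff 0 (if m + 1 - (m + 1 - k) = k then (k : MvPolynomial ℕ ℂ) else 0)
        = 2 * t * ((k : ℂ) * ((m + 1 - k : ℕ) : ℂ)) := by
      intro k hk
      have := mem_range.mp hk
      rw [if_pos (by omega), ← map_natCast (C (R := ℂ) (σ := ℕ)), coeff_zero_C]; ring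
    rw [sum_congr rfl h3, ← mul_sum, sum_range_mul_sub, if_pos rfl, if_pos rfl, coeff_zero_C,
      charge, lowestWeight]
    field_simp
    push_cast
    ring
  · rw [if_neg h, if_neg (by omega), coeff_zero, mul_zero, mul_zero, add_zero, sum_eq_zero, mul_zero]
    intro k hk
    have := mem_range.mp hk
    split_ifs with hk'
    · have : m + 1 - k = 0 ∨ k = 0 := by omega
      rcases this with h0 | h0
      · rw [h0]; simp
      · rw [h0]; simp
    · simp

theorem coeff_zero_lower (n : ℕ) (f : MvPolynomial ℕ ℂ) : coeff 0 (lower t α n f) = 0 := by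
  rw [lower_apply, coeff_add, coeff_zero_mul, coeff_zero_mulPart, zero_mul, add_zero]
  induction f using MvPolynomial.induction_on with
  | C a => simp [derivation_C]
  | add f g hf hg => rw [map_add, coeff_add, hf, hg, add_zero]
  | mul_X f i hf =>
    rw [← x_succ, Derivation.leibniz, coeff_add, smul_eq_mul, smul_eq_mul, coeff_zero_mul,
      coeff_zero_mul, coeff_zero_x, shiftDer_x, coeff_zero_mul, coeff_zero_x]
    simp

theorem coeff_zero_modes_lower_one (ht : t ≠ 0) (m : ℤ) (n : ℕ) :
    coeff 0 (modes t α m (lower t α n 1)) = if m = n + 1 then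
      ((m : ℂ) ^ 3 - m) / 12 * charge t + 2 * m * lowestWeight t α else 0 := by
  have h1 : lower t α n 1 = mulPart t α n := by simp [lower_apply]
  rcases m with (_ | p) | p
  · rw [Int.ofNat_eq_natCast, Nat.cast_zero, modes_zero, coeff_add, coeff_euler, coeff_smul,
      coeff_zero_lower, if_neg (by omega)]; simp
  · rw [h1]
    refine (coeff_zero_raise_mulPart α ht p n).trans ?_
    by_cases h : p = n
    · rw [if_pos h, if_pos (by simp [h])]; simp
    · rw [if_neg h, if_neg (by simpa using h)]
  · rw [if_neg (by omega)]
    exact coeff_zero_lower α p _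

/-- The commutator minus its non-central value commutes with every Heisenberg operator, so it is a
scalar, which is read off on the vacuum. -/
theorem modes_comm (ht : t ≠ 0) (m : ℤ) (n : ℕ) :
    modes t α m * modes t α (-((n : ℤ) + 1)) - modes t α (-((n : ℤ) + 1)) * modes t α m
      = ((m : ℂ) + (n + 1)) • modes t α (m - (n + 1))
        + (if m = n + 1 then ((m : ℂ) ^ 3 - m) / 12 * charge t else 0) • 1 := by
  set j : ℤ := -((n : ℤ) + 1) with hj
  have hmj : m - (n + 1) = m + j := by omega
  rw [hmj]
  set T : Module.End ℂ (MvPolynomial ℕ ℂ) := modes t α m * modes t α j - modes t α j * modes t α m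
    - ((m : ℂ) + (n + 1)) • modes t α (m + j) with hTdef
  have hTa : ∀ f, T f = modes t α m (modes t α j f) - modes t α j (modes t α m f)
    - ((m : ℂ) + (n + 1)) • modes t α (m + j) f := fun f => rfl
  have hn : (n : ℂ) + 1 = -(j : ℂ) := by rw [hj]; push_cast; ring
  have hT : ∀ k f, T (heis t α k f) = heis t α k (T f) := by
    intro k f
    rw [hTa, hTa, hn]
    simp only [modes_heis α ht, map_add, map_sub, map_smul]
    rw [show m + (j + k) = m + j + k by ring, show j + (m + k) = m + j + k by ring]
    by_cases h : m + j + k = 0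
    · obtain rfl : k = -(m + j) := by omega
      simp only [if_pos h]
      push_cast
      module
    · simp only [if_neg h]
      push_cast
      module
  have hc : coeff 0 (T 1) = if m = n + 1 then ((m : ℂ) ^ 3 - m) / 12 * charge t else 0 := by
    rw [hTa, hj, modes_neg, coeff_sub, coeff_sub, coeff_zero_modes_lower_one α ht, coeff_zero_lower,
      ← hj, ← hmj, coeff_smul]
    have h1 : coeff 0 (modes t α (m - (n + 1)) 1)
        = if m = n + 1 then lowestWeight t α else 0 := by
      split_ifs with h
      · rw [h, sub_self, modes_zero]; simp
      · rcases hq : m - (n + 1) with (_ | p) | p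
        · simp at hq; omega
        · change coeff 0 (raise t α p 1) = 0
          rw [raise_one, coeff_zero]
        · exact coeff_zero_lower α p 1
    rw [h1]
    split_ifs with h
    · rw [h]; push_cast; simp only [smul_eq_mul]; ring
    · simp
  refine LinearMap.ext fun f => ?_
  have h := eq_smul_of_commute_heis α ht T hT f
  rw [hc, hTa, sub_eq_iff_eq_add] at h
  change modes t α m (modes t α j f) - modes t α j (modes t α m f) = _
  rw [h, add_comm]; rfl

end Modes

/-! ### The contravariant form -/

section Form

variable (t : ℂ)

/-- The squared norm of a monomial. -/
def formWeight (μ : ℕ →₀ ℕ) : ℂ := μ.prod fun i k => (k.factorial : ℂ) * (-(i + 1 : ℂ) / (2 * t)) ^ k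

/-- The contravariant pairing between the Fock spaces of momenta `α` and `2 (t - 1) - α`. -/
def form : MvPolynomial ℕ ℂ →ₗ[ℂ] MvPolynomial ℕ ℂ →ₗ[ℂ] ℂ :=
  (basisMonomials ℕ ℂ).constr ℂ fun μ => formWeight t μ • lcoeff ℂ μ

theorem form_monomial (μ : ℕ →₀ ℕ) (a : ℂ) (g : MvPolynomial ℕ ℂ) :
    form t (monomial μ a) g = a * (formWeight t μ * coeff μ g) := by
  have h : monomial μ a = a • basisMonomials ℕ ℂ μ := by simp [smul_monomial]
  rw [h, map_smul, form, Module.Basis.constr_basis]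
  rfl

theorem form_one (g : MvPolynomial ℕ ℂ) : form t 1 g = coeff 0 g := by
  have := form_monomial t 0 1 g
  rw [monomial_zero', C_1] at this
  simpa [formWeight] using this

variable {t}

theorem formWeight_ne_zero (ht : t ≠ 0) (μ : ℕ →₀ ℕ) : formWeight t μ ≠ 0 := by
  refine Finset.prod_ne_zero_iff.mpr fun i _ => mul_ne_zero ?_ (pow_ne_zero _ ?_)
  · exact_mod_cast Nat.factorial_ne_zero _
  · refine div_ne_zero (neg_ne_zero.mpr (Nat.cast_add_one_ne_zero i)) (mul_ne_zero two_ne_zero ht)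

theorem formWeight_add_single (μ : ℕ →₀ ℕ) (i : ℕ) :
    formWeight t (μ + Finsupp.single i 1)
      = (-(i + 1 : ℂ) / (2 * t)) * (μ i + 1) * formWeight t μ := by
  classical
  have h : ∀ ν : ℕ →₀ ℕ, formWeight t ν = ((ν i).factorial : ℂ) * (-(i + 1 : ℂ) / (2 * t)) ^ (ν i)
      * formWeight t (ν.erase i) := by
    intro ν
    rw [formWeight, formWeight]
    by_cases hi : i ∈ ν.support
    · exact (Finsupp.mul_prod_erase ν i _ hi).symm
    · rw [Finsupp.erase_of_notMem_support hi, Finsupp.notMem_support_iff.mp hi]; simp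
  rw [h, h μ]
  have he : (μ + Finsupp.single i 1).erase i = μ.erase i := by
    ext j
    by_cases hj : j = i
    · subst hj; simp
    · simp [Finsupp.erase_ne hj]
  rw [he, Finsupp.add_apply, Finsupp.single_eq_same, Nat.factorial_succ, pow_succ]
  push_cast; ring

/-- The norms in `formWeight` are chosen for this: the adjoint of the Heisenberg operator `2 t x_k`
is minus the annihilation operator. -/
theorem form_x_mul (k : ℕ) (f g : MvPolynomial ℕ ℂ) :
    form t (x ℂ k * f) g = -(2 * t)⁻¹ * form t f (ann k g) := by
  cases k with
  | zero => simp
  | succ i =>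
    induction f using MvPolynomial.induction_on' with
    | monomial μ a =>
      rw [x_succ, X, monomial_mul, one_mul, add_comm, form_monomial, formWeight_add_single,
        form_monomial, ann, Derivation.smul_apply, coeff_smul, coeff_pderiv, smul_eq_mul]
      push_cast; ring
    | add f f' hf hf' => rw [mul_add, map_add, LinearMap.add_apply, hf, hf', map_add,
        LinearMap.add_apply]; ring

theorem form_symm (f g : MvPolynomial ℕ ℂ) : form t f g = form t g f := by
  induction f using MvPolynomial.induction_on' with
  | monomial μ a =>
    induction g using MvPolynomial.induction_on' with
    | monomial ν b =>
      rw [form_monomial, form_monomial, coeff_monomial, coeff_monomial]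
      by_cases h : μ = ν
      · subst h; simp only [if_true]; ring
      · rw [if_neg h, if_neg (Ne.symm h)]; ring
    | add g g' hg hg' => rw [map_add, map_add, LinearMap.add_apply, hg, hg']
  | add f f' hf hf' => rw [map_add, map_add, LinearMap.add_apply, hf, hf']

theorem form_ann (ht : t ≠ 0) (k : ℕ) (f g : MvPolynomial ℕ ℂ) :
    form t (ann k f) g = -(2 * t) * form t f (x ℂ k * g) := by
  rw [form_symm f, form_x_mul, form_symm g]
  field_simp

/-- The sign in the Heisenberg adjoint reverses the momentum up to the background charge, which is
why two different Fock spaces are paired. The induction builds `f` from creation operators and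
compares their commutators with `raise` and, on the other side, of `ann` with `lower`. -/
theorem form_raise (ht : t ≠ 0) {α β : ℂ} (hαβ : α + β = 2 * (t - 1)) (m : ℕ)
    (f g : MvPolynomial ℕ ℂ) : form t (raise t α m f) g = form t f (lower t β m g) := by
  induction f using MvPolynomial.induction_on generalizing g with
  | C a =>
    rw [← mul_one (C a), ← smul_eq_C_mul]
    simp only [map_smul, LinearMap.smul_apply, raise_one, form_one, coeff_zero_lower, map_zero,
      LinearMap.zero_apply, smul_zero]
  | add f f' hf hf' => rw [map_add, map_add, LinearMap.add_apply, hf, hf', map_add,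
      LinearMap.add_apply]
  | mul_X f i hf =>
    obtain rfl : β = 2 * (t - 1) - α := by linear_combination hαβ
    rw [mul_comm, ← x_succ, raise_x_mul α ht, map_add, LinearMap.add_apply, form_x_mul, hf,
      form_x_mul]
    have h1 : ann (i + 1) (lower t (2 * (t - 1) - α) m g)
        = lower t (2 * (t - 1) - α) m (ann (i + 1) g) + (((i + 1 : ℕ) : ℂ)) •
          (ann (i + 1 - (m + 1)) g + (2 * t) • (x ℂ (m + 1 - (i + 1)) * g)
            + if i + 1 = m + 1 then ((2 * (t - 1) - α) + (t - 1) * m) • g else 0) := by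
      rw [lower_ann]; abel
    rw [h1]
    by_cases hi : i + 1 = m + 1
    · simp only [if_pos hi, map_smul, map_add, LinearMap.smul_apply, LinearMap.add_apply,
        form_x_mul, form_ann ht, smul_eq_mul]
      field_simp
      ring
    · simp only [if_neg hi, map_smul, map_add, LinearMap.smul_apply, LinearMap.add_apply,
        form_x_mul, form_ann ht, smul_eq_mul, map_zero, LinearMap.zero_apply]
      field_simp
      ring

end Form

end Fock

end



noncomputable section

namespace Virasoro

open Finset

/-! ### Highest weight vectors and universality of the Gram matrix -/

section Abstract

variable {X : Type*} [AddCommGroup X] [Module ℂ X]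

/-- The Virasoro relations for `[L_m, L_n]` with `n < 0`. -/
def LowerRelations (L : ℤ → Module.End ℂ X) (c : ℂ) : Prop :=
  ∀ (m : ℤ) (n : ℕ), L m * L (-((n : ℤ) + 1)) - L (-((n : ℤ) + 1)) * L m
    = ((m : ℂ) + (n + 1)) • L (m - (n + 1))
      + (if m = n + 1 then ((m : ℂ) ^ 3 - m) / 12 * c else 0) • 1

/-- Products of lowering operators. -/
def downWord (L : ℤ → Module.End ℂ X) : List ℕ → Module.End ℂ X :=
  word fun n => L (-((n : ℤ) + 1))

/-- Products of raising operators. -/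
def upWord (L : ℤ → Module.End ℂ X) : List ℕ → Module.End ℂ X :=
  word fun n => L ((n : ℤ) + 1)

/-- A singular vector of weight `h`. -/
structure IsSingular (L : ℤ → Module.End ℂ X) (h : ℂ) (ω : X) : Prop where
  weight : L 0 ω = h • ω
  raise : ∀ n : ℕ, L ((n : ℤ) + 1) ω = 0

/-- The subspace of vectors of degree `d` in the submodule generated by `ω`. -/
def levelSpan (L : ℤ → Module.End ℂ X) (ω : X) (d : ℤ) : Submodule ℂ X :=
  Submodule.span ℂ {y | ∃ l, (wordDegree l : ℤ) = d ∧ y = downWord L l ω}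

variable {L : ℤ → Module.End ℂ X} {c h : ℂ} {ω : X}

theorem downWord_mem_levelSpan (l : List ℕ) {d : ℤ} (hd : (wordDegree l : ℤ) = d) :
    downWord L l ω ∈ levelSpan L ω d := Submodule.subset_span ⟨l, hd, rfl⟩

theorem down_mem_levelSpan (n : ℕ) {d : ℤ} {y : X} (hy : y ∈ levelSpan L ω d) :
    L (-((n : ℤ) + 1)) y ∈ levelSpan L ω (d + (n + 1)) := by
  induction hy using Submodule.span_induction with
  | mem y hy =>
    obtain ⟨l, rfl, rfl⟩ := hy
    have := downWord_mem_levelSpan (L := L) (ω := ω) (n :: l)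
      (d := (wordDegree l : ℤ) + (n + 1)) (by simp; ring)
    simpa [downWord] using this
  | zero => simp
  | add x y _ _ hx hy => rw [map_add]; exact add_mem hx hy
  | smul a x _ hx => rw [map_smul]; exact Submodule.smul_mem _ _ hx

theorem LowerRelations.apply (hL : LowerRelations L c) (m : ℤ) (n : ℕ) (y : X) :
    L m (L (-((n : ℤ) + 1)) y) = L (-((n : ℤ) + 1)) (L m y) + ((m : ℂ) + (n + 1)) • L (m - (n + 1)) y
      + (if m = n + 1 then ((m : ℂ) ^ 3 - m) / 12 * c else 0) • y := by
  have := LinearMap.congr_fun (hL m n) y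
  simp only [LinearMap.sub_apply, Module.End.mul_apply, LinearMap.add_apply, LinearMap.smul_apply,
    Module.End.one_apply] at this
  rw [sub_eq_iff_eq_add] at this
  rw [this]; abel

/-- Commuting `L_m` past the first letter only calls for the relations in `LowerRelations` and
shorter words. -/
theorem mode_downWord_mem (hL : LowerRelations L c) (hω : IsSingular L h ω) (l : List ℕ) (m : ℤ) :
    L m (downWord L l ω) ∈ levelSpan L ω (wordDegree l - m) := by
  induction l generalizing m with
  | nil =>
    have h0 : ω ∈ levelSpan L ω 0 := downWord_mem_levelSpan [] rfl
    simp only [downWord, word_nil, Module.End.one_apply, wordDegree_nil]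
    rcases m with (_ | n) | n
    · change L 0 ω ∈ levelSpan L ω _
      rw [hω.weight]; exact Submodule.smul_mem _ _ (by simpa using h0)
    · change L ((n : ℤ) + 1) ω ∈ _
      rw [hω.raise]; exact zero_mem _
    · have := down_mem_levelSpan n h0
      rw [Int.negSucc_eq]
      simpa using this
  | cons n l ih =>
    have hw : downWord L (n :: l) ω = L (-((n : ℤ) + 1)) (downWord L l ω) := by simp [downWord]
    rw [hw, hL.apply]
    refine add_mem (add_mem ?_ (Submodule.smul_mem _ _ ?_)) ?_
    · have := down_mem_levelSpan n (ih m)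
      convert this using 2
      rw [wordDegree_cons]; push_cast; ring
    · have := ih (m - (n + 1))
      convert this using 2
      rw [wordDegree_cons]; push_cast; ring
    · split_ifs with hm
      · refine Submodule.smul_mem _ _ (downWord_mem_levelSpan l ?_)
        rw [hm, wordDegree_cons]; push_cast; ring
      · simp

theorem mode_mem_levelSpan (hL : LowerRelations L c) (hω : IsSingular L h ω) (m : ℤ) {d : ℤ} {y : X}
    (hy : y ∈ levelSpan L ω d) : L m y ∈ levelSpan L ω (d - m) := by
  induction hy using Submodule.span_induction with
  | mem y hy =>
    obtain ⟨l, rfl, rfl⟩ := hy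
    exact mode_downWord_mem hL hω l m
  | zero => simp
  | add x y _ _ hx hy => rw [map_add]; exact add_mem hx hy
  | smul a x _ hx => rw [map_smul]; exact Submodule.smul_mem _ _ hx

theorem upWord_mem_levelSpan (hL : LowerRelations L c) (hω : IsSingular L h ω) (l : List ℕ) {d : ℤ}
    {y : X} (hy : y ∈ levelSpan L ω d) : upWord L l y ∈ levelSpan L ω (d - wordDegree l) := by
  induction l with
  | nil => simpa [upWord] using hy
  | cons n l ih =>
    have := mode_mem_levelSpan hL hω ((n : ℤ) + 1) ih
    have h2 : upWord L (n :: l) y = L ((n : ℤ) + 1) (upWord L l y) := by simp [upWord]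
    rw [h2]
    convert this using 2
    rw [wordDegree_cons]; push_cast; ring

theorem levelSpan_zero : levelSpan L ω 0 = Submodule.span ℂ {ω} := by
  rw [levelSpan]
  congr 1
  ext y
  constructor
  · rintro ⟨l, hl, rfl⟩
    obtain rfl : l = [] := wordDegree_eq_zero.mp (by exact_mod_cast hl)
    simp [downWord]
  · rintro rfl
    exact ⟨[], by simp, by simp [downWord]⟩

theorem levelSpan_eq_bot {d : ℤ} (hd : d < 0) : levelSpan L ω d = ⊥ := by
  rw [levelSpan, Submodule.span_eq_bot]
  rintro _ ⟨l, hl, rfl⟩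
  omega

end Abstract

/-! ### Gram matrices of singular vectors via Fock space -/

section Universal

open Fock MvPolynomial

variable {X : Type*} [AddCommGroup X] [Module ℂ X] {L : ℤ → Module.End ℂ X} {ω : X} {t : ℂ} (α : ℂ)

theorem lowerRelations_modes (ht : t ≠ 0) : LowerRelations (modes t α) (charge t) :=
  modes_comm α ht

theorem isSingular_one : IsSingular (modes t α) (lowestWeight t α) 1 where
  weight := by rw [modes_zero]; simp
  raise n := raise_one t α n

theorem downWord_modes_one (l : List ℕ) : downWord (modes t α) l 1 = wordVec t α l := by
  induction l with
  | nil => simp [downWord]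
  | cons n l ih =>
    rw [downWord, word_cons, Module.End.mul_apply, wordVec_cons, ← ih, modes_neg]; rfl

theorem word_prodMap {Y : Type*} [AddCommGroup Y] [Module ℂ Y] (A : ℕ → Module.End ℂ X)
    (B : ℕ → Module.End ℂ Y) (l : List ℕ) :
    word (fun n => (A n).prodMap (B n)) l = (word A l).prodMap (word B l) := by
  induction l with
  | nil => rw [word_nil, word_nil, word_nil]; exact LinearMap.prodMap_one.symm
  | cons n l ih => rw [word_cons, word_cons, word_cons, ih, LinearMap.prodMap_mul]

/-- Words of degree zero act on all singular vectors of the same weight by the same scalar. -/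
theorem upWord_downWord_eq (ht : t ≠ 0) (hL : LowerRelations L (charge t))
    (hω : IsSingular L (lowestWeight t α) ω) {l l' : List ℕ} (hl : wordDegree l = wordDegree l') :
    upWord L l (downWord L l' ω) = coeff 0 (upWord (modes t α) l (wordVec t α l')) • ω := by
  -- In the direct sum of Fock space and `X` the pair `(1, ω)` is singular, and its level 0 is one
  -- line. So both components see the same scalar, and no Verma module is needed.
  have hP : LowerRelations (fun m => (modes t α m).prodMap (L m)) (charge t) := by
    intro m n
    refine LinearMap.ext fun z => Prod.ext ?_ ?_
    · exact LinearMap.congr_fun (lowerRelations_modes α ht m n) z.1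
    · exact LinearMap.congr_fun (hL m n) z.2
  have hS : IsSingular (fun m => (modes t α m).prodMap (L m)) (lowestWeight t α)
      ((1 : MvPolynomial ℕ ℂ), ω) :=
    ⟨Prod.ext (isSingular_one α).weight hω.weight,
      fun n => Prod.ext ((isSingular_one α).raise n) (hω.raise n)⟩
  have h := upWord_mem_levelSpan hP hS l (downWord_mem_levelSpan l' rfl)
  rw [hl, sub_self, levelSpan_zero] at h
  obtain ⟨a, ha⟩ := Submodule.mem_span_singleton.mp h
  simp only [upWord, downWord, word_prodMap] at ha
  have h1 := congrArg Prod.fst ha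
  have h2 := congrArg Prod.snd ha
  change a • (1 : MvPolynomial ℕ ℂ) = upWord (modes t α) l (downWord (modes t α) l' 1) at h1
  change a • ω = upWord L l (downWord L l' ω) at h2
  rw [← h2, ← downWord_modes_one, ← h1]
  simp

theorem form_upWord (ht : t ≠ 0) (l : List ℕ) (f g : MvPolynomial ℕ ℂ) :
    form t (upWord (modes t α) l f) g
      = form t f (downWord (modes t (2 * (t - 1) - α)) l.reverse g) := by
  induction l generalizing g with
  | nil => simp [upWord, downWord]
  | cons n l ih =>
    have h1 : upWord (modes t α) (n :: l) f = raise t α n (upWord (modes t α) l f) := by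
      simp [upWord, modes_succ]
    rw [h1, form_raise ht (β := 2 * (t - 1) - α) (by ring), ih, List.reverse_cons]
    simp only [downWord, word_append, Module.End.mul_apply, word_cons, word_nil, modes_neg, mul_one]

/-- The Gram matrix of the Fock space of momentum `α`. -/
def gram (t α : ℂ) (N : ℕ) : Matrix (Idx N) (Idx N) ℂ := fun μ ν =>
  form t (wordVec t α (sortedWord ν.1)) (wordVec t (2 * (t - 1) - α) (sortedWord μ.1))

theorem upWord_downWord_eq_gram (ht : t ≠ 0) (hL : LowerRelations L (charge t))
    (hω : IsSingular L (lowestWeight t α) ω) {N : ℕ} (μ ν : Idx N) :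
    upWord L (sortedWord μ.1).reverse (downWord L (sortedWord ν.1) ω) = gram t α N μ ν • ω := by
  rw [upWord_downWord_eq α ht hL hω
    (by rw [wordDegree_perm (List.reverse_perm _)]; simp [μ.2, ν.2]), gram, ← form_one t,
    form_symm, form_upWord α ht, List.reverse_reverse, downWord_modes_one]

theorem form_eq_sum {N : ℕ} {f : MvPolynomial ℕ ℂ} (hf : ∀ μ, multiDegree μ ≠ N → coeff μ f = 0)
    (g : MvPolynomial ℕ ℂ) :
    form t f g = ∑ ν : Idx N, coeff ν.1 f * (formWeight t ν.1 * coeff ν.1 g) := by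
  have h : f = ∑ ν : Idx N, monomial ν.1 (coeff ν.1 f) := by
    ext μ
    rw [coeff_sum]
    by_cases hμ : multiDegree μ = N
    · rw [sum_eq_single ⟨μ, hμ⟩]
      · simp
      · intro ν _ hne
        rw [coeff_monomial, if_neg fun h => hne (Subtype.ext h)]
      · simp
    · rw [hf μ hμ, sum_eq_zero]
      intro ν _
      rw [coeff_monomial, if_neg]
      rintro rfl; exact hμ ν.2
  conv_lhs => rw [h]
  rw [map_sum, LinearMap.sum_apply]
  exact sum_congr rfl fun ν _ => form_monomial _ _ _ _

/-- Monomials are orthogonal for the pairing, with norms `formWeight`. -/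
theorem gram_eq (N : ℕ) : gram t α N = (fockMatrix t (2 * (t - 1) - α) N).transpose
    * (Matrix.diagonal fun ν : Idx N => formWeight t ν.1) * fockMatrix t α N := by
  ext μ ν
  rw [gram, form_eq_sum (N := N) fun σ hσ => coeff_wordVec_eq_zero _ _ (by simpa [ν.2] using hσ),
    Matrix.mul_apply]
  refine sum_congr rfl fun σ _ => ?_
  rw [Matrix.mul_diagonal, Matrix.transpose_apply, fockMatrix, fockMatrix]
  ring

theorem fockMatrix_mulVec_eq_zero (ht : t ≠ 0) {N : ℕ}
    (hdet : (fockMatrix t (2 * (t - 1) - α) N).det ≠ 0) {u : Idx N → ℂ}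
    (hu : (gram t α N).mulVec u = 0) : (fockMatrix t α N).mulVec u = 0 := by
  rw [gram_eq, ← Matrix.mulVec_mulVec] at hu
  refine Matrix.eq_zero_of_mulVec_eq_zero ?_ hu
  rw [Matrix.det_mul, Matrix.det_transpose, Matrix.det_diagonal]
  exact mul_ne_zero hdet (prod_ne_zero_iff.mpr fun ν _ => formWeight_ne_zero ht _)

theorem det_fockMatrix_ne_zero {α : ℂ} (h : ∀ r s : ℕ, α ≠ s - r * t) (N : ℕ) :
    (fockMatrix t α N).det ≠ 0 := by
  rw [det_fockMatrix_eq]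
  exact prod_ne_zero_iff.mpr fun p _ => pow_ne_zero _ (sub_ne_zero.mpr (h _ _))

end Universal

end Virasoro

end



noncomputable section

/-! ### Words ending in `L_{-1}` -/

namespace Virasoro

open Finset Fock

/-- Index 0 stands for `L_{-1}`; decreasing order puts it last, so that it acts first on the vector.
-/
theorem exists_sortedWord_eq_append_zero {μ : ℕ →₀ ℕ} (h : μ 0 ≠ 0) :
    ∃ l, sortedWord μ = l ++ [0] := by
  have hmem : 0 ∈ sortedWord μ := by
    rw [← Multiset.mem_coe, coe_sortedWord, Finsupp.mem_toMultiset]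
    exact Finsupp.mem_support_iff.mpr h
  obtain ⟨l₁, l₂, hl⟩ := List.append_of_mem hmem
  have hs : (sortedWord μ).Pairwise (· ≥ ·) := Multiset.pairwise_sort _ _
  rw [hl, List.pairwise_append, List.pairwise_cons] at hs
  have h2 : l₂ = List.replicate l₂.length 0 :=
    List.eq_replicate_iff.mpr ⟨rfl, fun b hb => Nat.le_zero.mp (hs.2.1.1 b hb)⟩
  refine ⟨l₁ ++ List.replicate l₂.length 0, ?_⟩
  rw [List.append_assoc, ← List.replicate_succ', List.replicate_succ, ← h2, hl]

theorem downWord_append_zero {X : Type*} [AddCommGroup X] [Module ℂ X] {L : ℤ → Module.End ℂ X}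
    {ω : X} (h : L (-1) ω = 0) {μ : ℕ →₀ ℕ} (hμ : μ 0 ≠ 0) : downWord L (sortedWord μ) ω = 0 := by
  obtain ⟨l, hl⟩ := exists_sortedWord_eq_append_zero hμ
  rw [hl, downWord, word_append, Module.End.mul_apply, word_cons, word_nil, mul_one]
  simp [h]

/-! ### Parameters for real central charge greater than one -/

theorem exists_charge_eq (c : ℂ) : ∃ t, t ≠ 0 ∧ charge t = c := by
  -- A square root of the discriminant of `6 t² - (13 - c) t + 6`, the equation `charge t = c`
  -- cleared of denominators.
  obtain ⟨s, hs⟩ := IsAlgClosed.exists_pow_nat_eq ((13 - c) ^ 2 - 144) (n := 2) (by norm_num)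
  have hq : 6 * ((13 - c + s) / 12) ^ 2 - (13 - c) * ((13 - c + s) / 12) + 6 = 0 := by
    linear_combination hs / 24
  have h0 : (13 - c + s) / 12 ≠ 0 := by
    intro h
    rw [h] at hq
    norm_num at hq
  refine ⟨_, h0, ?_⟩
  rw [charge]
  generalize (13 - c + s) / 12 = t at hq h0
  field_simp
  linear_combination -hq

theorem exists_lowestWeight_eq {t : ℂ} (ht : t ≠ 0) (h : ℂ) : ∃ α, lowestWeight t α = h := by
  obtain ⟨s, hs⟩ := IsAlgClosed.exists_pow_nat_eq ((1 - t) ^ 2 + 4 * t * h) (n := 2) (by norm_num)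
  refine ⟨s - (1 - t), ?_⟩
  rw [lowestWeight, div_eq_iff (by simpa using ht)]
  linear_combination hs

theorem lowestWeight_reflect (t α : ℂ) : lowestWeight t (2 * (t - 1) - α) = lowestWeight t α := by
  rw [lowestWeight, lowestWeight]
  ring

/-- Here `t + 1/t = (13 - c)/6 < 2`. A real `t` is then negative, and a non-real `t` is conjugate to
the other root `1/t`, so it lies on the unit circle. -/
theorem re_im_of_charge {t : ℂ} (ht : t ≠ 0) {c : ℝ} (hc : charge t = c) (hc1 : 1 < c) :
    (t.im = 0 ∧ t.re < 0) ∨ (t.im ≠ 0 ∧ t.re < 1 ∧ t.re ^ 2 + t.im ^ 2 = 1) := by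
  have hq : 6 * t * t - (13 - c) * t + 6 = 0 := by
    rw [charge] at hc
    field_simp at hc
    linear_combination -hc
  have hre := congrArg Complex.re hq
  have him := congrArg Complex.im hq
  simp at hre him
  by_cases hi : t.im = 0
  · left
    refine ⟨hi, ?_⟩
    rw [hi] at hre
    by_contra hneg
    nlinarith [sq_nonneg (t.re - 1), mul_nonneg (not_lt.mp hneg) (sub_pos.mpr hc1).le]
  · right
    have ha : 12 * t.re = 13 - c := by
      apply mul_left_cancel₀ hi
      linear_combination him
    exact ⟨hi, by linarith, by linear_combination (-1/6) * hre + t.re / 6 * ha⟩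

/-- The degeneracy condition is a real quadratic equation in `t`. If `t < 0`, its three terms are
nonnegative and all vanish. If `t` is non-real with `|t| = 1`, equality of the outer coefficients
gives `r = s`, and then `t.re < 1` contradicts the middle coefficient unless all is zero. -/
theorem eq_zero_of_degenerate {t : ℂ} (ht : t ≠ 0) {c : ℝ} (hc : charge t = c) (hc1 : 1 < c)
    {h : ℝ} (hh : 0 ≤ h) {r s : ℕ} (hrs : lowestWeight t (s - r * t) = h) :
    h = 0 ∧ r = 0 ∧ s = 0 := by
  have hq : ((r ^ 2 + 2 * r : ℝ) : ℂ) * (t * t) - ((2 * r * s + 2 * r + 2 * s + 4 * h : ℝ) : ℂ) * t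
      + ((s ^ 2 + 2 * s : ℝ) : ℂ) = 0 := by
    rw [lowestWeight, div_eq_iff (by simpa using ht)] at hrs
    push_cast
    linear_combination hrs
  have hre := congrArg Complex.re hq
  have him := congrArg Complex.im hq
  simp only [Complex.add_re, Complex.sub_re, Complex.mul_re,
    Complex.ofReal_re, Complex.add_im, Complex.sub_im, Complex.mul_im,
    Complex.ofReal_im, Complex.zero_re, Complex.zero_im] at hre him
  have hr : (0 : ℝ) ≤ r := r.cast_nonneg
  have hs : (0 : ℝ) ≤ s := s.cast_nonneg
  have hrs := mul_nonneg hr hs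
  rcases re_im_of_charge ht hc hc1 with ⟨hi, ha⟩ | ⟨hi, ha, hn⟩
  · rw [hi] at hre
    have hK := mul_nonneg (add_nonneg (add_nonneg (add_nonneg (by linarith : 0 ≤ 2 * (r : ℝ) * s)
      (by linarith : 0 ≤ 2 * (r : ℝ))) (by linarith : 0 ≤ 2 * (s : ℝ)))
      (by linarith : 0 ≤ 4 * h)) (neg_pos.mpr ha).le
    have hR := mul_nonneg (by positivity : 0 ≤ (r : ℝ) ^ 2 + 2 * r) (sq_nonneg t.re)
    have hs0 : (s : ℝ) = 0 := by nlinarith [sq_nonneg (s : ℝ)]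
    have hK0 : (2 * (r : ℝ) * s + 2 * r + 2 * s + 4 * h) * -t.re = 0 := by nlinarith
    rcases mul_eq_zero.mp hK0 with h0 | h0
    · refine ⟨by linarith, ?_, by exact_mod_cast hs0⟩
      have : (r : ℝ) = 0 := by linarith
      exact_mod_cast this
    · linarith
  · have hK : 2 * t.re * ((r : ℝ) ^ 2 + 2 * r) = 2 * r * s + 2 * r + 2 * s + 4 * h := by
      apply mul_left_cancel₀ hi
      linear_combination him
    have he : (r : ℝ) ^ 2 + 2 * r = s ^ 2 + 2 * s := by
      linear_combination ((r : ℝ) ^ 2 + 2 * r) * (-hn) - hre + t.re * hK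
    have hrs' : (r : ℝ) = s := by
      have : ((r : ℝ) - s) * (r + s + 2) = 0 := by linear_combination he
      rcases mul_eq_zero.mp this with h0 | h0
      · linarith
      · linarith
    rw [← hrs'] at hK
    have hpos := mul_nonneg (sub_pos.mpr ha).le (by positivity : 0 ≤ 2 * (r : ℝ) ^ 2 + 4 * r)
    have h0 : h = 0 := by linarith
    have hz : (1 - t.re) * (2 * (r : ℝ) ^ 2 + 4 * r) = 0 := by linarith
    have hr0 : (r : ℝ) = 0 := by
      rcases mul_eq_zero.mp hz with h1 | h1
      · linarith
      · nlinarith [sq_nonneg (r : ℝ)]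
    refine ⟨h0, by exact_mod_cast hr0, ?_⟩
    rw [hr0] at hrs'
    exact_mod_cast hrs'.symm

/-! ### Kernels of Gram matrices -/

section Kernel



theorem wordVec_eq_zero (t : ℂ) {μ : ℕ →₀ ℕ} (hμ : μ 0 ≠ 0) : wordVec t 0 (sortedWord μ) = 0 := by
  rw [← downWord_modes_one]
  refine downWord_append_zero ?_ hμ
  have := modes_neg (t := t) 0 0
  simp only [Nat.cast_zero, zero_add] at this
  rw [this, lower_apply, mulPart, quad]
  simp [sum_range_succ]

/-- The nullity at `α = 0` is at most the multiplicity of that root of the determinant, to which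
only the factor `(r, s) = (0, 0)` contributes. -/
theorem finrank_ker_fockMatrix_le {t : ℂ} (h : ∀ r s : ℕ, (s : ℂ) - r * t = 0 → r = 0 ∧ s = 0)
    {N : ℕ} (hN : 1 ≤ N) :
    Module.finrank ℂ (LinearMap.ker (fockMatrix t 0 N).mulVecLin) ≤ Fintype.card (Idx (N - 1)) := by
  have hdet : (fockMatrix (Polynomial.C t) Polynomial.X N).det
      = ∏ p ∈ kacPairs N, (Polynomial.X - Polynomial.C ((p.2 : ℂ) - p.1 * t))
          ^ Fintype.card (Idx (N - (p.1 + 1) * (p.2 + 1))) := by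
    refine Polynomial.funext fun z => ?_
    have := map_det_fockMatrix (Polynomial.evalRingHom z) (Polynomial.C t) Polynomial.X N
    simp only [Polynomial.coe_evalRingHom, Polynomial.eval_X, Polynomial.eval_C] at this
    rw [this, det_fockMatrix_eq, Polynomial.eval_prod]
    simp
  have hmap := map_fockMatrix (Polynomial.evalRingHom (0 : ℂ)) (Polynomial.C t) Polynomial.X N
  rw [Polynomial.coe_evalRingHom, Polynomial.eval_C, Polynomial.eval_X] at hmap
  have hdvd := Matrix.pow_dvd_det_of_le_finrank_ker
    (fockMatrix (Polynomial.C t) Polynomial.X N) 0 le_rfl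
  rw [hmap, hdet, ← mul_prod_erase _ _ (mem_kacPairs.mpr (by simpa using hN) :
    ((0, 0) : ℕ × ℕ) ∈ kacPairs N)] at hdvd
  have hprime : Prime (Polynomial.X - Polynomial.C (0 : ℂ)) := Polynomial.prime_X_sub_C 0
  replace hdvd := hprime.pow_dvd_of_dvd_mul_right _ (fun hd => ?_) hdvd
  · simp only [Nat.cast_zero, zero_mul, sub_zero, zero_add, mul_one] at hdvd
    exact (pow_dvd_pow_iff hprime.ne_zero hprime.not_isUnit).mp hdvd
  · obtain ⟨p, hp, hd⟩ := hprime.exists_mem_finset_dvd hd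
    have hd' := hprime.dvd_of_dvd_pow hd
    rw [Polynomial.dvd_iff_isRoot, Polynomial.IsRoot, Polynomial.eval_sub, Polynomial.eval_X,
      Polynomial.eval_C, zero_sub, neg_eq_zero] at hd'
    obtain ⟨h1, h2⟩ := h _ _ hd'
    exact (mem_erase.mp hp).1 (Prod.ext h1 h2)

/-- At momentum 0 the vacuum is killed by `L_{-1}`, so partitions with a part 1 give kernel vectors;
their number already reaches the bound on the nullity. -/
theorem apply_eq_zero_of_fockMatrix_mulVec {t : ℂ}
    (h : ∀ r s : ℕ, (s : ℂ) - r * t = 0 → r = 0 ∧ s = 0) {N : ℕ} (hN : 1 ≤ N) {u : Idx N → ℂ}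
    (hu : (fockMatrix t 0 N).mulVec u = 0) {μ : Idx N} (hμ : μ.1 0 = 0) : u μ = 0 := by
  set S : Submodule ℂ (Idx N → ℂ) :=
    Submodule.span ℂ (Set.range fun ν : {ν : Idx N // 0 < ν.1 0} => Pi.single ν.1 1) with hS
  have hle : S ≤ LinearMap.ker (fockMatrix t 0 N).mulVecLin := by
    rw [hS, Submodule.span_le]
    rintro _ ⟨ν, rfl⟩
    rw [SetLike.mem_coe, LinearMap.mem_ker, Matrix.mulVecLin_apply, Matrix.mulVec_single_one]
    ext σ
    simp [fockMatrix, wordVec_eq_zero t ν.2.ne']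
  have hfin : Module.finrank ℂ S = Fintype.card (Idx (N - 1)) := by
    have hli : LinearIndependent ℂ fun ν : {ν : Idx N // 0 < ν.1 0} =>
        (Pi.single ν.1 1 : Idx N → ℂ) := by
      have := (Pi.basisFun ℂ (Idx N)).linearIndependent.comp _
        (Subtype.val_injective (p := fun ν : Idx N => 0 < ν.1 0))
      convert this using 1
      ext ν : 1
      simp
    rw [hS, finrank_span_eq_card hli, Fintype.card_subtype]
    simpa using card_filter_lt N 0 0 (by simpa using hN)
  have heq := Submodule.eq_of_le_of_finrank_le hle
    (hfin ▸ finrank_ker_fockMatrix_le h hN)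
  have hmem : u ∈ S := heq ▸ LinearMap.mem_ker.mpr hu
  clear hu
  induction hmem using Submodule.span_induction with
  | mem y hy =>
    obtain ⟨ν, rfl⟩ := hy
    refine Pi.single_eq_of_ne ?_ _
    rintro rfl
    exact ν.2.ne' hμ
  | zero => rfl
  | add x y _ _ hx hy => rw [Pi.add_apply, hx, hy, add_zero]
  | smul a x _ hx => rw [Pi.smul_apply, hx, smul_zero]

/-- For `k > 0` both Fock matrices in the factorisation are invertible. For `k = 0` the choice `α =
0` puts all degeneracy into the right-hand factor. -/
theorem apply_eq_zero_of_gram_mulVec {t : ℂ} (ht : t ≠ 0) {c : ℝ} (hc : charge t = c) (hc1 : 1 < c)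
    {k : ℕ} {α : ℂ} (hα : lowestWeight t α = k) (hα0 : k = 0 → α = 0) {N : ℕ} (hN : 1 ≤ N)
    {u : Idx N → ℂ} (hu : (gram t α N).mulVec u = 0) {μ : Idx N} (hμ : k = 0 → μ.1 0 = 0) :
    u μ = 0 := by
  have hk : (0 : ℝ) ≤ k := k.cast_nonneg
  rcases Nat.eq_zero_or_pos k with rfl | hpos
  · obtain rfl := hα0 rfl
    refine apply_eq_zero_of_fockMatrix_mulVec (t := t) (fun r s h => ?_) hN
      (fockMatrix_mulVec_eq_zero 0 ht ?_ hu) (hμ rfl)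
    · exact (eq_zero_of_degenerate ht hc hc1 le_rfl (r := r) (s := s)
        (by rw [h, lowestWeight]; simp)).2
    · refine det_fockMatrix_ne_zero (fun r s h => ?_) N
      obtain ⟨-, rfl, rfl⟩ := eq_zero_of_degenerate ht hc hc1 le_rfl (r := r) (s := s)
        (by rw [← h, lowestWeight_reflect, lowestWeight]; simp)
      -- A degenerate reflected momentum `2 (t - 1)` would have to be 0, but `t = 1` gives central
      -- charge 1.
      have h1 : t = 1 := by
        simp only [Nat.cast_zero, zero_mul, sub_zero] at h
        linear_combination h / 2
      rw [h1, charge] at hc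
      norm_num at hc
      exact hc1.ne (by exact_mod_cast hc)
  · have hne : ∀ β, lowestWeight t β = k → ∀ r s : ℕ, β ≠ s - r * t := by
      rintro β hβ r s rfl
      have := (eq_zero_of_degenerate ht hc hc1 hk (r := r) (s := s) (by simpa using hβ)).1
      exact hpos.ne' (by exact_mod_cast this)
    have h1 := fockMatrix_mulVec_eq_zero α ht
      (det_fockMatrix_ne_zero (hne _ (by rw [lowestWeight_reflect, hα])) N) hu
    exact congrFun (Matrix.eq_zero_of_mulVec_eq_zero (det_fockMatrix_ne_zero (hne _ hα) N) h1) μ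

end Kernel

/-- For real `c > 1`, the contravariant pairing on singular vectors of weight `k` is governed by a
matrix whose kernel only accounts for `L_{-1}` acting on vectors of weight `0`. -/
theorem exists_gram {X : Type*} [AddCommGroup X] [Module ℂ X] {L : ℤ → Module.End ℂ X} {c : ℝ}
    (hc1 : 1 < c) (hL : LowerRelations L c) (k : ℕ) {N : ℕ} (hN : 1 ≤ N) :
    ∃ G : Matrix (Idx N) (Idx N) ℂ,
      (∀ ω, IsSingular L k ω → ∀ μ ν : Idx N,
        upWord L (sortedWord μ.1).reverse (downWord L (sortedWord ν.1) ω) = G μ ν • ω) ∧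
      ∀ u : Idx N → X, (∀ μ, ∑ ν, G μ ν • u ν = 0) → ∀ ν : Idx N, (k = 0 → ν.1 0 = 0) → u ν = 0 := by
  obtain ⟨t, ht, hc⟩ := exists_charge_eq c
  obtain ⟨α, hα, hα0⟩ : ∃ α, lowestWeight t α = k ∧ (k = 0 → α = 0) := by
    rcases Nat.eq_zero_or_pos k with rfl | hk
    · exact ⟨0, by simp [lowestWeight], fun _ => rfl⟩
    · obtain ⟨α, hα⟩ := exists_lowestWeight_eq ht k
      exact ⟨α, hα, fun h => absurd h hk.ne'⟩
  refine ⟨gram t α N, fun ω hω μ ν => ?_, fun u hu ν hν => ?_⟩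
  · rw [← hα] at hω
    exact upWord_downWord_eq_gram α ht (hc ▸ hL) hω μ ν
  -- The coordinates of `u` are vectors of `X`; applying a linear functional reduces to scalars.
  · refine (Module.forall_dual_apply_eq_zero_iff ℂ _).mp fun f => ?_
    refine apply_eq_zero_of_gram_mulVec ht hc hc1 hα hα0 hN (u := fun ν => f (u ν)) ?_ hν
    ext μ
    have := congrArg f (hu μ)
    rw [map_sum, map_zero] at this
    rw [Pi.zero_apply, ← this]
    exact sum_congr rfl fun ν _ => by rw [map_smul, smul_eq_mul]

end Virasoro

end



noncomputable section

namespace Virasoro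

open Finset

/-! ### Splitting off the singular vectors -/

/-- The Virasoro relations with central charge `c`. -/
def Relations {X : Type*} [AddCommGroup X] [Module ℂ X] (L : ℤ → Module.End ℂ X) (c : ℂ) : Prop :=
  ∀ m n : ℤ, L m * L n - L n * L m = ((m : ℂ) - n) • L (m + n)
    + (if m + n = 0 then ((m : ℂ) ^ 3 - m) / 12 * c else 0) • (1 : Module.End ℂ X)

/-- Operators satisfying the Virasoro relations and compatible with a grading bounded below by `0`,
such that `L_{-1}` kills the vectors of weight `0`. -/
structure IsGraded {X : Type*} [AddCommGroup X] [Module ℂ X] (L : ℤ → Module.End ℂ X) (c : ℂ)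
    (W : ℤ → Submodule ℂ X) : Prop where
  relations : Relations L c
  mode_mem : ∀ m n : ℤ, ∀ x ∈ W n, L m x ∈ W (n - m)
  weight : ∀ n : ℤ, ∀ x ∈ W n, L 0 x = (n : ℂ) • x
  eq_bot : ∀ n < 0, W n = ⊥
  translation : ∀ x ∈ W 0, L (-1) x = 0

section Defs

variable {X : Type*} [AddCommGroup X] [Module ℂ X] (L : ℤ → Module.End ℂ X)
  (W : ℤ → Submodule ℂ X)

/-- The singular vectors of weight `k`. -/
def singular (k : ℤ) : Submodule ℂ X where
  carrier := {x | x ∈ W k ∧ ∀ n : ℕ, L ((n : ℤ) + 1) x = 0}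
  add_mem' hx hy := ⟨add_mem hx.1 hy.1, fun n => by rw [map_add, hx.2, hy.2, add_zero]⟩
  zero_mem' := ⟨zero_mem _, fun n => map_zero _⟩
  smul_mem' a _ hx := ⟨Submodule.smul_mem _ a hx.1, fun n => by rw [map_smul, hx.2, smul_zero]⟩

/-- The vectors of weight `k` in the image of the lowering operators. -/
def descend (k : ℤ) : Submodule ℂ X := ⨆ n : ℕ, (W (k - (n + 1))).map (L (-((n : ℤ) + 1)))

end Defs

variable {X : Type*} [AddCommGroup X] [Module ℂ X] {L : ℤ → Module.End ℂ X}
  {W : ℤ → Submodule ℂ X} {c : ℂ}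

theorem Relations.lowerRelations (h : Relations L c) : LowerRelations L c := by
  intro m n
  have := h m (-((n : ℤ) + 1))
  rw [this]
  congr 2
  · push_cast; ring
  · refine if_congr ?_ rfl rfl
    constructor <;> intro h <;> linarith

theorem lower_mem_descend {k : ℤ} (n : ℕ) {x : X} (hx : x ∈ W (k - (n + 1))) :
    L (-((n : ℤ) + 1)) x ∈ descend L W k :=
  Submodule.mem_iSup_of_mem n (Submodule.mem_map_of_mem hx)

namespace IsGraded

variable (hg : IsGraded L c W)
include hg

theorem isSingular {k : ℕ} {x : X} (hx : x ∈ singular L W k) : IsSingular L k x :=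
  ⟨by simpa using hg.weight k x hx.1, hx.2⟩

theorem descend_le (k : ℤ) : descend L W k ≤ W k := by
  refine iSup_le fun n => ?_
  rintro _ ⟨x, hx, rfl⟩
  have := hg.mode_mem (-((n : ℤ) + 1)) _ x hx
  rwa [sub_neg_eq_add, sub_add_cancel] at this

theorem downWord_mem {k : ℤ} {x : X} (hx : x ∈ W k) (l : List ℕ) :
    downWord L l x ∈ W (k + wordDegree l) := by
  induction l with
  | nil => simpa [downWord] using hx
  | cons n l ih =>
    have := hg.mode_mem (-((n : ℤ) + 1)) _ _ ih
    rw [downWord, word_cons, Module.End.mul_apply, wordDegree_cons]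
    rw [show k + ((n + 1 + wordDegree l : ℕ) : ℤ)
      = k + (wordDegree l : ℤ) - -((n : ℤ) + 1) by push_cast; ring]
    exact this

theorem downWord_mem_descend {k : ℤ} {x : X} (hx : x ∈ W k) {l : List ℕ} (hl : l ≠ []) :
    downWord L l x ∈ descend L W (k + wordDegree l) := by
  cases l with
  | nil => exact absurd rfl hl
  | cons n l =>
    rw [downWord, word_cons, Module.End.mul_apply]
    refine lower_mem_descend n ?_
    rw [show k + (wordDegree (n :: l) : ℤ) - (n + 1) = k + wordDegree l by
      rw [wordDegree_cons]; push_cast; ring]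
    exact hg.downWord_mem hx l

theorem levelSpan_le_descend {k d : ℤ} (hd : 0 < d) {x : X} (hx : x ∈ W k) :
    levelSpan L x d ≤ descend L W (k + d) := by
  rw [levelSpan, Submodule.span_le]
  rintro _ ⟨l, rfl, rfl⟩
  refine hg.downWord_mem_descend hx ?_
  rintro rfl
  simp at hd

theorem lower_comm (i j : ℕ) : L (-((i : ℤ) + 1)) * L (-((j : ℤ) + 1))
    - L (-((j : ℤ) + 1)) * L (-((i : ℤ) + 1))
    = ((j : ℂ) - i) • L (-(((i + j + 1 : ℕ) : ℤ) + 1)) := by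
  rw [hg.relations, if_neg (by omega), zero_smul, add_zero]
  rw [show -((i : ℤ) + 1) + -((j : ℤ) + 1) = -(((i + j + 1 : ℕ) : ℤ) + 1) by push_cast; ring]
  congr 1
  push_cast; ring

theorem downWord_mem_span_sortedWord (l : List ℕ) (x : X) : downWord L l x ∈
    Submodule.span ℂ (Set.range fun μ : Idx (wordDegree l) => downWord L (sortedWord μ.1) x) := by
  have h := word_mem_span_sortedWord hg.lower_comm l
  have := Submodule.mem_map_of_mem (f := LinearMap.applyₗ x) h
  rw [Submodule.map_span, ← Set.range_comp] at this
  exact this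

/-- The vectors of weight `k` generated by singular vectors. -/
theorem le_span_downWord {h : ℕ} (hs : ∀ k : ℕ, k < h → W k ≤ singular L W k ⊔ descend L W k)
    (k : ℕ) (hk : k < h) : W k ≤ Submodule.span ℂ
      {y | ∃ (j : ℕ) (l : List ℕ), j + wordDegree l = k ∧ ∃ x ∈ singular L W j,
        y = downWord L l x} := by
  induction k using Nat.strong_induction_on with
  | _ k ih =>
    refine (hs k hk).trans (sup_le ?_ (iSup_le fun n => ?_))
    · intro x hx
      exact Submodule.subset_span ⟨k, [], by simp, x, hx, by simp [downWord]⟩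
    · rw [Submodule.map_le_iff_le_comap]
      by_cases hn : n + 1 ≤ k
      · have h1 := ih (k - (n + 1)) (by omega) (by omega)
        have h2 : ((k - (n + 1) : ℕ) : ℤ) = (k : ℤ) - (n + 1) := by
          rw [Nat.cast_sub hn]; push_cast; ring
        rw [h2] at h1
        refine h1.trans (Submodule.span_le.mpr ?_)
        rintro _ ⟨j, l, hjl, x, hx, rfl⟩
        refine Submodule.subset_span ⟨j, n :: l, ?_, x, hx, by simp [downWord]⟩
        rw [wordDegree_cons]; omega
      · rw [hg.eq_bot _ (by omega)]
        exact bot_le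

theorem descend_le_span_downWord {h : ℕ}
    (hs : ∀ k : ℕ, k < h → W k ≤ singular L W k ⊔ descend L W k) :
    descend L W h ≤ Submodule.span ℂ
      {y | ∃ (j : ℕ) (l : List ℕ), j < h ∧ j + wordDegree l = h ∧ ∃ x ∈ singular L W j,
        y = downWord L l x} := by
  refine iSup_le fun n => ?_
  rw [Submodule.map_le_iff_le_comap]
  by_cases hn : n + 1 ≤ h
  · have h1 := hg.le_span_downWord hs (h - (n + 1)) (by omega)
    have h2 : ((h - (n + 1) : ℕ) : ℤ) = (h : ℤ) - (n + 1) := by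
      rw [Nat.cast_sub hn]; push_cast; ring
    rw [h2] at h1
    refine h1.trans (Submodule.span_le.mpr ?_)
    rintro _ ⟨j, l, hjl, x, hx, rfl⟩
    refine Submodule.subset_span ⟨j, n :: l, by omega, ?_, x, hx, by simp [downWord]⟩
    rw [wordDegree_cons]; omega
  · rw [hg.eq_bot _ (by omega)]
    exact bot_le

/-- The normal form to which Gram matrices apply: one singular vector for each weight `k < h` and
each partition of `h - k`. -/
theorem exists_eq_sum_downWord {h : ℕ}
    (hs : ∀ k : ℕ, k < h → W k ≤ singular L W k ⊔ descend L W k) {v : X}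
    (hv : v ∈ descend L W h) :
    ∃ w : (Σ k : Fin h, Idx (h - k)) → X, (∀ p, w p ∈ singular L W (p.1 : ℕ)) ∧
      v = ∑ p, downWord L (sortedWord p.2.1) (w p) := by
  classical
  have hadd : ∀ x y : X,
      (∃ w : (Σ k : Fin h, Idx (h - k)) → X, (∀ p, w p ∈ singular L W (p.1 : ℕ)) ∧
        x = ∑ p, downWord L (sortedWord p.2.1) (w p)) →
      (∃ w : (Σ k : Fin h, Idx (h - k)) → X, (∀ p, w p ∈ singular L W (p.1 : ℕ)) ∧
        y = ∑ p, downWord L (sortedWord p.2.1) (w p)) →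
      ∃ w : (Σ k : Fin h, Idx (h - k)) → X, (∀ p, w p ∈ singular L W (p.1 : ℕ)) ∧
        x + y = ∑ p, downWord L (sortedWord p.2.1) (w p) := by
    rintro _ _ ⟨w, hw, rfl⟩ ⟨w', hw', rfl⟩
    refine ⟨w + w', fun p => add_mem (hw p) (hw' p), ?_⟩
    rw [← sum_add_distrib]
    exact sum_congr rfl fun p _ => by rw [Pi.add_apply, map_add]
  have hsmul : ∀ (a : ℂ) (x : X),
      (∃ w : (Σ k : Fin h, Idx (h - k)) → X, (∀ p, w p ∈ singular L W (p.1 : ℕ)) ∧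
        x = ∑ p, downWord L (sortedWord p.2.1) (w p)) →
      ∃ w : (Σ k : Fin h, Idx (h - k)) → X, (∀ p, w p ∈ singular L W (p.1 : ℕ)) ∧
        a • x = ∑ p, downWord L (sortedWord p.2.1) (w p) := by
    rintro a _ ⟨w, hw, rfl⟩
    refine ⟨a • w, fun p => Submodule.smul_mem _ _ (hw p), ?_⟩
    rw [smul_sum]
    exact sum_congr rfl fun p _ => by rw [Pi.smul_apply, map_smul]
  have hzero : ∃ w : (Σ k : Fin h, Idx (h - k)) → X, (∀ p, w p ∈ singular L W (p.1 : ℕ)) ∧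
      (0 : X) = ∑ p, downWord L (sortedWord p.2.1) (w p) :=
    ⟨0, fun p => zero_mem _, by simp⟩
  have hmem := hg.descend_le_span_downWord hs hv
  clear hv
  induction hmem using Submodule.span_induction with
  | zero => exact hzero
  | add x y _ _ hx hy => exact hadd x y hx hy
  | smul a x _ hx => exact hsmul a x hx
  | mem y hy =>
    obtain ⟨j, l, hj, hjl, x, hx, rfl⟩ := hy
    have hl := hg.downWord_mem_span_sortedWord l x
    generalize downWord L l x = y at hl
    induction hl using Submodule.span_induction with
    | zero => exact hzero
    | add x y _ _ hx hy => exact hadd x y hx hy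
    | smul a x _ hx => exact hsmul a x hx
    | mem y hy =>
      obtain ⟨μ, rfl⟩ := hy
      have hμ : multiDegree μ.1 = h - (⟨j, hj⟩ : Fin h) := by rw [μ.2]; simp; omega
      refine ⟨Pi.single ⟨⟨j, hj⟩, ⟨μ.1, hμ⟩⟩ x, fun p => ?_, ?_⟩
      · rcases eq_or_ne p ⟨⟨j, hj⟩, ⟨μ.1, hμ⟩⟩ with rfl | hp
        · simpa using hx
        · rw [Pi.single_eq_of_ne hp]; exact zero_mem _
      · rw [sum_eq_single_of_mem ⟨⟨j, hj⟩, ⟨μ.1, hμ⟩⟩ (mem_univ _)]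
        · simp
        · intro p _ hp
          rw [Pi.single_eq_of_ne hp, map_zero]

end IsGraded

theorem upWord_eq_zero {k : ℤ} {x : X} (hx : x ∈ singular L W k) {l : List ℕ} (hl : l ≠ []) :
    upWord L l x = 0 := by
  rw [← List.dropLast_append_getLast hl, upWord, word_append, Module.End.mul_apply, word_cons,
    word_nil, mul_one, hx.2, map_zero]

/-- Singular vectors are not descendants, provided this is so, and the space is generated by
singular vectors, in smaller weights. -/
theorem IsGraded.disjoint_singular_descend {c : ℝ} (hg : IsGraded L c W) (hc1 : 1 < c) {h : ℕ}
    (hs : ∀ k : ℕ, k < h → W k ≤ singular L W k ⊔ descend L W k)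
    (hd : ∀ k : ℕ, k < h → Disjoint (singular L W k) (descend L W k)) :
    Disjoint (singular L W h) (descend L W h) := by
  classical
  have hL := hg.relations.lowerRelations
  rw [Submodule.disjoint_def]
  intro v hv hv'
  obtain ⟨w, hw, rfl⟩ := hg.exists_eq_sum_downWord hs hv'
  have key : ∀ p, ((p.1 : ℕ) = 0 → p.2.1 0 = 0) → w p = 0 := by
    rintro ⟨k, ν⟩ hν
    obtain ⟨G, hG, hker⟩ := exists_gram hc1 hL k (N := h - k) (by have := k.2; omega)
    refine hker (fun ν => w ⟨k, ν⟩) (fun μ => ?_) ν hν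
    have hmem : ∑ ν, G μ ν • w ⟨k, ν⟩ ∈ singular L W (k : ℕ) :=
      sum_mem fun ν _ => Submodule.smul_mem _ _ (hw ⟨k, ν⟩)
    -- In weight `k` the combination is singular; once it is also a descendant, the induction
    -- hypothesis makes it zero. The raising word kills the original vector, so the combination is
    -- minus the contributions of the other weights `j`.
    refine (Submodule.disjoint_def.mp (hd k k.2)) _ hmem ?_
    have hne : (sortedWord μ.1).reverse ≠ [] := by
      intro h0
      have := wordDegree_perm (List.reverse_perm (sortedWord μ.1))
      rw [h0, wordDegree_sortedWord, μ.2, wordDegree_nil] at this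
      have := k.2
      omega
    have h0 := upWord_eq_zero hv hne
    rw [map_sum, Fintype.sum_sigma, ← add_sum_erase _ _ (mem_univ k)] at h0
    have h1 : ∑ ν, upWord L (sortedWord μ.1).reverse (downWord L (sortedWord ν.1) (w ⟨k, ν⟩))
        = ∑ ν, G μ ν • w ⟨k, ν⟩ :=
      sum_congr rfl fun ν _ => hG _ (hg.isSingular (hw ⟨k, ν⟩)) μ ν
    rw [h1] at h0
    rw [eq_neg_of_add_eq_zero_left h0]
    refine neg_mem (sum_mem fun j hj => sum_mem fun ν _ => ?_)
    have hjk := (mem_erase.mp hj).1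
    have h2 := upWord_mem_levelSpan hL (hg.isSingular (hw ⟨j, ν⟩)) (sortedWord μ.1).reverse
      (downWord_mem_levelSpan (L := L) (ω := w ⟨j, ν⟩) (sortedWord ν.1) rfl)
    rw [wordDegree_perm (List.reverse_perm (sortedWord μ.1)), wordDegree_sortedWord,
      wordDegree_sortedWord, μ.2, ν.2] at h2
    have hj2 := j.2
    have hk2 := k.2
    have hne' : (j : ℕ) ≠ k := fun h => hjk (Fin.ext h)
    rcases lt_or_gt_of_ne hne' with hlt | hgt
    -- For `j < k` some lowering remains after raising, so the contribution is a descendant; for `j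
    -- > k` the degree becomes negative and it vanishes.
    · have h3 := hg.levelSpan_le_descend (by omega) (hw ⟨j, ν⟩).1 h2
      convert h3 using 2
      simp only
      omega
    · rw [levelSpan_eq_bot (by omega), Submodule.mem_bot] at h2
      rw [h2]
      exact zero_mem _
  refine sum_eq_zero fun p _ => ?_
  by_cases hp : (p.1 : ℕ) = 0 → p.2.1 0 = 0
  · rw [key p hp, map_zero]
  -- The terms not covered by `key` have weight 0 and a word ending in `L_{-1}`.
  · push Not at hp
    refine downWord_append_zero (hg.translation _ ?_) hp.2
    have := (hw p).1
    rwa [hp.1] at this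

/-! ### Duality -/

/-- A pairing of graded spaces for which the adjoint of `L_m` is `L_{-m}`, and which is perfect in
each weight. -/
structure IsDualPair {Y : Type*} [AddCommGroup Y] [Module ℂ Y] (L : ℤ → Module.End ℂ X)
    (W : ℤ → Submodule ℂ X) (L' : ℤ → Module.End ℂ Y) (W' : ℤ → Submodule ℂ Y)
    (B : X →ₗ[ℂ] Y →ₗ[ℂ] ℂ) : Prop where
  adjoint : ∀ m x y, B (L m x) y = B x (L' (-m) y)
  exists_left : ∀ n (f : Module.Dual ℂ (W n)), ∃ y ∈ W' n, ∀ x : W n, B x y = f x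
  exists_right : ∀ n (f : Module.Dual ℂ (W' n)), ∃ x ∈ W n, ∀ y : W' n, B x y = f y

namespace IsDualPair

variable {Y : Type*} [AddCommGroup Y] [Module ℂ Y] {L' : ℤ → Module.End ℂ Y}
  {W' : ℤ → Submodule ℂ Y} {B : X →ₗ[ℂ] Y →ₗ[ℂ] ℂ}

theorem flip (hB : IsDualPair L W L' W' B) : IsDualPair L' W' L W B.flip where
  adjoint m x y := by
    rw [LinearMap.flip_apply, LinearMap.flip_apply, hB.adjoint, neg_neg]
  exists_left := hB.exists_right
  exists_right := hB.exists_left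

/-- A functional separates `x` from `U` within weight `n`, and perfectness represents it by a
vector. -/
theorem exists_ne_zero (hB : IsDualPair L W L' W' B) {n : ℤ} (U : Submodule ℂ X) {x : X}
    (hx : x ∈ W n) (hxU : x ∉ U) : ∃ y ∈ W' n, B x y ≠ 0 ∧ ∀ u ∈ U, u ∈ W n → B u y = 0 := by
  obtain ⟨f, hf, hU⟩ := Submodule.exists_le_ker_of_notMem (p := U.comap (W n).subtype)
    (v := ⟨x, hx⟩) (by simpa using hxU)
  obtain ⟨y, hy, h⟩ := hB.exists_left n f
  refine ⟨y, hy, ?_, fun u hu hun => ?_⟩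
  · rw [h ⟨x, hx⟩]; exact hf
  · rw [h ⟨u, hun⟩]
    exact hU (by simpa using hu)

/-- Pairing `L_{n+1} y` with `x` equals pairing `y` with the descendant `L_{-(n+1)} x`, and the
pairing is perfect. -/
theorem mem_singular_of_forall_descend (hB : IsDualPair L W L' W' B) {c : ℂ}
    (hg' : IsGraded L' c W') {k : ℤ} {y : Y} (hy : y ∈ W' k)
    (h : ∀ x ∈ descend L W k, B x y = 0) : y ∈ singular L' W' k := by
  refine ⟨hy, fun n => ?_⟩
  by_contra hne
  obtain ⟨x, hx, hx', -⟩ := hB.flip.exists_ne_zero ⊥ (hg'.mode_mem ((n : ℤ) + 1) k y hy) hne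
  rw [LinearMap.flip_apply] at hx'
  refine hx' ?_
  rw [← h _ (lower_mem_descend (L := L) n hx), hB.adjoint, neg_neg]

/-- If singular vectors of the dual are not descendants, then the space is spanned by singular
vectors and descendants. -/
theorem le_sup (hB : IsDualPair L W L' W' B) {c : ℂ} (hg : IsGraded L c W)
    (hg' : IsGraded L' c W') {k : ℤ}
    (hd : Disjoint (singular L' W' k) (descend L' W' k)) :
    W k ≤ singular L W k ⊔ descend L W k := by
  intro x hx
  by_contra hxU
  obtain ⟨y, hy, hxy, hU⟩ := hB.exists_ne_zero _ hx hxU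
  refine hxy ?_
  have hy1 : y ∈ singular L' W' k := hB.mem_singular_of_forall_descend hg' hy fun u hu =>
    hU u (Submodule.mem_sup_right hu) (hg.descend_le k hu)
  -- A double annihilator argument: a vector `z` orthogonal to the descendants of the dual is
  -- singular, and `y` already kills singular vectors.
  have hy2 : y ∈ descend L' W' k := by
    by_contra hyP
    obtain ⟨z, hz, hzy, hP⟩ := hB.flip.exists_ne_zero _ hy hyP
    refine hzy ?_
    have hz1 : z ∈ singular L W k := hB.flip.mem_singular_of_forall_descend hg hz fun u hu =>
      hP u hu (hg'.descend_le k hu)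
    exact hU z (Submodule.mem_sup_left hz1) hz
  rw [(Submodule.disjoint_def.mp hd) y hy1 hy2, map_zero]

/-- The two modules must advance together: spanning on one side comes from disjointness on the
other, and disjointness from both properties in lower weights. -/
theorem splitting (hB : IsDualPair L W L' W' B) {c : ℝ} (hc1 : 1 < c) (hg : IsGraded L c W)
    (hg' : IsGraded L' c W') (k : ℕ) :
    (W k ≤ singular L W k ⊔ descend L W k ∧ Disjoint (singular L W k) (descend L W k)) ∧
    (W' k ≤ singular L' W' k ⊔ descend L' W' k ∧
      Disjoint (singular L' W' k) (descend L' W' k)) := by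
  induction k using Nat.strong_induction_on with
  | _ k ih =>
    have h1 := hg.disjoint_singular_descend hc1 (fun j hj => (ih j hj).1.1)
      (fun j hj => (ih j hj).1.2)
    have h2 := hg'.disjoint_singular_descend hc1 (fun j hj => (ih j hj).2.1)
      (fun j hj => (ih j hj).2.2)
    exact ⟨⟨hB.le_sup hg hg' h2, h1⟩, ⟨hB.flip.le_sup hg' hg h1, h2⟩⟩

end IsDualPair

end Virasoro

end



noncomputable section

namespace Virasoro

open Finset

variable {X : Type*} [AddCommGroup X] [Module ℂ X] {L : ℤ → Module.End ℂ X}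
  {W : ℤ → Submodule ℂ X} {c : ℂ}

theorem exists_projection (hW : DirectSum.IsInternal W) (n : ℤ) : ∃ π : X →ₗ[ℂ] W n,
    (∀ x : W n, π x = x) ∧ ∀ m ≠ n, ∀ x ∈ W m, π x = 0 := by
  let e := LinearEquiv.ofBijective (DirectSum.coeLinearMap W) hW
  have he : ∀ m (x : W m), e.symm x = DirectSum.lof ℂ ℤ (fun m => W m) m x := fun m x => by
    rw [LinearEquiv.symm_apply_eq]
    exact (DirectSum.coeLinearMap_lof W m x).symm
  refine ⟨DirectSum.component ℂ ℤ (fun m => W m) n ∘ₗ e.symm.toLinearMap, fun x => ?_,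
    fun m hm x hx => ?_⟩
  · rw [LinearMap.comp_apply, LinearEquiv.coe_coe, he, DirectSum.component.lof_self]
  · rw [LinearMap.comp_apply, LinearEquiv.coe_coe, he m ⟨x, hx⟩, DirectSum.component.of,
      dif_neg hm]

/-! ### The contragredient module -/

/-- The contragredient action on the dual space. -/
def dualMode (L : ℤ → Module.End ℂ X) (m : ℤ) : Module.End ℂ (Module.Dual ℂ X) := (L (-m)).dualMap

theorem dualMode_apply (m : ℤ) (ψ : Module.Dual ℂ X) (x : X) :
    dualMode L m ψ x = ψ (L (-m) x) := rfl

/-- The functionals supported in weight `n`. -/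
def dualWeight (W : ℤ → Submodule ℂ X) (n : ℤ) : Submodule ℂ (Module.Dual ℂ X) :=
  ⨅ m, ⨅ (_ : m ≠ n), (W m).dualAnnihilator

theorem mem_dualWeight {n : ℤ} {ψ : Module.Dual ℂ X} :
    ψ ∈ dualWeight W n ↔ ∀ m ≠ n, ∀ x ∈ W m, ψ x = 0 := by
  simp [dualWeight, Submodule.mem_iInf, Submodule.mem_dualAnnihilator]

theorem functional_ext (hW : DirectSum.IsInternal W) {f g : X →ₗ[ℂ] ℂ}
    (h : ∀ m, ∀ x ∈ W m, f x = g x) : f = g := by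
  have hle : ⨆ m, W m ≤ LinearMap.eqLocus f g := iSup_le h
  rw [hW.submodule_iSup_eq_top] at hle
  exact LinearMap.ext fun x => hle Submodule.mem_top

/-- Transposition and `m ↦ -m` each reverse the bracket, so the relations persist with the same
central charge. -/
theorem IsGraded.dual (hg : IsGraded L c W) (hW : DirectSum.IsInternal W)
    (h1 : ∀ x ∈ W 1, L 1 x = 0) : IsGraded (dualMode L) c (dualWeight W) where
  relations m n := by
    refine LinearMap.ext fun ψ => LinearMap.ext fun x => ?_
    have h := congrArg ψ (LinearMap.congr_fun (hg.relations (-n) (-m)) x)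
    simp only [LinearMap.sub_apply, Module.End.mul_apply, LinearMap.add_apply,
      LinearMap.smul_apply, Module.End.one_apply, map_sub, map_add, map_smul] at h
    simp only [LinearMap.sub_apply, Module.End.mul_apply, LinearMap.add_apply,
      LinearMap.smul_apply, Module.End.one_apply, dualMode_apply, h]
    rw [show -n + -m = -(m + n) by ring]
    congr 2
    · push_cast; ring
    · by_cases hmn : m + n = 0
      · rw [if_pos hmn, if_pos (by omega)]
        obtain rfl : n = -m := by omega
        push_cast; ring
      · rw [if_neg hmn, if_neg (by omega)]
  mode_mem m n ψ hψ := by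
    rw [mem_dualWeight] at hψ ⊢
    intro k hk x hx
    exact hψ (k + m) (by omega) _ (by simpa using hg.mode_mem (-m) k x hx)
  weight n ψ hψ := by
    refine functional_ext hW fun m x hx => ?_
    rw [dualMode_apply, neg_zero, hg.weight m x hx, map_smul, LinearMap.smul_apply]
    rcases eq_or_ne m n with rfl | hmn
    · rfl
    · rw [mem_dualWeight.mp hψ m hmn x hx, smul_zero, smul_zero]
  eq_bot n hn := by
    rw [eq_bot_iff]
    intro ψ hψ
    refine functional_ext hW fun m x hx => ?_
    rcases eq_or_ne m n with rfl | hmn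
    · rw [hg.eq_bot m hn, Submodule.mem_bot] at hx
      rw [hx, map_zero, map_zero]
    · exact mem_dualWeight.mp hψ m hmn x hx
  translation ψ hψ := by
    refine functional_ext hW fun m x hx => ?_
    rw [dualMode_apply, neg_neg]
    -- On the dual `L_{-1}` is the transpose of `L_1`, which reaches weight 0 only from weight 1,
    -- where it vanishes by `h1`.
    rcases eq_or_ne m 1 with rfl | hm
    · rw [h1 x hx, map_zero]; rfl
    · exact mem_dualWeight.mp hψ (m - 1) (by omega) _ (hg.mode_mem 1 m x hx)

theorem isDualPair_dual (hW : DirectSum.IsInternal W) (hfin : ∀ n, Module.Finite ℂ (W n)) :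
    IsDualPair L W (dualMode L) (dualWeight W) (Module.Dual.eval ℂ X) where
  adjoint m x ψ := by
    rw [Module.Dual.eval_apply, Module.Dual.eval_apply, dualMode_apply, neg_neg]
  exists_left n f := by
    obtain ⟨π, hπ, hπ0⟩ := exists_projection hW n
    refine ⟨f ∘ₗ π, mem_dualWeight.mpr fun m hm x hx => ?_, fun x => ?_⟩
    · rw [LinearMap.comp_apply, hπ0 m hm x hx, map_zero]
    · rw [Module.Dual.eval_apply, LinearMap.comp_apply, hπ]
  exists_right n f := by
    have := hfin n
    obtain ⟨π, hπ, hπ0⟩ := exists_projection hW n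
    let ρ : Module.Dual ℂ (W n) →ₗ[ℂ] dualWeight W n :=
      LinearMap.codRestrict _ π.dualMap fun g => mem_dualWeight.mpr fun m hm x hx => by
        rw [LinearMap.dualMap_apply, hπ0 m hm x hx, map_zero]
    -- Finite dimension enters through reflexivity of `W n`; `ρ` extends functionals by zero off
    -- weight `n`.
    refine ⟨(Module.evalEquiv ℂ (W n)).symm (f ∘ₗ ρ), Subtype.coe_prop _, fun ψ => ?_⟩
    have h1 : ρ (ψ.1 ∘ₗ (W n).subtype) = ψ := by
      refine Subtype.ext (functional_ext hW fun m x hx => ?_)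
      change ψ.1 (π x) = ψ.1 x
      rcases eq_or_ne m n with rfl | hm
      · rw [hπ ⟨x, hx⟩]
      · rw [hπ0 m hm x hx, mem_dualWeight.mp ψ.2 m hm x hx, Submodule.coe_zero, map_zero]
    have h2 := Module.apply_evalEquiv_symm_apply ℂ (W n) (ψ.1 ∘ₗ (W n).subtype) (f ∘ₗ ρ)
    rw [LinearMap.comp_apply, LinearMap.comp_apply, h1] at h2
    exact h2

/-! ### Complete reducibility -/

/-- The homogeneous components of a vector of a stable subspace lie in that subspace. -/
theorem mem_of_sum_mem {T : Module.End ℂ X} (hT : ∀ n : ℤ, ∀ x ∈ W n, T x = (n : ℂ) • x)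
    {M : Submodule ℂ X} (hM : ∀ x ∈ M, T x ∈ M) (s : Finset ℤ) (f : ℤ → X) (hf : ∀ m, f m ∈ W m)
    (h : ∑ m ∈ s, f m ∈ M) : ∀ m ∈ s, f m ∈ M := by
  induction s using Finset.induction_on generalizing f with
  | empty => simp
  | insert a s ha ih =>
    -- `T - a` removes the component of weight `a` and scales the others by nonzero numbers.
    have h1 : ∑ m ∈ s, ((m : ℂ) - a) • f m ∈ M := by
      have : ∑ m ∈ s, ((m : ℂ) - a) • f m
          = T (∑ m ∈ insert a s, f m) - (a : ℂ) • ∑ m ∈ insert a s, f m := by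
        rw [map_sum, smul_sum, ← sum_sub_distrib, sum_insert ha, hT a _ (hf a), sub_self,
          zero_add]
        exact sum_congr rfl fun m _ => by rw [hT m _ (hf m), sub_smul]
      rw [this]
      exact sub_mem (hM _ h) (Submodule.smul_mem _ _ h)
    have h2 : ∀ m ∈ s, f m ∈ M := fun m hm => by
      have h3 := ih (fun m => ((m : ℂ) - a) • f m) (fun m => Submodule.smul_mem _ _ (hf m)) h1 m hm
      refine (Submodule.smul_mem_iff _ (sub_ne_zero.mpr ?_)).mp h3
      exact_mod_cast ne_of_mem_of_not_mem hm ha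
    intro m hm
    rcases mem_insert.mp hm with rfl | hm
    · rw [sum_insert ha] at h
      exact (Submodule.add_mem_iff_left _ (sum_mem h2)).mp h
    · exact h2 m hm

/-- Stability under `L_0` gives homogeneous vectors; one of least weight in `M` is singular, since
raising operators lower the weight. -/
theorem IsGraded.exists_mem_singular (hg : IsGraded L c W) (hW : DirectSum.IsInternal W)
    {M : Submodule ℂ X} (hM : ∀ n : ℤ, ∀ x ∈ M, L n x ∈ M) (hne : M ≠ ⊥) :
    ∃ (k : ℕ), ∃ x ∈ M, x ≠ 0 ∧ x ∈ singular L W k := by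
  classical
  have hex : ∃ k : ℕ, ∃ x ∈ M, x ∈ W k ∧ x ≠ 0 := by
    obtain ⟨y, hy, hy0⟩ := Submodule.exists_mem_ne_zero_of_ne_bot hne
    have hyW : y ∈ ⨆ m, W m := hW.submodule_iSup_eq_top ▸ Submodule.mem_top
    obtain ⟨f, hf, rfl⟩ := (Submodule.mem_iSup_iff_exists_finsupp _ _).mp hyW
    obtain ⟨m, hm, hm0⟩ := exists_ne_zero_of_sum_ne_zero hy0
    have hmW := hf m
    rcases lt_or_ge m 0 with hlt | hge
    · rw [hg.eq_bot m hlt, Submodule.mem_bot] at hmW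
      exact absurd hmW hm0
    · refine ⟨m.toNat, f m, mem_of_sum_mem hg.weight (hM 0) f.support f hf hy m hm, ?_, hm0⟩
      rwa [Int.toNat_of_nonneg hge]
  obtain ⟨x, hxM, hxW, hx0⟩ := Nat.find_spec hex
  refine ⟨Nat.find hex, x, hxM, hx0, hxW, fun n => ?_⟩
  by_contra hn0
  have hmem := hg.mode_mem ((n : ℤ) + 1) _ x hxW
  by_cases hn : n + 1 ≤ Nat.find hex
  · refine Nat.find_min hex (m := Nat.find hex - (n + 1)) (by omega)
      ⟨_, hM _ _ hxM, ?_, hn0⟩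
    rw [Nat.cast_sub hn]
    exact_mod_cast hmem
  · rw [hg.eq_bot _ (by omega), Submodule.mem_bot] at hmem
    exact hn0 hmem

section LieModule

variable [LieRingModule Virasoro X] [LieModule ℂ Virasoro X]

theorem lieSpan_toSubmodule_le (hL : ∀ n x, ⁅Virasoro.L n, x⁆ = L n x)
    (hC : ∀ x : X, ⁅Virasoro.C, x⁆ = c • x) (hr : Relations L c) {h : ℂ} {ω : X}
    (hω : IsSingular L h ω) : (LieSubmodule.lieSpan ℂ Virasoro {ω}).toSubmodule
      ≤ Submodule.span ℂ (Set.range fun l => downWord L l ω) := by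
  let N : LieSubmodule ℂ Virasoro X :=
    { Submodule.span ℂ (Set.range fun l => downWord L l ω) with
      lie_mem := by
        intro x m hm
        change m ∈ Submodule.span ℂ (Set.range fun l => downWord L l ω) at hm
        change ⁅x, m⁆ ∈ Submodule.span ℂ (Set.range fun l => downWord L l ω)
        induction x using Virasoro.induction with
        | hL n =>
          rw [hL]
          induction hm using Submodule.span_induction with
          | mem y hy =>
            obtain ⟨l, rfl⟩ := hy
            refine Submodule.span_mono ?_ (mode_downWord_mem hr.lowerRelations hω l n)
            rintro _ ⟨l', -, rfl⟩
            exact ⟨l', rfl⟩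
          | zero => simp
          | add y z _ _ hy hz => rw [map_add]; exact add_mem hy hz
          | smul a y _ hy => rw [map_smul]; exact Submodule.smul_mem _ _ hy
        | hC => rw [hC]; exact Submodule.smul_mem _ _ hm
        | hadd x y hx hy => rw [add_lie]; exact add_mem hx hy
        | hsmul a x hx => rw [smul_lie]; exact Submodule.smul_mem _ _ hx }
  have : LieSubmodule.lieSpan ℂ Virasoro {ω} ≤ N := by
    rw [LieSubmodule.lieSpan_le, Set.singleton_subset_iff]
    exact Submodule.subset_span ⟨[], by simp [downWord]⟩
  exact this

variable (hL : ∀ n x, ⁅Virasoro.L n, x⁆ = L n x) (hC : ∀ x : X, ⁅Virasoro.C, x⁆ = c • x)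
  (hg : IsGraded L c W) (hW : DirectSum.IsInternal W)
  (hs : ∀ k : ℕ, W k ≤ singular L W k ⊔ descend L W k)
  (hd : ∀ k : ℕ, Disjoint (singular L W k) (descend L W k))

include hL hC hg hW hd in
/-- A nonzero submodule of the module generated by a singular vector contains that vector. -/
theorem IsGraded.mem_of_le_lieSpan {k : ℕ} {x : X} (hx : x ∈ singular L W k)
    {M : LieSubmodule ℂ Virasoro X} (hle : M ≤ LieSubmodule.lieSpan ℂ Virasoro {x})
    (hne : M ≠ ⊥) : x ∈ M := by
  obtain ⟨j, y, hyM, hy0, hy⟩ := hg.exists_mem_singular hW (M := M.toSubmodule)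
    (fun n z hz => by rw [← hL]; exact M.lie_mem hz)
    (fun h => hne ((LieSubmodule.toSubmodule_eq_bot M).mp h))
  have hyN := lieSpan_toSubmodule_le hL hC hg.relations (hg.isSingular hx) (hle hyM)
  obtain ⟨π, hπ, hπ0⟩ := exists_projection hW j
  -- Projecting to weight `j` discards all words except those of degree `j - k`.
  have hlev : y ∈ levelSpan L x ((j : ℤ) - k) := by
    have h1 : Submodule.span ℂ (Set.range fun l => downWord L l x)
        ≤ (levelSpan L x ((j : ℤ) - k)).comap ((W j).subtype ∘ₗ π) := by
      rw [Submodule.span_le]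
      rintro _ ⟨l, rfl⟩
      rw [SetLike.mem_coe, Submodule.mem_comap, LinearMap.comp_apply, Submodule.subtype_apply]
      have h2 := hg.downWord_mem hx.1 l
      rcases eq_or_ne ((k : ℤ) + wordDegree l) j with h3 | h3
      · rw [h3] at h2
        rw [hπ ⟨_, h2⟩]
        exact downWord_mem_levelSpan l (by omega)
      · rw [hπ0 _ h3 _ h2]
        exact zero_mem _
    have h2 := h1 hyN
    rwa [Submodule.mem_comap, LinearMap.comp_apply, Submodule.subtype_apply, hπ ⟨y, hy.1⟩] at h2
  rcases lt_trichotomy ((j : ℤ) - k) 0 with hlt | heq | hgt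
  · rw [levelSpan_eq_bot hlt, Submodule.mem_bot] at hlev
    exact absurd hlev hy0
  · rw [heq, levelSpan_zero] at hlev
    obtain ⟨a, rfl⟩ := Submodule.mem_span_singleton.mp hlev
    have ha : a ≠ 0 := by rintro rfl; simp at hy0
    exact (Submodule.smul_mem_iff M.toSubmodule ha).mp hyM
  -- Above weight `k` the vector would be both singular and a descendant.
  · have h1 := hg.levelSpan_le_descend hgt hx.1 hlev
    rw [add_sub_cancel] at h1
    exact absurd (Submodule.disjoint_def.mp (hd j) y hy h1) hy0

include hL hC hg hW hd in
theorem IsGraded.isIrreducible_lieSpan {k : ℕ} {x : X} (hx : x ∈ singular L W k) (hx0 : x ≠ 0) :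
    LieModule.IsIrreducible ℂ Virasoro (LieSubmodule.lieSpan ℂ Virasoro {x}) := by
  set N := LieSubmodule.lieSpan ℂ Virasoro {x} with hN
  have hxN : x ∈ N := LieSubmodule.subset_lieSpan rfl
  have : Nontrivial N := ⟨⟨x, hxN⟩, 0, fun h => hx0 (congrArg Subtype.val h)⟩
  refine LieModule.IsIrreducible.mk fun M hM => ?_
  have h1 : x ∈ M.map N.incl := by
    refine hg.mem_of_le_lieSpan hL hC hW hd hx ?_ ?_
    · rintro _ ⟨y, -, rfl⟩
      exact y.2
    · intro h
      refine hM ((LieSubmodule.eq_bot_iff M).mpr fun y hy => ?_)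
      have : N.incl y ∈ M.map N.incl := LieSubmodule.mem_map_of_mem hy
      rw [h, LieSubmodule.mem_bot] at this
      exact Subtype.ext this
  have h2 : N ≤ M.map N.incl := by
    refine LieSubmodule.lieSpan_le.mpr ?_
    rw [Set.singleton_subset_iff]
    exact h1
  refine eq_top_iff.mpr fun y _ => ?_
  obtain ⟨z, hz, hzy⟩ := (LieSubmodule.mem_map _).mp (h2 y.2)
  obtain rfl : z = y := Subtype.ext hzy
  exact hz

include hL hC hg hW hs hd in
theorem IsGraded.isCompletelyReducible : IsCompletelyReducible ℂ Virasoro X := by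
  classical
  let b := fun k : ℕ => Module.Basis.ofVectorSpace ℂ (singular L W k)
  let v : (Σ k : ℕ, Module.Basis.ofVectorSpaceIndex ℂ (singular L W k)) → X := fun i => b i.1 i.2
  have hv : ∀ i, v i ∈ singular L W (i.1 : ℕ) := fun i => (b i.1 i.2).2
  let N := fun i => LieSubmodule.lieSpan ℂ Virasoro {v i}
  have hvN : ∀ i, v i ∈ N i := fun i => LieSubmodule.subset_lieSpan rfl
  refine ⟨Set.range N, ?_, ?_, ?_⟩
  · rintro _ ⟨i, rfl⟩
    exact hg.isIrreducible_lieSpan hL hC hW hd (hv i) fun h0 => (b i.1).ne_zero i.2 (Subtype.ext h0)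
  · rintro _ ⟨i, rfl⟩
    by_contra hdis
    rw [disjoint_iff] at hdis
    have hmem := (hg.mem_of_le_lieSpan hL hC hW hd (hv i) inf_le_left hdis).2
    obtain ⟨π, hπ, hπ0⟩ := exists_projection hW i.1
    set U : Submodule ℂ X := Submodule.span ℂ ((fun e => (b i.1 e : X)) '' {e | e ≠ i.2}) with hU
    -- In the weight of `v i`, the other summands contribute only descendants and the other basis
    -- vectors of that singular space. If `v i` lay there, disjointness would remove the descendant
    -- part and contradict linear independence.
    have hle : (sSup (Set.range N \ {N i})).toSubmodule
        ≤ (U ⊔ descend L W i.1).comap ((W i.1).subtype ∘ₗ π) := by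
      rw [LieSubmodule.sSup_toSubmodule_eq_iSup]
      refine iSup₂_le ?_
      rintro _ ⟨⟨j, rfl⟩, hji⟩
      replace hji : j ≠ i := fun h => hji (h ▸ rfl)
      refine (lieSpan_toSubmodule_le hL hC hg.relations (hg.isSingular (hv j))).trans ?_
      rw [Submodule.span_le]
      rintro _ ⟨l, rfl⟩
      rw [SetLike.mem_coe, Submodule.mem_comap, LinearMap.comp_apply, Submodule.subtype_apply]
      have h2 := hg.downWord_mem (hv j).1 l
      rcases eq_or_ne ((j.1 : ℤ) + wordDegree l) i.1 with h3 | h3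
      · have h4 := h2
        rw [h3] at h4
        rw [hπ ⟨_, h4⟩]
        by_cases hl : l = []
        · subst hl
          obtain ⟨k, e⟩ := i
          obtain ⟨k', e'⟩ := j
          obtain rfl : k' = k := by simpa using h3
          refine Submodule.mem_sup_left (Submodule.subset_span ⟨e', ?_, by simp [downWord, v]⟩)
          rintro rfl
          exact hji rfl
        · have := hg.downWord_mem_descend (hv j).1 hl
          rw [h3] at this
          exact Submodule.mem_sup_right this
      · rw [hπ0 _ h3 _ h2]
        exact zero_mem _
    have h1 := hle hmem
    rw [Submodule.mem_comap, LinearMap.comp_apply, Submodule.subtype_apply, hπ ⟨v i, (hv i).1⟩] at h1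
    obtain ⟨y, hy, z, hz, hyz⟩ := Submodule.mem_sup.mp h1
    have hyΩ : y ∈ singular L W (i.1 : ℕ) := by
      have : U ≤ singular L W (i.1 : ℕ) := by
        rw [hU, Submodule.span_le]
        rintro _ ⟨e, -, rfl⟩
        exact (b i.1 e).2
      exact this hy
    have hz0 : z = 0 := by
      refine Submodule.disjoint_def.mp (hd i.1) z ?_ hz
      rw [eq_sub_of_add_eq' hyz]
      exact sub_mem (hv i) hyΩ
    rw [hz0, add_zero] at hyz
    have hli : LinearIndependent ℂ fun e => (b i.1 e : X) :=
      (b i.1).linearIndependent.map' (singular L W (i.1 : ℕ)).subtype (Submodule.ker_subtype _)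
    refine hli.notMem_span_image (s := {e | e ≠ i.2}) (x := i.2) (fun h => h rfl) ?_
    change v i ∈ U
    have : y = v i := hyz
    exact this ▸ hy
  · set T := sSup (Set.range N) with hT
    have hNT : ∀ i, N i ≤ T := fun i => le_sSup ⟨i, rfl⟩
    -- Spanning by induction on the weight: singular vectors come from the bases, descendants from
    -- lower weights.
    have hk : ∀ k : ℕ, W k ≤ T.toSubmodule := by
      intro k
      induction k using Nat.strong_induction_on with
      | _ k ih =>
        refine (hs k).trans (sup_le (fun x hx => ?_) (iSup_le fun n => ?_))
        · have h1 : (⊤ : Submodule ℂ (singular L W k)) ≤ T.toSubmodule.comap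
              (singular L W k).subtype := by
            rw [← (b k).span_eq, Submodule.span_le]
            rintro _ ⟨e, rfl⟩
            exact hNT ⟨k, e⟩ (hvN ⟨k, e⟩)
          exact h1 (Submodule.mem_top (x := ⟨x, hx⟩))
        · rw [Submodule.map_le_iff_le_comap]
          intro x hx
          rw [Submodule.mem_comap, ← hL]
          refine T.lie_mem ?_
          by_cases hn : n + 1 ≤ k
          · refine ih (k - (n + 1)) (by omega) ?_
            rw [Nat.cast_sub hn]
            exact_mod_cast hx
          · rw [hg.eq_bot _ (by omega), Submodule.mem_bot] at hx
            rw [hx]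
            exact T.toSubmodule.zero_mem
    rw [← LieSubmodule.toSubmodule_eq_top, eq_top_iff, ← hW.submodule_iSup_eq_top]
    refine iSup_le fun m => ?_
    rcases lt_or_ge m 0 with hlt | hge
    · rw [hg.eq_bot m hlt]
      exact bot_le
    · have := hk m.toNat
      rwa [Int.toNat_of_nonneg hge] at this

end LieModule

/-- Graded Virasoro modules of real central charge `c > 1` with finite-dimensional weight spaces in
which `L_{-1}` kills weight `0` and `L_1` kills weight `1` are completely reducible. -/
theorem IsGraded.isCompletelyReducible_of_one_lt [LieRingModule Virasoro X]
    [LieModule ℂ Virasoro X] {c : ℝ} (hc1 : 1 < c) (hL : ∀ n x, ⁅Virasoro.L n, x⁆ = L n x)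
    (hC : ∀ x : X, ⁅Virasoro.C, x⁆ = (c : ℂ) • x) (hg : IsGraded L c W)
    (hW : DirectSum.IsInternal W) (hfin : ∀ n, Module.Finite ℂ (W n))
    (h1 : ∀ x ∈ W 1, L 1 x = 0) : IsCompletelyReducible ℂ Virasoro X :=
  have h := (isDualPair_dual hW hfin).splitting hc1 hg (hg.dual hW h1)
  hg.isCompletelyReducible hL hC hW (fun k => (h k).1.1) fun k => (h k).1.2

end Virasoro

end



noncomputable section

namespace Virasoro

variable {X : Type*} [AddCommGroup X] [Module ℂ X] {L : ℤ → Module.End ℂ X}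
  {W : ℤ → Submodule ℂ X} {c : ℂ}

/-! ### Vertex operator algebras as graded Virasoro modules -/

theorem mem_of_eigenvector (hW : DirectSum.IsInternal W) {T : Module.End ℂ X}
    (hT : ∀ n : ℤ, ∀ x ∈ W n, T x = (n : ℂ) • x) {n : ℤ} {y : X} (hy : T y = (n : ℂ) • y) :
    y ∈ W n := by
  have hyW : y ∈ ⨆ m, W m := hW.submodule_iSup_eq_top ▸ Submodule.mem_top
  obtain ⟨f, hf, hsum⟩ := (Submodule.mem_iSup_iff_exists_finsupp _ _).mp hyW
  have hmem := mem_of_sum_mem (M := Submodule.span ℂ {y}) hT (fun x hx => ?_) f.support f hf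
    (by change f.sum (fun _ x => x) ∈ _; rw [hsum]; exact Submodule.mem_span_singleton_self y)
  · rw [← hsum]
    refine sum_mem fun m hm => ?_
    obtain ⟨a, ha⟩ := Submodule.mem_span_singleton.mp (hmem m hm)
    have h1 := hT m _ (hf m)
    rw [← ha, map_smul, hy, smul_comm a, ha, ← sub_eq_zero, ← sub_smul] at h1
    rcases smul_eq_zero.mp h1 with h2 | h2
    · obtain rfl : n = m := by exact_mod_cast sub_eq_zero.mp h2
      exact hf n
    · rw [h2]
      exact zero_mem _
  · obtain ⟨a, rfl⟩ := Submodule.mem_span_singleton.mp hx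
    rw [map_smul, hy]
    exact Submodule.smul_mem _ _
      (Submodule.smul_mem _ _ (Submodule.mem_span_singleton_self y))

/-- `[L_0, L_m] = -m L_m`, so `L_m` shifts `L_0`-eigenvalues by `-m`, and the weight spaces are the
full eigenspaces. -/
theorem Relations.mode_mem (hr : Relations L c) (hW : DirectSum.IsInternal W)
    (hw : ∀ n : ℤ, ∀ x ∈ W n, L 0 x = (n : ℂ) • x) (m n : ℤ) {x : X} (hx : x ∈ W n) :
    L m x ∈ W (n - m) := by
  refine mem_of_eigenvector hW hw ?_
  have h := LinearMap.congr_fun (hr 0 m) x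
  simp only [LinearMap.sub_apply, Module.End.mul_apply, LinearMap.add_apply,
    LinearMap.smul_apply, Module.End.one_apply, hw n x hx, map_smul, zero_add, Int.cast_zero] at h
  rw [sub_eq_iff_eq_add] at h
  rw [h]
  push_cast
  split_ifs <;> module

/-- If `L_{-1}` kills weight `0`, then there are no negative weights. -/
theorem Relations.eq_bot_of_neg (hr : Relations L c) (hW : DirectSum.IsInternal W)
    (hw : ∀ n : ℤ, ∀ x ∈ W n, L 0 x = (n : ℂ) • x) (hbound : ∃ N : ℤ, ∀ n < N, W n = ⊥)
    (h0 : ∀ x ∈ W 0, L (-1) x = 0) (n : ℤ) (hn : n < 0) : W n = ⊥ := by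
  obtain ⟨N, hN⟩ := hbound
  suffices ∀ k : ℕ, ∀ n < N + k, n < 0 → W n = ⊥ from
    this (n + 1 - N).toNat n (by omega) hn
  intro k
  induction k with
  | zero => exact fun n hn _ => hN n (by simpa using hn)
  | succ k ih =>
    intro n hnk hn
    rw [eq_bot_iff]
    intro x hx
    have h1 : L 1 x = 0 := by
      have := hr.mode_mem hW hw 1 n hx
      rwa [ih (n - 1) (by push_cast at hnk; omega) (by omega), Submodule.mem_bot] at this
    have hmem : ∀ j : ℕ, (L (-1) ^ j) x ∈ W (n + j) := fun j => by
      induction j with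
      | zero => simpa using hx
      | succ j ihj =>
        have := hr.mode_mem hW hw (-1) _ ihj
        rw [pow_succ', Module.End.mul_apply]
        convert this using 2
        push_cast; ring
    -- The `sl₂` formula on a vector killed by `L_1`: the factor `2 n + j` is nonzero for `j ≤ -n`,
    -- so `L_{-1}` is injective along the string up to weight 0.
    have hcomm : ∀ j : ℕ, L 1 ((L (-1) ^ (j + 1)) x)
        = ((j + 1 : ℂ) * (2 * n + j)) • (L (-1) ^ j) x := fun j => by
      have hsl : ∀ y, L 1 (L (-1) y) = L (-1) (L 1 y) + (2 : ℂ) • L 0 y := fun y => by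
        have h := LinearMap.congr_fun (hr 1 (-1)) y
        simp only [LinearMap.sub_apply, Module.End.mul_apply, LinearMap.add_apply,
          LinearMap.smul_apply, Module.End.one_apply] at h
        rw [sub_eq_iff_eq_add] at h
        rw [h]
        norm_num
        abel
      induction j with
      | zero =>
        rw [pow_succ', Module.End.mul_apply, hsl, pow_zero, Module.End.one_apply, h1, map_zero,
          hw n x hx]
        push_cast
        module
      | succ j ihj =>
        rw [pow_succ', Module.End.mul_apply, hsl, ihj, hw _ _ (hmem (j + 1)), map_smul,
          ← Module.End.mul_apply, ← pow_succ']
        push_cast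
        module
    have hstep : ∀ j : ℕ, 2 * n + j < 0 → (L (-1) ^ (j + 1)) x = 0 → (L (-1) ^ j) x = 0 := by
      intro j hj hz
      have := hcomm j
      rw [hz, map_zero, eq_comm, smul_eq_zero, mul_eq_zero] at this
      rcases this with (h | h) | h
      · exact absurd h (by exact_mod_cast Nat.succ_ne_zero j)
      · exact absurd h (by exact_mod_cast hj.ne)
      · exact h
    -- After `-n` steps the string is in weight 0, where `L_{-1}` vanishes; descending the string
    -- then gives `x = 0`.
    have htop : (L (-1) ^ ((-n).toNat + 1)) x = 0 := by
      rw [pow_succ', Module.End.mul_apply]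
      refine h0 _ ?_
      have := hmem (-n).toNat
      rwa [Int.toNat_of_nonneg (by omega), add_neg_cancel] at this
    have hdown : ∀ j : ℕ, j ≤ (-n).toNat + 1 → (L (-1) ^ j) x = 0 := fun j hj => by
      induction hj using Nat.decreasingInduction with
      | of_succ j hj ihj => exact hstep j (by omega) ihj
      | self => exact htop
    simpa using hdown 0 (Nat.zero_le _)

end Virasoro

namespace VertexOperatorAlgebra

variable (V : Type*) [AddCommGroup V] [Module ℂ V] [VertexOperatorAlgebra V]

theorem L_neg_one_vacuum : L V (-1) vacuum = 0 := mode_vacuum (conformal : V) 0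

/-- A vertex operator algebra with `V_0 = ℂ𝟏` is a graded Virasoro module. -/
theorem isGraded (hV0 : weightSpace (V := V) 0 = Submodule.span ℂ {vacuum}) :
    Virasoro.IsGraded (L V) (centralCharge V) (weightSpace (V := V)) := by
  have hr : Virasoro.Relations (L V) (centralCharge V) := virasoro
  have hW : DirectSum.IsInternal (weightSpace (V := V)) := isInternal
  have hw : ∀ n : ℤ, ∀ x ∈ weightSpace (V := V) n, L V 0 x = (n : ℂ) • x := conformal_mode_one
  have h0 : ∀ x ∈ weightSpace (V := V) 0, L V (-1) x = 0 := by
    intro x hx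
    rw [hV0] at hx
    obtain ⟨a, rfl⟩ := Submodule.mem_span_singleton.mp hx
    rw [map_smul, L_neg_one_vacuum, smul_zero]
  exact ⟨hr, fun m n x hx => hr.mode_mem hW hw m n hx, hw,
    hr.eq_bot_of_neg hW hw weightSpace_eq_bot h0, h0⟩

end VertexOperatorAlgebra

theorem proposition3p3 (V : Type*) [AddCommGroup V] [Module ℂ V] [VertexOperatorAlgebra V]
    (hsimple : VertexOperatorAlgebra.IsSimple V)
    (hV0 : VertexOperatorAlgebra.weightSpace (V := V) 0
      = Submodule.span ℂ {VertexOperatorAlgebra.vacuum})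
    (hV1 : ∀ v ∈ VertexOperatorAlgebra.weightSpace (V := V) 1, VertexOperatorAlgebra.L V 1 v = 0)
    (c : ℝ) (hc : VertexOperatorAlgebra.centralCharge V = (c : ℂ)) (hc1 : 1 < c) :
    IsCompletelyReducible ℂ Virasoro V := by
  have hg := VertexOperatorAlgebra.isGraded V hV0
  rw [hc] at hg
  refine hg.isCompletelyReducible_of_one_lt hc1 (VertexOperatorAlgebra.virasoro_L_lie V)
    (fun v => ?_) VertexOperatorAlgebra.isInternal VertexOperatorAlgebra.finite_weightSpace hV1
  rw [VertexOperatorAlgebra.virasoro_C_lie, hc]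

end
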